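/- Let $n\ge 3$, let $h_1,\dots,h_{n-1}>0$, and let $E_{\boldsymbol h}\subset\mathbb R^n$ be the codimension-$2$ ellipsoid $$E_{\boldsymbol h}:\quad \sum_{i=1}^{n-1}\frac{x_i^2}{h_i^2}=1,\qquad x_n=0 .$$ A $\mathbb Z_2$-harmonic function on $\mathbb R^n$ whose branching set is a compact, smoothly embedded, co-oriented codimension-$2$ submanifold $\Sigma$ consists of a flat real line bundle $L$ over $\mathbb R^n\setminus\Sigma$ with structure group $\{\pm1\}$ such that every small loop linking $\Sigma$ has monodromy $-1$, and a section $f$ of $L$ (equivalently, a function on the corresponding double cover of $\mathbb R^n\setminus\Sigma$ that changes sign under the covering involution) such that $\Delta f=0$ on $\mathbb R^n\setminus\Sigma$ and $|f|,|\nabla f|\in L^2_{loc}(\mathbb R^n)$. Let $N$ be the normal bundle of $\Sigma$, regarded as a complex line bundle by means of the co-orientation, let $N^{1/2}$ be the square root of $N$ determined by the monodromy of $L$, and let $\zeta$ be the inverse of the normal exponential map, from a tubular neighbourhood of $\Sigma$ to $N$. The function $f$ is called non-degenerate if near $\Sigma$ $$f=\operatorname{Re}\big(B\,\zeta^{3/2}\big)+O(|\zeta|^{5/2})$$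 for a smooth nowhere vanishing section $B$ of $N^{-3/2}$ over $\Sigma$. Then there exists a non-degenerate $\mathbb Z_2$-harmonic function $f_{\boldsymbol h}$ on $\mathbb R^n$ whose branching set is $E_{\boldsymbol h}$ and such that, outside a large ball, there is a single-valued branch of $f_{\boldsymbol h}$ on which $$f_{\boldsymbol h}=a_0-\sum_{i=1}^n a_i x_i^2+O(|x|^{2-n})\qquad(|x|\to\infty).$$ Here, with $S(y)=\prod_{i=1}^{n-1}(y+h_i^2)$, the constants are given by the convergent integrals $$a_i=\frac{\prod_{j=1}^{n-1}h_j}{2}\int_0^\infty\frac{du}{(u^2+h_i^2)\sqrt{S(u^2)}}\quad(1\le i\le n-1),$$ $$a_n=-\frac{\prod_{j=1}^{n-1}h_j}{2}\int_0^\infty\frac{S'(u^2)\,du}{S(u^2)^{3/2}},\qquad a_0=\frac{\prod_{j=1}^{n-1}h_j}{2}\int_0^\infty\frac{du}{\sqrt{S(u^2)}}.$$ -/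

import Mathlib

open Set Filter Topology MeasureTheory InnerProductSpace Asymptotics
open scoped ContDiff

noncomputable section

namespace Z2Harmonic

/-- Euclidean space `ℝⁿ`. -/
abbrev Euc (n : ℕ) : Type := EuclideanSpace ℝ (Fin n)

/-- `Γ` is a smooth embedded submanifold of `ℝⁿ` of codimension two: near each of its points it is
the zero set of a smooth submersion to `ℝ²`. -/
def IsCodimTwoSubmanifold {n : ℕ} (Γ : Set (Euc n)) : Prop :=
  ∀ p ∈ Γ, ∃ (V : Set (Euc n)) (Φ : Euc n → Euc 2), IsOpen V ∧ p ∈ V ∧ ContDiffOn ℝ ∞ Φ V ∧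
    (∀ x ∈ V, Function.Surjective (fderiv ℝ Φ x)) ∧ Γ ∩ V = {x ∈ V | Φ x = 0}

/-- The normal space of `Γ` at `p`: the orthogonal complement of the tangent space. -/
def normalSpace {n : ℕ} (Γ : Set (Euc n)) (p : Euc n) : Submodule ℝ (Euc n) :=
  (Submodule.span ℝ (tangentConeAt ℝ Γ p))ᗮ

/-- A co-orientation of a codimension-two submanifold, given as the rotation by a right angle
`J q` of each normal plane, depending continuously on the base point. It makes the normal bundle
a complex line bundle. -/
structure IsCoorientation {n : ℕ} (Γ : Set (Euc n)) (J : Euc n → Euc n →L[ℝ] Euc n) : Prop where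
  continuousOn : ContinuousOn J Γ
  mem : ∀ q ∈ Γ, ∀ v ∈ normalSpace Γ q, J q v ∈ normalSpace Γ q
  orthogonal : ∀ q ∈ Γ, ∀ v ∈ normalSpace Γ q, inner ℝ (J q v) v = 0
  norm_eq : ∀ q ∈ Γ, ∀ v ∈ normalSpace Γ q, ‖J q v‖ = ‖v‖

/-- The point `exp_q (r e^{iθ} e)`, where `e` is a normal vector at `q`. -/
def normalPoint {n : ℕ} (J : Euc n → Euc n →L[ℝ] Euc n) (q e : Euc n) (r θ : ℝ) : Euc n :=
  q + r • (Real.cos θ • e + Real.sin θ • J q e)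

/-- A two-sheeted covering space of `ℝⁿ ∖ Γ`. It is the same thing as a flat real line bundle `L`
over `ℝⁿ ∖ Γ` with structure group `{±1}`: the points of the cover over `x` are the two unit
vectors of the fibre `L_x`. -/
structure DoubleCover {n : ℕ} (Γ : Set (Euc n)) where
  X : Type
  [top : TopologicalSpace X]
  proj : X → ↥(Γᶜ)
  isCoveringMap : IsCoveringMap proj
  surjective : Function.Surjective proj
  /-- the sheet-exchanging involution -/
  deck : X → X
  continuous_deck : Continuous deck
  deck_ne : ∀ y, deck y ≠ y
  proj_eq_iff : ∀ y z, proj z = proj y ↔ z = y ∨ z = deck y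

attribute [instance] DoubleCover.top

namespace DoubleCover

variable {n : ℕ} {Γ : Set (Euc n)} (C : DoubleCover Γ)

/-- Every small loop linking `Γ` has monodromy `-1`: each lift of it to the cover ends on the
sheet other than the one where it started. -/
def HasMonodromyNegOne (J : Euc n → Euc n →L[ℝ] Euc n) : Prop :=
  ∀ q ∈ Γ, ∀ e ∈ normalSpace Γ q, ‖e‖ = 1 → ∃ r₀ > 0, ∀ r, 0 < r → r < r₀ →
    (∀ θ, normalPoint J q e r θ ∉ Γ) ∧
    ∀ γ : ℝ → C.X, Continuous γ → (∀ θ, (C.proj (γ θ) : Euc n) = normalPoint J q e r θ) →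
      γ (2 * Real.pi) = C.deck (γ 0)

/-- A section of the flat line bundle is a function on the cover that is odd under the
involution. -/
def IsOdd (f : C.X → ℝ) : Prop := ∀ y, f (C.deck y) = -f y

/-- `g` is a single-valued branch on `V` of the two-valued function `f`. -/
def IsBranchOn (f : C.X → ℝ) (V : Set (Euc n)) (g : Euc n → ℝ) : Prop :=
  ∃ s : V → C.X, Continuous s ∧ (∀ x, (C.proj (s x) : Euc n) = x) ∧ ∀ x : V, g x = f (s x)

/-- The pointwise absolute value of a section; it is `0` on `Γ`, by convention. For a section the
set below has exactly one element if `x ∉ Γ`. -/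
def absValue (f : C.X → ℝ) (x : Euc n) : ℝ :=
  sSup {a : ℝ | ∃ y, (C.proj y : Euc n) = x ∧ a = |f y|}

/-- The pointwise norm of the gradient of a section, computed on a branch near the point; it is
`0` on `Γ`, by convention. -/
def gradNorm (f : C.X → ℝ) (x : Euc n) : ℝ :=
  sSup {a : ℝ | ∃ (V : Set (Euc n)) (g : Euc n → ℝ), IsOpen V ∧ x ∈ V ∧ C.IsBranchOn f V g ∧
    a = ‖gradient g x‖}

end DoubleCover

/-- `u` is locally square integrable on `ℝⁿ`. -/
def IsLocallyL2 {n : ℕ} (u : Euc n → ℝ) : Prop :=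
  ∀ K : Set (Euc n), IsCompact K → MemLp u 2 (volume.restrict K)

/-- `f` is a `ℤ₂`-harmonic function on `ℝⁿ` with branching set `Γ`, a compact co-oriented
submanifold of codimension two. -/
structure IsZ2HarmonicFunction {n : ℕ} (Γ : Set (Euc n)) (J : Euc n → Euc n →L[ℝ] Euc n)
    (C : DoubleCover Γ) (f : C.X → ℝ) : Prop where
  isCompact : IsCompact Γ
  isSubmanifold : IsCodimTwoSubmanifold Γ
  isCoorientation : IsCoorientation Γ J
  monodromy : C.HasMonodromyNegOne J
  odd : C.IsOdd f
  harmonic : ∀ (V : Set (Euc n)) (g : Euc n → ℝ), IsOpen V → C.IsBranchOn f V g →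
    HarmonicOnNhd g V
  locallyL2 : IsLocallyL2 (C.absValue f)
  gradient_locallyL2 : IsLocallyL2 (C.gradNorm f)

/-- Non-degeneracy: `f = Re (B ζ^{3/2}) + O(|ζ|^{5/2})` near `Γ`, with a nowhere vanishing smooth
section `B` of `N^{-3/2}`. Near each point of `Γ` a smooth unit normal field `e`
trivializes the complex line bundle `N`, so that `ζ = r e^{iθ}` at the point
`q + r (cos θ e + sin θ J e)`. The continuous lift `Λ` of this polar parametrization to the double
cover trivializes the square root of `N` given by the monodromy, so that
`ζ^{3/2} = r^{3/2} e^{3iθ/2}`, and `B` is a smooth complex-valued function. (Being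
the leading coefficient of `f`, the local sections `B` are unique and fit together.) -/
def IsNondegenerate {n : ℕ} (Γ : Set (Euc n)) (J : Euc n → Euc n →L[ℝ] Euc n)
    (C : DoubleCover Γ) (f : C.X → ℝ) : Prop :=
  ∀ p ∈ Γ, ∃ (W : Set (Euc n)) (e : Euc n → Euc n) (B : Euc n → ℂ) (r₀ K : ℝ)
      (Λ : Euc n × ℝ × ℝ → C.X),
    IsOpen W ∧ p ∈ W ∧ ContDiffOn ℝ ∞ e W ∧ ContDiffOn ℝ ∞ B W ∧ 0 < r₀ ∧
    (∀ q ∈ Γ ∩ W, e q ∈ normalSpace Γ q ∧ ‖e q‖ = 1 ∧ B q ≠ 0) ∧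
    ContinuousOn Λ ((Γ ∩ W) ×ˢ (Ioo 0 r₀ ×ˢ univ)) ∧
    ∀ q ∈ Γ ∩ W, ∀ r ∈ Ioo 0 r₀, ∀ θ : ℝ,
      (C.proj (Λ (q, r, θ)) : Euc n) = normalPoint J q (e q) r θ ∧
      |f (Λ (q, r, θ)) -
        (B q * ((r ^ (3 / 2 : ℝ) : ℝ) : ℂ) * Complex.exp (3 / 2 * θ * Complex.I)).re|
          ≤ K * r ^ (5 / 2 : ℝ)

variable {m : ℕ}

/-- The ellipsoid `∑ i < n, x_i² / h_i² = 1`, `x_n = 0` in `ℝⁿ`, where `n = m + 1`. -/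
def ellipsoid (h : Fin m → ℝ) : Set (Euc (m + 1)) :=
  {x | ∑ i : Fin m, x i.castSucc ^ 2 / h i ^ 2 = 1 ∧ x (Fin.last m) = 0}

/-- `S(y) = ∏ (y + h_i²)`. -/
def S (h : Fin m → ℝ) (y : ℝ) : ℝ := ∏ i, (y + h i ^ 2)

/-- The integrands of the coefficients. -/
def integrandConst (h : Fin m → ℝ) (u : ℝ) : ℝ := 1 / √(S h (u ^ 2))

def integrandSide (h : Fin m → ℝ) (i : Fin m) (u : ℝ) : ℝ :=
  1 / ((u ^ 2 + h i ^ 2) * √(S h (u ^ 2)))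

def integrandLast (h : Fin m → ℝ) (u : ℝ) : ℝ :=
  deriv (S h) (u ^ 2) / S h (u ^ 2) ^ (3 / 2 : ℝ)

/-- `a_0` -/
def coeffConst (h : Fin m → ℝ) : ℝ := (∏ j, h j) / 2 * ∫ u in Ioi (0 : ℝ), integrandConst h u

/-- `a_i` for `1 ≤ i ≤ n - 1` -/
def coeffSide (h : Fin m → ℝ) (i : Fin m) : ℝ :=
  (∏ j, h j) / 2 * ∫ u in Ioi (0 : ℝ), integrandSide h i u

/-- `a_n` -/
def coeffLast (h : Fin m → ℝ) : ℝ := -((∏ j, h j) / 2) * ∫ u in Ioi (0 : ℝ), integrandLast h u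

end Z2Harmonic

end

/-! The function is a classical ellipsoidal potential, written in coordinates that make its
two-valuedness visible. Off the disc `s = 0`, the number λ = s² solves ∑ x_i²/(λ + h_i²) + x_n²/λ =
1, the equation of the confocal family. Putting w = x_n/s turns it into the pair s·w = x_n, ∑
x_i²/(s² + h_i²) + w² = 1 of `IsLift`, which stays regular at s = 0. Over each point the solutions
form one pair ±(s, w) (`exists_isLift`, `IsLift.eq_or_eq_neg`), and the two members merge exactly on
the ellipsoid. Off it the Jacobian in (s, w) is nonzero (`IsLift.jacobian_pos`), so the set of
triples (x, s, w) is a double cover with deck map (s, w) ↦ (-s, -w).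

With φ(u) = S(u²)^(-1/2), the potential is formally half of ∏ h_j times ∫₀ˢ (1 - ∑ x_i²/(u² + h_i²)
- x_n²/u²) φ(u) du. The last term diverges at 0; since φ' = -u ∑ φ/(u² + h_i²), integration by parts
replaces it by its finite part, and this gives `potential`. The integrand vanishes at u = s, so
differentiating once produces no term from the moving endpoint (`hasFDerivAt_potential`).
Differentiating again and using the implicit derivatives of s and w gives zero Laplacian
(`harmonicAt_potential`). The expression is odd in (s, w). Both it and its differential are
continuous in (x, s, w), also where s = w = 0, so they are locally bounded and hence locally square
integrable.

At infinity the sheet s > 0 is single-valued, the primitives tend to the integrals over (0, ∞), and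
their tails give the error (`abs_potential_sub_le`).

Near a point q of the ellipsoid let a = ‖`conormal h q`‖. In polar normal coordinates (a s + i w)²
is 2 a r e^{iθ} up to O(r²), so s and w are of order √r and change sign when θ increases by 2π: this
is the monodromy. The potential is s w² - a² s³/3 = -Re (a s + i w)³/(3a) up to O(r^{5/2})
(`IsLift.abs_potential_sub_cubic_le`, `abs_cube_sub_le`). Its leading term is therefore a nonzero
multiple of r^{3/2} cos(3θ/2) (`exists_expansion`). -/

noncomputable section

/-! ### Signed ellipsoidal coordinates: existence, uniqueness up to sign, size. -/

namespace Z2Harmonic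

variable {m : ℕ} {h : Fin m → ℝ} {x : Euc (m + 1)} {s w s' w' : ℝ}

/-- `(s, w)` are the signed ellipsoidal coordinates of a point over `x`: the square of `s` is the
ellipsoidal coordinate of `x` for the family of quadrics confocal to the ellipsoid. -/
def IsLift (h : Fin m → ℝ) (x : Euc (m + 1)) (s w : ℝ) : Prop :=
  s * w = x (Fin.last m) ∧ ∑ i, x i.castSucc ^ 2 / (s ^ 2 + h i ^ 2) + w ^ 2 = 1

theorem sq_add_sq_pos (hpos : ∀ i, 0 < h i) (s : ℝ) (i : Fin m) : 0 < s ^ 2 + h i ^ 2 := by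
  have := hpos i
  positivity

theorem IsLift.neg (H : IsLift h x s w) : IsLift h x (-s) (-w) := by
  simpa [IsLift] using H

theorem isLift_zero_iff : IsLift h x 0 0 ↔ x ∈ ellipsoid h := by
  simp [IsLift, ellipsoid, and_comm, eq_comm]

theorem quadric_antitone (hpos : ∀ i, 0 < h i) (x : Euc (m + 1)) (hs : s ^ 2 ≤ s' ^ 2) :
    ∑ i : Fin m, x i.castSucc ^ 2 / (s' ^ 2 + h i ^ 2) ≤
      ∑ i : Fin m, x i.castSucc ^ 2 / (s ^ 2 + h i ^ 2) := by
  gcongr with i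
  exact sq_add_sq_pos hpos s i

/-- If s'² were larger, the quadric sum would not increase, so w'² ≥ w²; the common product s w = s'
w' then forces w = w' = 0. Both sums are now 1, so some x_i is nonzero and the sum is strictly
decreasing in s², a contradiction. -/
theorem IsLift.sq_le (hpos : ∀ i, 0 < h i) (H : IsLift h x s w) (H' : IsLift h x s' w') :
    s' ^ 2 ≤ s ^ 2 := by
  by_contra! hlt
  have h1 := quadric_antitone hpos x hlt.le
  have hw : w ^ 2 ≤ w' ^ 2 := by linarith [H.2, H'.2]
  have h2 : s ^ 2 * w ^ 2 = s' ^ 2 * w' ^ 2 := by rw [← mul_pow, ← mul_pow, H.1, H'.1]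
  have hw' : w' ^ 2 = 0 := by
    nlinarith [sq_nonneg w', sq_nonneg s, mul_le_mul_of_nonneg_left hw (sq_nonneg s)]
  have hw0 : w ^ 2 = 0 := le_antisymm (hw.trans hw'.le) (sq_nonneg w)
  have hlt' : ∑ i : Fin m, x i.castSucc ^ 2 / (s' ^ 2 + h i ^ 2) <
      ∑ i : Fin m, x i.castSucc ^ 2 / (s ^ 2 + h i ^ 2) := by
    obtain ⟨i, hi⟩ : ∃ i : Fin m, x i.castSucc ≠ 0 := by
      by_contra! h0
      have := H.2
      simp [h0, hw0] at this
    refine Finset.sum_lt_sum (fun j _ => ?_) ⟨i, Finset.mem_univ i, ?_⟩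
    · have := sq_add_sq_pos hpos s j
      gcongr
    · have := sq_add_sq_pos hpos s i
      have : 0 < x i.castSucc ^ 2 := by positivity
      gcongr
  linarith [H.2, H'.2]

theorem IsLift.sq_eq (hpos : ∀ i, 0 < h i) (H : IsLift h x s w) (H' : IsLift h x s' w') :
    s' ^ 2 = s ^ 2 ∧ w' ^ 2 = w ^ 2 := by
  have hs : s' ^ 2 = s ^ 2 := le_antisymm (H.sq_le hpos H') (H'.sq_le hpos H)
  refine ⟨hs, ?_⟩
  have h1 := H.2
  have h2 := H'.2
  rw [hs] at h2
  linarith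

/-- Equality of squares leaves four sign patterns. In a mixed one the fixed product s w forces a
coordinate to vanish, and then the pattern is also one of the two unmixed ones. -/
theorem IsLift.eq_or_eq_neg (hpos : ∀ i, 0 < h i) (H : IsLift h x s w) (H' : IsLift h x s' w') :
    (s' = s ∧ w' = w) ∨ (s' = -s ∧ w' = -w) := by
  obtain ⟨h1, h2⟩ := H.sq_eq hpos H'
  have h3 : s' * w' = s * w := by rw [H.1, H'.1]
  rcases sq_eq_sq_iff_eq_or_eq_neg.1 h1 with rfl | rfl <;>
    rcases sq_eq_sq_iff_eq_or_eq_neg.1 h2 with rfl | rfl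
  · simp
  · have : s' * w = 0 := by linarith
    rcases mul_eq_zero.1 this with rfl | rfl <;> simp
  · have : s * w' = 0 := by linarith
    rcases mul_eq_zero.1 this with rfl | rfl <;> simp
  · simp

theorem IsLift.ne_zero (H : IsLift h x s w) (hx : x ∉ ellipsoid h) : 0 < s ^ 2 + w ^ 2 := by
  by_contra! h0
  have hs : s = 0 := by nlinarith [sq_nonneg s, sq_nonneg w]
  have hw : w = 0 := by nlinarith [sq_nonneg s, sq_nonneg w]
  subst hs hw
  exact hx (isLift_zero_iff.1 H)

theorem norm_sq_eq (x : Euc (m + 1)) :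
    ‖x‖ ^ 2 = ∑ i : Fin m, x i.castSucc ^ 2 + x (Fin.last m) ^ 2 := by
  rw [EuclideanSpace.norm_sq_eq, Fin.sum_univ_castSucc]
  simp

theorem IsLift.sq_w_le_one (H : IsLift h x s w) : w ^ 2 ≤ 1 := by
  have : 0 ≤ ∑ i, x i.castSucc ^ 2 / (s ^ 2 + h i ^ 2) := by positivity
  linarith [H.2]

theorem IsLift.abs_w_le_one (H : IsLift h x s w) : |w| ≤ 1 :=
  (sq_le_one_iff_abs_le_one w).1 H.sq_w_le_one

theorem IsLift.sq_s_le (hpos : ∀ i, 0 < h i) (H : IsLift h x s w) : s ^ 2 ≤ ‖x‖ ^ 2 := by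
  have h1 : s ^ 2 = ∑ i, s ^ 2 * (x i.castSucc ^ 2 / (s ^ 2 + h i ^ 2)) + s ^ 2 * w ^ 2 := by
    rw [← Finset.mul_sum, ← mul_add, H.2, mul_one]
  have h2 : ∑ i, s ^ 2 * (x i.castSucc ^ 2 / (s ^ 2 + h i ^ 2)) ≤ ∑ i : Fin m, x i.castSucc ^ 2 := by
    refine Finset.sum_le_sum fun i _ => ?_
    have := sq_add_sq_pos hpos s i
    rw [mul_div_assoc', div_le_iff₀ this]
    nlinarith [mul_nonneg (sq_nonneg (x i.castSucc)) (sq_nonneg (h i))]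
  rw [norm_sq_eq, ← H.1, mul_pow]
  linarith

/-- Weight the identity ∑ x_i²/(s² + h_i²) + w² = 1 by s² + ∑ h_i², which dominates every s² + h_i²
and also s². Together with `IsLift.sq_s_le` this makes |s| comparable to ‖x‖ far away. -/
theorem IsLift.norm_sq_le (hpos : ∀ i, 0 < h i) (H : IsLift h x s w) :
    ‖x‖ ^ 2 ≤ s ^ 2 + ∑ i, h i ^ 2 := by
  have h1 : ∀ i, x i.castSucc ^ 2 ≤ (x i.castSucc ^ 2 / (s ^ 2 + h i ^ 2)) * (s ^ 2 + ∑ i, h i ^ 2) := by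
    intro i
    have := sq_add_sq_pos hpos s i
    rw [div_mul_eq_mul_div, le_div_iff₀ this]
    gcongr
    exact Finset.single_le_sum (f := fun i => h i ^ 2) (fun _ _ => sq_nonneg _) (Finset.mem_univ i)
  have h2 := Finset.sum_le_sum fun i (_ : i ∈ Finset.univ) => h1 i
  rw [← Finset.sum_mul] at h2
  have h3 : s ^ 2 * w ^ 2 ≤ w ^ 2 * (s ^ 2 + ∑ i, h i ^ 2) := by
    have : 0 ≤ ∑ i, h i ^ 2 := by positivity
    nlinarith [mul_nonneg (sq_nonneg w) this]
  rw [norm_sq_eq, ← H.1, mul_pow]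
  calc _ ≤ (∑ i, x i.castSucc ^ 2 / (s ^ 2 + h i ^ 2) + w ^ 2) * (s ^ 2 + ∑ i, h i ^ 2) := by
        rw [add_mul]; exact add_le_add h2 h3
    _ = _ := by rw [H.2, one_mul]

/-- The upper endpoint for the intermediate value theorem; t = ‖x‖ works because ‖x‖² x_i²/(‖x‖² +
h_i²) ≤ x_i². -/
theorem exists_quadric_le (hpos : ∀ i, 0 < h i) (x : Euc (m + 1)) :
    ∃ t : ℝ, 0 ≤ t ∧ x (Fin.last m) ^ 2 ≤
      t ^ 2 * (1 - ∑ i : Fin m, x i.castSucc ^ 2 / (t ^ 2 + h i ^ 2)) ∧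
      ∑ i : Fin m, x i.castSucc ^ 2 / (t ^ 2 + h i ^ 2) ≤ 1 := by
  have key : ∑ i : Fin m, ‖x‖ ^ 2 * (x i.castSucc ^ 2 / (‖x‖ ^ 2 + h i ^ 2)) ≤
      ∑ i : Fin m, x i.castSucc ^ 2 := by
    refine Finset.sum_le_sum fun i _ => ?_
    have := sq_add_sq_pos hpos ‖x‖ i
    rw [mul_div_assoc', div_le_iff₀ this]
    nlinarith [mul_nonneg (sq_nonneg (x i.castSucc)) (sq_nonneg (h i))]
  have hn := norm_sq_eq x
  refine ⟨‖x‖, norm_nonneg _, ?_, ?_⟩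
  · rw [mul_sub, mul_one, Finset.mul_sum]
    linarith
  · rcases eq_or_ne x 0 with rfl | hx
    · simp
    · have hx2 : 0 < ‖x‖ ^ 2 := by positivity
      rw [← Finset.mul_sum] at key
      nlinarith [sq_nonneg (x (Fin.last m))]

theorem continuous_quadric (hpos : ∀ i, 0 < h i) (x : Euc (m + 1)) :
    Continuous fun t : ℝ => ∑ i : Fin m, x i.castSucc ^ 2 / (t ^ 2 + h i ^ 2) :=
  continuous_finsetSum _ fun i _ => continuous_const.div (by fun_prop)
    fun t => (sq_add_sq_pos hpos t i).ne'

theorem exists_isLift (hpos : ∀ i, 0 < h i) (x : Euc (m + 1)) :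
    ∃ s w : ℝ, 0 ≤ s ∧ IsLift h x s w := by
  obtain ⟨t, ht, ht1, ht2⟩ := exists_quadric_le hpos x
  have hc := continuous_quadric hpos x
  -- On the hyperplane one coordinate must vanish: s = 0 inside the closed ellipsoid, w = 0 outside
  -- it. Off the hyperplane s is nonzero, so w is determined as x_n/s.
  by_cases hx : x (Fin.last m) = 0
  · by_cases hin : ∑ i : Fin m, x i.castSucc ^ 2 / (0 ^ 2 + h i ^ 2) ≤ 1
    · refine ⟨0, √(1 - ∑ i : Fin m, x i.castSucc ^ 2 / (0 ^ 2 + h i ^ 2)), le_rfl, by simp [hx], ?_⟩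
      rw [Real.sq_sqrt (by linarith)]
      ring
    · push Not at hin
      obtain ⟨s, hs, hs'⟩ := intermediate_value_Icc' ht hc.continuousOn ⟨ht2, hin.le⟩
      exact ⟨s, 0, hs.1, by simp [hx], by simpa using hs'⟩
  · have hc2 : Continuous fun t : ℝ =>
        t ^ 2 * (1 - ∑ i : Fin m, x i.castSucc ^ 2 / (t ^ 2 + h i ^ 2)) := by fun_prop
    obtain ⟨s, hs, hs'⟩ := intermediate_value_Icc ht hc2.continuousOn
      (show x (Fin.last m) ^ 2 ∈ _ from ⟨by simpa using sq_nonneg _, ht1⟩)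
    have hs0 : s ≠ 0 := by
      rintro rfl
      exact hx (by simpa using hs'.symm)
    refine ⟨s, x (Fin.last m) / s, hs.1, by field_simp, ?_⟩
    rw [div_pow, ← hs']
    field_simp
    ring

end Z2Harmonic

end

/-! ### Smooth dependence of the lifts on the point. -/

noncomputable section

namespace Z2Harmonic

variable {m : ℕ} {h : Fin m → ℝ} {x : Euc (m + 1)} {s w : ℝ}

/-- The negative of the derivative of the quadric `∑ x_i² / (y + h_i²)` with respect to `y`, at
`y = s²`. -/
def slope (h : Fin m → ℝ) (x : Euc (m + 1)) (s : ℝ) : ℝ :=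
  ∑ i : Fin m, x i.castSucc ^ 2 / (s ^ 2 + h i ^ 2) ^ 2

theorem slope_nonneg (h : Fin m → ℝ) (x : Euc (m + 1)) (s : ℝ) : 0 ≤ slope h x s := by
  unfold slope
  positivity

/-- This is half the determinant of the lift equations in (s, w). It can vanish only if w = 0 and
either s = 0, which puts x on the ellipsoid, or all x_i = 0, which contradicts the quadric equation.
-/
theorem IsLift.jacobian_pos (hpos : ∀ i, 0 < h i) (H : IsLift h x s w) (hx : x ∉ ellipsoid h) :
    0 < slope h x s * s ^ 2 + w ^ 2 := by
  have h0 := mul_nonneg (slope_nonneg h x s) (sq_nonneg s)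
  refine lt_of_le_of_ne (by positivity) fun h1 => ?_
  have hw : w = 0 := by nlinarith [sq_nonneg w]
  have hA : slope h x s * s ^ 2 = 0 := by nlinarith [sq_nonneg w]
  have hs : s ^ 2 ≠ 0 := by
    have := H.ne_zero hx
    rw [hw] at this
    intro h2
    simp [h2] at this
  have hA0 : slope h x s = 0 := by simpa [hs] using hA
  have hx0 : ∀ i : Fin m, x i.castSucc = 0 := by
    intro i
    have := (Finset.sum_eq_zero_iff_of_nonneg (fun i _ => by positivity)).1 hA0 i (Finset.mem_univ i)
    have h3 := (sq_add_sq_pos hpos s i).ne'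
    simpa [h3] using this
  have := H.2
  simp [hx0, hw] at this

theorem hasDerivAt_quadric (hpos : ∀ i, 0 < h i) {ξ : Fin m → ℝ → ℝ} {ξ' : Fin m → ℝ}
    {σ τ : ℝ → ℝ} {σ' τ' t : ℝ} (hξ : ∀ i, HasDerivAt (ξ i) (ξ' i) t) (hσ : HasDerivAt σ σ' t)
    (hτ : HasDerivAt τ τ' t) :
    HasDerivAt (fun t => ∑ i, ξ i t ^ 2 / (σ t ^ 2 + h i ^ 2) + τ t ^ 2)
      (∑ i, 2 * ξ i t * ξ' i / (σ t ^ 2 + h i ^ 2) -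
        2 * σ t * σ' * ∑ i, ξ i t ^ 2 / (σ t ^ 2 + h i ^ 2) ^ 2 + 2 * τ t * τ') t := by
  have h1 : ∀ i ∈ Finset.univ, HasDerivAt (fun t => ξ i t ^ 2 / (σ t ^ 2 + h i ^ 2))
      (2 * ξ i t * ξ' i / (σ t ^ 2 + h i ^ 2) -
        2 * σ t * σ' * (ξ i t ^ 2 / (σ t ^ 2 + h i ^ 2) ^ 2)) t := by
    intro i _
    have h2 := sq_add_sq_pos hpos (σ t) i
    refine (((hξ i).fun_pow 2).fun_div ((hσ.fun_pow 2).add_const (h i ^ 2)) h2.ne').congr_deriv ?_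
    field_simp
    push_cast
    ring
  refine ((HasDerivAt.fun_sum h1).fun_add (hτ.fun_pow 2)).congr_deriv ?_
  rw [Finset.sum_sub_distrib, Finset.mul_sum]
  push_cast
  ring

/-- The pair of functions whose joint level set is the graph of the lifts. -/
def liftEq (h : Fin m → ℝ) (p : Euc (m + 1) × (ℝ × ℝ)) : ℝ × ℝ :=
  (p.2.1 * p.2.2 - p.1 (Fin.last m),
    ∑ i : Fin m, p.1 i.castSucc ^ 2 / (p.2.1 ^ 2 + h i ^ 2) + p.2.2 ^ 2)

theorem isLift_iff_liftEq : IsLift h x s w ↔ liftEq h (x, s, w) = (0, 1) := by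
  simp [IsLift, liftEq, sub_eq_zero]

theorem contDiff_liftEq (hpos : ∀ i, 0 < h i) : ContDiff ℝ ∞ (liftEq h) := by
  unfold liftEq
  refine ContDiff.prodMk (by fun_prop) (ContDiff.add (ContDiff.sum fun i _ => ?_) (by fun_prop))
  exact ContDiff.div (by fun_prop) (by fun_prop) fun p => (sq_add_sq_pos hpos p.2.1 i).ne'

theorem fderiv_liftEq_apply (hpos : ∀ i, 0 < h i) (x v : Euc (m + 1)) (s w a b : ℝ) :
    fderiv ℝ (liftEq h) (x, s, w) (v, a, b) =
      (a * w + s * b - v (Fin.last m),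
        ∑ i : Fin m, 2 * x i.castSucc * v i.castSucc / (s ^ 2 + h i ^ 2)
          - 2 * s * a * slope h x s + 2 * w * b) := by
  have hd : DifferentiableAt ℝ (liftEq h) (x, s, w) :=
    (contDiff_liftEq hpos).differentiable (by simp) _
  have hline : ∀ c d : ℝ, HasDerivAt (fun t : ℝ => c + t * d) d 0 := fun c d => by
    simpa using ((hasDerivAt_id (0 : ℝ)).mul_const d).const_add c
  have h0 : HasDerivAt (fun t : ℝ => ((x, s, w) : Euc (m + 1) × (ℝ × ℝ)) + t • (v, a, b))
      (v, a, b) 0 := by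
    simpa using ((hasDerivAt_id (0 : ℝ)).smul_const
      ((v, a, b) : Euc (m + 1) × (ℝ × ℝ))).const_add (x, s, w)
  have h1 : HasDerivAt (fun t : ℝ => liftEq h ((x, s, w) + t • (v, a, b)))
      (fderiv ℝ (liftEq h) (x, s, w) (v, a, b)) 0 := by
    have hd' : HasFDerivAt (liftEq h) (fderiv ℝ (liftEq h) (x, s, w))
      ((x, s, w) + (0 : ℝ) • (v, a, b)) := by simpa using hd.hasFDerivAt
    exact hd'.comp_hasDerivAt 0 h0
  have h2 : HasDerivAt (fun t : ℝ => liftEq h ((x, s, w) + t • (v, a, b)))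
      (a * w + s * b - v (Fin.last m),
        ∑ i : Fin m, 2 * x i.castSucc * v i.castSucc / (s ^ 2 + h i ^ 2)
          - 2 * s * a * slope h x s + 2 * w * b) 0 := by
    have h3 := ((hline s a).fun_mul (hline w b)).fun_sub (hline (x (Fin.last m)) (v (Fin.last m)))
    have h4 := hasDerivAt_quadric hpos
      (fun i => hline (x (Fin.castSucc i)) (v i.castSucc)) (hline s a) (hline w b)
    refine ((h3.prodMk h4).congr_deriv ?_).congr_of_eventuallyEq (Eventually.of_forall fun t => ?_)
    · simp [slope]
    · simp [liftEq]
  exact h1.unique h2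

theorem IsLift.exists_smooth (hpos : ∀ i, 0 < h i) (H : IsLift h x s w) (hx : x ∉ ellipsoid h) :
    ∃ σ τ : Euc (m + 1) → ℝ, ContDiffAt ℝ ∞ σ x ∧ ContDiffAt ℝ ∞ τ x ∧ σ x = s ∧ τ x = w ∧
      ∀ᶠ y in 𝓝 x, IsLift h y (σ y) (τ y) := by
  have cdf : ContDiffAt ℝ ∞ (liftEq h) (x, s, w) := (contDiff_liftEq hpos).contDiffAt
  have hinv : (fderiv ℝ (liftEq h) (x, s, w) ∘L .inr ℝ (Euc (m + 1)) (ℝ × ℝ)).IsInvertible := by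
    set L := fderiv ℝ (liftEq h) (x, s, w) ∘L .inr ℝ (Euc (m + 1)) (ℝ × ℝ)
    have hinj : Function.Injective L.toLinearMap := by
      rw [← LinearMap.ker_eq_bot, LinearMap.ker_eq_bot']
      rintro ⟨a, b⟩ hab
      have : fderiv ℝ (liftEq h) (x, s, w) (0, a, b) = 0 := hab
      rw [fderiv_liftEq_apply hpos] at this
      simp only [PiLp.zero_apply, sub_zero, mul_zero, zero_div, Finset.sum_const_zero, zero_sub,
        Prod.mk_eq_zero] at this
      obtain ⟨e1, e2⟩ := this
      have hJ := H.jacobian_pos hpos hx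
      -- Cramer's rule: the combinations of the two linear equations are the rows of the adjugate
      -- matrix.
      have ha : (slope h x s * s ^ 2 + w ^ 2) * a = 0 := by linear_combination w * e1 - s / 2 * e2
      have hb : (slope h x s * s ^ 2 + w ^ 2) * b = 0 := by
        linear_combination s * slope h x s * e1 + w / 2 * e2
      simp only [mul_eq_zero, hJ.ne', false_or] at ha hb
      simp [ha, hb]
    exact ⟨(LinearEquiv.ofInjectiveEndo L.toLinearMap hinj).toContinuousLinearEquiv, by ext <;> rfl⟩
  set ψ := cdf.implicitFunction (by simp) hinv
  have hψ : ContDiffAt ℝ ∞ ψ x := cdf.contDiffAt_implicitFunction (by simp) hinv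
  have hψx : ψ x = (s, w) := cdf.implicitFunction_apply_self (by simp) hinv
  refine ⟨fun y => (ψ y).1, fun y => (ψ y).2, hψ.fst, hψ.snd, by simp [hψx], by simp [hψx], ?_⟩
  filter_upwards [cdf.eventually_apply_implicitFunction (by simp) hinv] with y hy
  exact isLift_iff_liftEq.2 (hy.trans (isLift_iff_liftEq.1 H))

/-- The chain rule applied to the constant `liftEq h (y, σ y, τ y)`. These two linear relations are
all that is ever used about the derivatives of σ and τ. -/
theorem fderiv_lift_relations (hpos : ∀ i, 0 < h i) {σ τ : Euc (m + 1) → ℝ}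
    (hσ : DifferentiableAt ℝ σ x) (hτ : DifferentiableAt ℝ τ x)
    (H : ∀ᶠ y in 𝓝 x, IsLift h y (σ y) (τ y)) (v : Euc (m + 1)) :
    σ x * fderiv ℝ τ x v + τ x * fderiv ℝ σ x v = v (Fin.last m) ∧
      ∑ i : Fin m, x i.castSucc * v i.castSucc / (σ x ^ 2 + h i ^ 2)
        - σ x * slope h x (σ x) * fderiv ℝ σ x v + τ x * fderiv ℝ τ x v = 0 := by
  have hd : DifferentiableAt ℝ (liftEq h) (x, σ x, τ x) :=
    (contDiff_liftEq hpos).differentiable (by simp) _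
  have hp : HasFDerivAt (fun y => (y, σ y, τ y)) _ x :=
    (hasFDerivAt_id x).prodMk (hσ.hasFDerivAt.prodMk hτ.hasFDerivAt)
  have h1 := HasFDerivAt.comp (g := liftEq h) x hd.hasFDerivAt hp
  have h2 : HasFDerivAt (fun y => liftEq h (y, σ y, τ y)) (0 : Euc (m + 1) →L[ℝ] ℝ × ℝ) x :=
    (hasFDerivAt_const ((0, 1) : ℝ × ℝ) x).congr_of_eventuallyEq
      (H.mono fun y hy => isLift_iff_liftEq.1 hy)
  have h3 := congrArg (fun L => L v) (h1.unique h2)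
  have h4 : fderiv ℝ (liftEq h) (x, σ x, τ x) (v, fderiv ℝ σ x v, fderiv ℝ τ x v) = 0 := h3
  rw [fderiv_liftEq_apply hpos, Prod.mk_eq_zero] at h4
  refine ⟨by linarith [h4.1], ?_⟩
  have h5 : ∑ i : Fin m, 2 * x i.castSucc * v i.castSucc / (σ x ^ 2 + h i ^ 2) =
      2 * ∑ i : Fin m, x i.castSucc * v i.castSucc / (σ x ^ 2 + h i ^ 2) := by
    rw [Finset.mul_sum]
    exact Finset.sum_congr rfl fun i _ => by ring
  rw [h5] at h4
  linarith [h4.2]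

end Z2Harmonic

end

/-! ### The double cover of the complement of the ellipsoid. -/

noncomputable section

namespace Z2Harmonic

variable {m : ℕ} {h : Fin m → ℝ} {x : Euc (m + 1)} {s w : ℝ}

theorem isClosed_ellipsoid (h : Fin m → ℝ) : IsClosed (ellipsoid h) :=
  (isClosed_eq (by fun_prop) continuous_const).inter (isClosed_eq (by fun_prop) continuous_const)

/-- Off the branching set, every lift extends to a smooth local lift. -/
theorem IsLift.exists_local (hpos : ∀ i, 0 < h i) (H : IsLift h x s w) (hx : x ∉ ellipsoid h) :
    ∃ (V : Set (Euc (m + 1))) (σ τ : Euc (m + 1) → ℝ), IsOpen V ∧ x ∈ V ∧ V ⊆ (ellipsoid h)ᶜ ∧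
      ContDiffOn ℝ 2 σ V ∧ ContDiffOn ℝ 2 τ V ∧ σ x = s ∧ τ x = w ∧
      ∀ y ∈ V, IsLift h y (σ y) (τ y) := by
  obtain ⟨σ, τ, hσ, hτ, hσx, hτx, hl⟩ := H.exists_smooth hpos hx
  have h1 := (hσ.of_le (m := 2) ENat.LEInfty.out).eventually (by simp)
  have h2 := (hτ.of_le (m := 2) ENat.LEInfty.out).eventually (by simp)
  have h3 := (isClosed_ellipsoid h).isOpen_compl.mem_nhds hx
  obtain ⟨V, hV, hVo, hxV⟩ := eventually_nhds_iff.1 (((h1.and h2).and hl).and h3)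
  exact ⟨V, σ, τ, hVo, hxV, fun y hy => (hV y hy).2,
    fun y hy => (hV y hy).1.1.1.contDiffWithinAt, fun y hy => (hV y hy).1.1.2.contDiffWithinAt,
    hσx, hτx, fun y hy => (hV y hy).1.2⟩

/-- The total space of the double cover. -/
def Cover (h : Fin m → ℝ) : Type :=
  {y : Euc (m + 1) × ℝ × ℝ // y.1 ∉ ellipsoid h ∧ IsLift h y.1 y.2.1 y.2.2}

namespace Cover

instance : TopologicalSpace (Cover h) := instTopologicalSpaceSubtype

/-- The point of `ℝⁿ` below a point of the cover. -/
def pt (y : Cover h) : Euc (m + 1) := y.1.1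
/-- The first signed coordinate of a point of the cover. -/
def sCoord (y : Cover h) : ℝ := y.1.2.1
/-- The second signed coordinate of a point of the cover. -/
def wCoord (y : Cover h) : ℝ := y.1.2.2

theorem isLift (y : Cover h) : IsLift h y.pt y.sCoord y.wCoord := y.2.2

theorem pt_notMem (y : Cover h) : y.pt ∉ ellipsoid h := y.2.1

theorem continuous_pt : Continuous (pt (h := h)) := continuous_subtype_val.fst
theorem continuous_sCoord : Continuous (sCoord (h := h)) := continuous_subtype_val.snd.fst
theorem continuous_wCoord : Continuous (wCoord (h := h)) := continuous_subtype_val.snd.snd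

/-- The point of the cover with given coordinates. -/
def mk (x : Euc (m + 1)) (s w : ℝ) (hx : x ∉ ellipsoid h) (H : IsLift h x s w) : Cover h :=
  ⟨(x, s, w), hx, H⟩

@[simp] theorem pt_mk (hx : x ∉ ellipsoid h) (H : IsLift h x s w) : (mk x s w hx H).pt = x := rfl
@[simp] theorem sCoord_mk (hx : x ∉ ellipsoid h) (H : IsLift h x s w) :
    (mk x s w hx H).sCoord = s := rfl
@[simp] theorem wCoord_mk (hx : x ∉ ellipsoid h) (H : IsLift h x s w) :
    (mk x s w hx H).wCoord = w := rfl

theorem ext {y z : Cover h} (h1 : y.pt = z.pt) (h2 : y.sCoord = z.sCoord)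
    (h3 : y.wCoord = z.wCoord) : y = z :=
  Subtype.ext (Prod.ext h1 (Prod.ext h2 h3))

theorem continuousOn_iff {α : Type*} [TopologicalSpace α] {f : α → Cover h} {t : Set α} :
    ContinuousOn f t ↔ ContinuousOn (fun a => (f a).pt) t ∧
      ContinuousOn (fun a => (f a).sCoord) t ∧ ContinuousOn (fun a => (f a).wCoord) t := by
  refine ⟨fun hf => ⟨continuous_pt.comp_continuousOn hf, continuous_sCoord.comp_continuousOn hf,
    continuous_wCoord.comp_continuousOn hf⟩, fun hf => ?_⟩
  exact Topology.IsInducing.subtypeVal.continuousOn_iff.2 (hf.1.prodMk (hf.2.1.prodMk hf.2.2))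

theorem continuous_iff {α : Type*} [TopologicalSpace α] {f : α → Cover h} :
    Continuous f ↔ Continuous (fun a => (f a).pt) ∧
      Continuous (fun a => (f a).sCoord) ∧ Continuous (fun a => (f a).wCoord) := by
  simp only [← continuousOn_univ, continuousOn_iff]

/-- The covering projection. -/
def proj (y : Cover h) : ↥(ellipsoid h)ᶜ := ⟨y.pt, y.pt_notMem⟩

theorem continuous_proj : Continuous (proj (h := h)) := continuous_pt.subtype_mk _

/-- The sheet-exchanging involution. -/
def deck (y : Cover h) : Cover h := mk y.pt (-y.sCoord) (-y.wCoord) y.pt_notMem y.isLift.neg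

@[simp] theorem pt_deck (y : Cover h) : y.deck.pt = y.pt := rfl
@[simp] theorem sCoord_deck (y : Cover h) : y.deck.sCoord = -y.sCoord := rfl
@[simp] theorem wCoord_deck (y : Cover h) : y.deck.wCoord = -y.wCoord := rfl

theorem continuous_deck : Continuous (deck (h := h)) :=
  continuous_iff.2 ⟨continuous_pt, continuous_sCoord.neg, continuous_wCoord.neg⟩

theorem deck_ne (y : Cover h) : y.deck ≠ y := by
  intro hy
  have h1 := congrArg sCoord hy
  have h2 := congrArg wCoord hy
  have h3 := y.isLift.ne_zero y.pt_notMem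
  rw [sCoord_deck] at h1
  rw [wCoord_deck] at h2
  nlinarith

theorem pt_eq_iff (hpos : ∀ i, 0 < h i) (y z : Cover h) : z.pt = y.pt ↔ z = y ∨ z = y.deck := by
  constructor
  · intro hyz
    have H := z.isLift
    rw [hyz] at H
    rcases y.isLift.eq_or_eq_neg hpos H with ⟨h1, h2⟩ | ⟨h1, h2⟩
    · exact Or.inl (ext hyz h1 h2)
    · exact Or.inr (ext hyz h1 h2)
  · rintro (rfl | rfl) <;> simp

theorem surjective_proj (hpos : ∀ i, 0 < h i) : Function.Surjective (proj (h := h)) := by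
  rintro ⟨x, hx⟩
  obtain ⟨s, w, -, H⟩ := exists_isLift hpos x
  exact ⟨mk x s w hx H, rfl⟩

theorem isCoveringMap_proj (hpos : ∀ i, 0 < h i) : IsCoveringMap (proj (h := h)) := by
  rintro ⟨x, hx⟩
  obtain ⟨s, w, -, H⟩ := exists_isLift hpos x
  obtain ⟨V, σ, τ, hVo, hxV, hVΓ, hσ, hτ, -, -, hl⟩ := H.exists_local hpos hx
  refine IsEvenlyCovered.to_isEvenlyCovered_preimage (I := Bool) ?_
  set U : Set ↥(ellipsoid h)ᶜ := Subtype.val ⁻¹' V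
  have hU : IsOpen U := hVo.preimage continuous_subtype_val
  -- A smooth local lift (σ, τ) labels the sheets: on a point of the cover s σ + w τ equals ±(σ² +
  -- τ²), which never vanishes, so its sign is the `Bool` coordinate of the trivialization.
  have hsign : ∀ y : Cover h, y.pt ∈ V → y.sCoord * σ y.pt + y.wCoord * τ y.pt ≠ 0 ∧
      (y.sCoord = σ y.pt ∧ y.wCoord = τ y.pt ∧ 0 < y.sCoord * σ y.pt + y.wCoord * τ y.pt ∨
      y.sCoord = -σ y.pt ∧ y.wCoord = -τ y.pt ∧ ¬ 0 < y.sCoord * σ y.pt + y.wCoord * τ y.pt) := by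
    intro y hy
    have h1 := (hl y.pt hy).ne_zero y.pt_notMem
    rcases (hl y.pt hy).eq_or_eq_neg hpos y.isLift with ⟨h2, h3⟩ | ⟨h2, h3⟩
    · rw [h2, h3]
      have : 0 < σ y.pt * σ y.pt + τ y.pt * τ y.pt := by nlinarith
      exact ⟨this.ne', Or.inl ⟨rfl, rfl, this⟩⟩
    · rw [h2, h3]
      have : -σ y.pt * σ y.pt + -τ y.pt * τ y.pt < 0 := by nlinarith
      exact ⟨this.ne, Or.inr ⟨rfl, rfl, this.not_gt⟩⟩
  have hcont : Continuous fun y : proj (h := h) ⁻¹' U =>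
      y.1.sCoord * σ y.1.pt + y.1.wCoord * τ y.1.pt := by
    have hpt : Continuous fun y : proj (h := h) ⁻¹' U => y.1.pt :=
      continuous_pt.comp continuous_subtype_val
    have h1 := hσ.continuousOn.comp_continuous hpt fun y => y.2
    have h2 := hτ.continuousOn.comp_continuous hpt fun y => y.2
    exact ((continuous_sCoord.comp continuous_subtype_val).mul h1).add
      ((continuous_wCoord.comp continuous_subtype_val).mul h2)
  let e : Bool → ℝ := fun b => bif b then 1 else -1
  have hlift : ∀ z : U × Bool, IsLift h z.1.1.1 (e z.2 * σ z.1.1.1) (e z.2 * τ z.1.1.1) := by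
    rintro ⟨z, b⟩
    have := hl z.1.1 z.2
    cases b
    · simpa [e] using this.neg
    · simpa [e] using this
  refine ⟨inferInstance, U, hxV, hU, hU.preimage continuous_proj,
    { toFun := fun y => (⟨proj y.1, y.2⟩,
        decide (0 < y.1.sCoord * σ y.1.pt + y.1.wCoord * τ y.1.pt))
      invFun := fun z => ⟨mk z.1.1.1 _ _ z.1.1.2 (hlift z), z.1.2⟩
      left_inv := ?_
      right_inv := ?_
      continuous_toFun := ?_
      continuous_invFun := ?_ }, fun y => rfl⟩
  · intro y
    refine Subtype.ext (ext rfl ?_ ?_)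
    · change e (decide _) * σ y.1.pt = _
      rcases (hsign y.1 y.2).2 with ⟨h1, h2, h3⟩ | ⟨h1, h2, h3⟩
      · rw [decide_eq_true h3, h1]
        simp [e]
      · rw [decide_eq_false h3, h1]
        simp [e]
    · change e (decide _) * τ y.1.pt = _
      rcases (hsign y.1 y.2).2 with ⟨h1, h2, h3⟩ | ⟨h1, h2, h3⟩
      · rw [decide_eq_true h3, h2]
        simp [e]
      · rw [decide_eq_false h3, h2]
        simp [e]
  · rintro ⟨z, b⟩
    refine Prod.ext rfl ?_
    have h1 := (hl z.1.1 z.2).ne_zero z.1.2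
    cases b
    · refine decide_eq_false ?_
      simp only [e, sCoord_mk, wCoord_mk, pt_mk, cond_false]
      nlinarith
    · refine decide_eq_true ?_
      simp only [e, sCoord_mk, wCoord_mk, pt_mk, cond_true]
      nlinarith
  · refine Continuous.prodMk
      ((continuous_proj.comp continuous_subtype_val).subtype_mk _) ?_
    rw [continuous_bool_rng true]
    have : (fun y : proj (h := h) ⁻¹' U =>
        decide (0 < y.1.sCoord * σ y.1.pt + y.1.wCoord * τ y.1.pt)) ⁻¹' {true} =
        {y | 0 < y.1.sCoord * σ y.1.pt + y.1.wCoord * τ y.1.pt} := by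
      ext y; simp
    rw [this]
    refine ⟨?_, isOpen_lt continuous_const hcont⟩
    have h2 : {y : proj (h := h) ⁻¹' U | 0 < y.1.sCoord * σ y.1.pt + y.1.wCoord * τ y.1.pt} =
        {y | 0 ≤ y.1.sCoord * σ y.1.pt + y.1.wCoord * τ y.1.pt} := by
      ext y
      exact ⟨fun hy => le_of_lt (a := (0 : ℝ)) hy,
        fun hy => lt_of_le_of_ne hy (hsign y.1 y.2).1.symm⟩
    rw [h2]
    exact isClosed_le continuous_const hcont
  · refine Continuous.subtype_mk (continuous_iff.2 ⟨?_, ?_, ?_⟩) _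
    · exact continuous_subtype_val.comp (continuous_subtype_val.comp continuous_fst)
    · exact ((continuous_of_discreteTopology (f := e)).comp continuous_snd).mul
        (hσ.continuousOn.comp_continuous (continuous_subtype_val.comp
          (continuous_subtype_val.comp continuous_fst)) fun z : U × Bool => z.1.2)
    · exact ((continuous_of_discreteTopology (f := e)).comp continuous_snd).mul
        (hτ.continuousOn.comp_continuous (continuous_subtype_val.comp
          (continuous_subtype_val.comp continuous_fst)) fun z : U × Bool => z.1.2)

end Cover

/-- The double cover of the complement of the ellipsoid. -/
def cover (h : Fin m → ℝ) (hpos : ∀ i, 0 < h i) : DoubleCover (ellipsoid h) where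
  X := Cover h
  proj := Cover.proj
  isCoveringMap := Cover.isCoveringMap_proj hpos
  surjective := Cover.surjective_proj hpos
  deck := Cover.deck
  continuous_deck := Cover.continuous_deck
  deck_ne := Cover.deck_ne
  proj_eq_iff y z := by rw [← Cover.pt_eq_iff hpos]; exact Subtype.ext_iff

/-- Two continuous lifts over a preconnected set either agree everywhere or are opposite
everywhere. -/
theorem lifts_eq_or_eq_deck (hpos : ∀ i, 0 < h i) {α : Type*} [TopologicalSpace α]
    [PreconnectedSpace α] {f g : α → Cover h} (hf : Continuous f) (hg : Continuous g)
    (hfg : ∀ a, (f a).pt = (g a).pt) : (∀ a, f a = g a) ∨ ∀ a, f a = (g a).deck := by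
  by_cases hne : ∃ a, f a = g a
  · obtain ⟨a, ha⟩ := hne
    left
    have := (Cover.isCoveringMap_proj hpos).eq_of_comp_eq hf hg
      (funext fun a => Subtype.ext (hfg a)) a ha
    exact fun b => congrFun this b
  · push Not at hne
    exact Or.inr fun a => ((Cover.pt_eq_iff hpos (g a) (f a)).1 (hfg a)).resolve_left (hne a)

end Z2Harmonic

end

/-! ### The potential and its harmonicity. -/

noncomputable section

namespace Z2Harmonic

variable {m : ℕ} {h : Fin m → ℝ} {x : Euc (m + 1)} {s w : ℝ}

theorem S_pos (hpos : ∀ i, 0 < h i) (s : ℝ) : 0 < S h (s ^ 2) :=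
  Finset.prod_pos fun i _ => sq_add_sq_pos hpos s i

theorem integrandConst_pos (hpos : ∀ i, 0 < h i) (s : ℝ) : 0 < integrandConst h s := by
  have := S_pos hpos s
  unfold integrandConst
  positivity

theorem integrandSide_eq (h : Fin m → ℝ) (i : Fin m) (s : ℝ) :
    integrandSide h i s = integrandConst h s / (s ^ 2 + h i ^ 2) := by
  unfold integrandSide integrandConst
  rw [div_div, mul_comm]

theorem deriv_S_eq (hpos : ∀ i, 0 < h i) (s : ℝ) :
    HasDerivAt (S h) (S h (s ^ 2) * ∑ i, 1 / (s ^ 2 + h i ^ 2)) (s ^ 2) := by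
  have h1 := HasDerivAt.fun_finsetProd (u := Finset.univ)
    (f := fun (i : Fin m) (y : ℝ) => y + h i ^ 2) (f' := fun _ => 1) (x := s ^ 2)
    fun i _ => (hasDerivAt_id _).add_const _
  refine h1.congr_deriv ?_
  rw [Finset.mul_sum]
  refine Finset.sum_congr rfl fun i _ => ?_
  rw [S, ← Finset.mul_prod_erase _ _ (Finset.mem_univ i)]
  have := (sq_add_sq_pos hpos s i).ne'
  simp only [smul_eq_mul, mul_one]
  field_simp

/-- The logarithmic derivative S'/S is ∑ 1/(y + h_i²). This ties the coefficient a_n to the side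
integrals. -/
theorem integrandLast_eq (hpos : ∀ i, 0 < h i) (s : ℝ) :
    integrandLast h s = ∑ i, integrandSide h i s := by
  have hS := S_pos hpos s
  have h3 : S h (s ^ 2) ^ (3 / 2 : ℝ) = S h (s ^ 2) * √(S h (s ^ 2)) := by
    rw [show (3 / 2 : ℝ) = 1 + 1 / 2 by norm_num, Real.rpow_add hS, Real.rpow_one,
      Real.sqrt_eq_rpow]
  rw [integrandLast, (deriv_S_eq hpos s).deriv, h3, mul_div_mul_left _ _ hS.ne', Finset.sum_div]
  exact Finset.sum_congr rfl fun i _ => by rw [integrandSide, div_div]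

theorem contDiff_integrandConst (hpos : ∀ i, 0 < h i) : ContDiff ℝ ∞ (integrandConst h) := by
  unfold integrandConst
  have h1 : ContDiff ℝ ∞ fun s : ℝ => S h (s ^ 2) := by
    unfold S
    exact contDiff_prod fun i _ => by fun_prop
  exact contDiff_const.div (h1.sqrt fun s => (S_pos hpos s).ne')
    fun s => (Real.sqrt_pos.2 (S_pos hpos s)).ne'

theorem contDiff_integrandSide (hpos : ∀ i, 0 < h i) (i : Fin m) :
    ContDiff ℝ ∞ (integrandSide h i) := by
  rw [funext (integrandSide_eq h i)]
  exact (contDiff_integrandConst hpos).div (by fun_prop) fun s => (sq_add_sq_pos hpos s i).ne'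

/-- The identity behind the integration by parts that removes the singular term x_n²/u² from the
potential; it also cancels terms in the first and second derivatives. -/
theorem hasDerivAt_integrandConst (hpos : ∀ i, 0 < h i) (s : ℝ) :
    HasDerivAt (integrandConst h) (-s * ∑ i, integrandSide h i s) s := by
  have hS := S_pos hpos s
  have h1 : HasDerivAt (fun s : ℝ => S h (s ^ 2)) _ s :=
    HasDerivAt.comp (h₂ := S h) (h := fun s : ℝ => s ^ 2) s (deriv_S_eq hpos s)
      (hasDerivAt_pow 2 s)
  have h2 := (h1.sqrt hS.ne').fun_inv (Real.sqrt_pos.2 hS).ne'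
  have h3 : integrandConst h = fun s => (√(S h (s ^ 2)))⁻¹ := by
    ext s
    rw [integrandConst, one_div]
  rw [h3]
  refine h2.congr_deriv ?_
  simp only [integrandSide_eq, h3]
  rw [Real.sq_sqrt hS.le]
  have h4 : ∑ i, (√(S h (s ^ 2)))⁻¹ / (s ^ 2 + h i ^ 2) =
      (√(S h (s ^ 2)))⁻¹ * ∑ i, 1 / (s ^ 2 + h i ^ 2) := by
    rw [Finset.mul_sum]
    exact Finset.sum_congr rfl fun i _ => by ring
  rw [h4]
  have := (Real.sqrt_pos.2 hS).ne'
  field_simp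
  norm_num
  ring

theorem contDiff_primitive {f : ℝ → ℝ} (hf : ContDiff ℝ ∞ f) :
    ContDiff ℝ ∞ fun s => ∫ u in (0 : ℝ)..s, f u := by
  have hd : ∀ s, HasDerivAt (fun s => ∫ u in (0 : ℝ)..s, f u) (f s) s := fun s =>
    hf.continuous.integral_hasStrictDerivAt 0 s |>.hasDerivAt
  rw [contDiff_infty_iff_deriv]
  exact ⟨fun s => (hd s).differentiableAt, by rwa [funext fun s => (hd s).deriv]⟩

/-- The primitive of `integrandConst` that vanishes at the origin. -/
def primConst (h : Fin m → ℝ) (s : ℝ) : ℝ := ∫ u in (0 : ℝ)..s, integrandConst h u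

/-- The primitive of `integrandSide` that vanishes at the origin. -/
def primSide (h : Fin m → ℝ) (i : Fin m) (s : ℝ) : ℝ := ∫ u in (0 : ℝ)..s, integrandSide h i u

theorem contDiff_primConst (hpos : ∀ i, 0 < h i) : ContDiff ℝ ∞ (primConst h) :=
  contDiff_primitive (contDiff_integrandConst hpos)

theorem contDiff_primSide (hpos : ∀ i, 0 < h i) (i : Fin m) : ContDiff ℝ ∞ (primSide h i) :=
  contDiff_primitive (contDiff_integrandSide hpos i)

theorem hasDerivAt_primConst (hpos : ∀ i, 0 < h i) (s : ℝ) :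
    HasDerivAt (primConst h) (integrandConst h s) s :=
  ((contDiff_integrandConst hpos).continuous.integral_hasStrictDerivAt 0 s).hasDerivAt

theorem hasDerivAt_primSide (hpos : ∀ i, 0 < h i) (i : Fin m) (s : ℝ) :
    HasDerivAt (primSide h i) (integrandSide h i s) s :=
  ((contDiff_integrandSide hpos i).continuous.integral_hasStrictDerivAt 0 s).hasDerivAt

/-- The harmonic function in terms of the point and of its signed ellipsoidal coordinates. -/
def potential (h : Fin m → ℝ) (x : Euc (m + 1)) (s w : ℝ) : ℝ :=
  (∏ j, h j) / 2 * (primConst h s +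
    ∑ i : Fin m, (x (Fin.last m) ^ 2 - x i.castSucc ^ 2) * primSide h i s +
    x (Fin.last m) * w * integrandConst h s)

/-- The coordinate functionals of `ℝⁿ`. -/
abbrev coord {n : ℕ} (j : Fin n) : Euc n →L[ℝ] ℝ := EuclideanSpace.proj j

/-- The differential of the harmonic function. -/
def potentialDeriv (h : Fin m → ℝ) (x : Euc (m + 1)) (s w : ℝ) : Euc (m + 1) →L[ℝ] ℝ :=
  (∏ j, h j) • (((x (Fin.last m) * ∑ i : Fin m, primSide h i s + w * integrandConst h s) •
    coord (Fin.last m)) -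
    ∑ i : Fin m, (x i.castSucc * primSide h i s) •
      coord i.castSucc)

theorem potentialDeriv_apply (h : Fin m → ℝ) (x v : Euc (m + 1)) (s w : ℝ) :
    potentialDeriv h x s w v = (∏ j, h j) *
      ((x (Fin.last m) * ∑ i : Fin m, primSide h i s + w * integrandConst h s) * v (Fin.last m) -
        ∑ i : Fin m, x i.castSucc * primSide h i s * v i.castSucc) := by
  simp [potentialDeriv, _root_.sum_apply]

theorem hasFDerivAt_coord (x : Euc (m + 1)) (j : Fin (m + 1)) :
    HasFDerivAt (fun y : Euc (m + 1) => y j)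
      (coord j) x :=
  (coord j).hasFDerivAt

section Local

variable {σ τ : Euc (m + 1) → ℝ}

/-- By the quadric equation the partial derivative in s reduces to φ w², up to the prefactor. The
moving coordinates therefore contribute φ w (w ds + s dw) = φ w dx_n, which doubles the term already
coming from x_n and absorbs the factor 1/2. -/
theorem hasFDerivAt_potential (hpos : ∀ i, 0 < h i) (hσ : DifferentiableAt ℝ σ x)
    (hτ : DifferentiableAt ℝ τ x) (H : ∀ᶠ y in 𝓝 x, IsLift h y (σ y) (τ y)) :
    HasFDerivAt (fun y => potential h y (σ y) (τ y)) (potentialDeriv h x (σ x) (τ x)) x := by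
  have hc := fun j => hasFDerivAt_coord x j
  have hP := (hasDerivAt_primConst hpos (σ x)).comp_hasFDerivAt x hσ.hasFDerivAt
  have hQ := fun i => (hasDerivAt_primSide hpos i (σ x)).comp_hasFDerivAt x hσ.hasFDerivAt
  have hφ := (hasDerivAt_integrandConst hpos (σ x)).comp_hasFDerivAt x hσ.hasFDerivAt
  have h1 := HasFDerivAt.fun_sum (u := Finset.univ) fun (i : Fin m) _ =>
    (((hc (Fin.last m)).pow 2).fun_sub ((hc i.castSucc).pow 2)).fun_mul (hQ i)
  have h2 := ((hP.fun_add h1).fun_add (((hc (Fin.last m)).fun_mul hτ.hasFDerivAt).fun_mul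
    hφ)).const_mul ((∏ j, h j) / 2)
  refine (h2.congr_fderiv ?_)
  ext v
  obtain ⟨r1, -⟩ := fderiv_lift_relations hpos hσ hτ H v
  have hx := H.self_of_nhds
  rw [potentialDeriv_apply]
  simp only [_root_.smul_apply, _root_.add_apply,
    _root_.sub_apply, _root_.sum_apply, smul_eq_mul, Function.comp_apply,
    PiLp.proj_apply, nsmul_eq_mul]
  set a := fderiv ℝ σ x v
  set b := fderiv ℝ τ x v
  set φ := integrandConst h (σ x)
  have e1 : ∑ i : Fin m, x i.castSucc ^ 2 * integrandSide h i (σ x) = φ * (1 - τ x ^ 2) := by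
    rw [← hx.2, add_sub_cancel_right, Finset.mul_sum]
    exact Finset.sum_congr rfl fun i _ => by rw [integrandSide_eq]; ring
  have e2 : ∑ i : Fin m, ((x (Fin.last m) ^ 2 - x i.castSucc ^ 2) * (integrandSide h i (σ x) * a) +
      primSide h i (σ x) * (((2 : ℕ) : ℝ) * x (Fin.last m) ^ (2 - 1) * v (Fin.last m) -
        ((2 : ℕ) : ℝ) * x i.castSucc ^ (2 - 1) * v i.castSucc)) =
      a * (x (Fin.last m) ^ 2 * ∑ i, integrandSide h i (σ x) -
        ∑ i : Fin m, x i.castSucc ^ 2 * integrandSide h i (σ x)) +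
      2 * x (Fin.last m) * v (Fin.last m) * ∑ i : Fin m, primSide h i (σ x) -
      2 * ∑ i : Fin m, x i.castSucc * primSide h i (σ x) * v i.castSucc := by
    simp only [Finset.mul_sum, ← Finset.sum_add_distrib, ← Finset.sum_sub_distrib]
    exact Finset.sum_congr rfl fun i _ => by push_cast; ring
  rw [e2, e1, ← hx.1, ← r1]
  ring

theorem contDiffAt_potential (hpos : ∀ i, 0 < h i) (hσ : ContDiffAt ℝ 2 σ x)
    (hτ : ContDiffAt ℝ 2 τ x) : ContDiffAt ℝ 2 (fun y => potential h y (σ y) (τ y)) x := by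
  have h0 : (2 : ℕ∞ω) ≤ ∞ := ENat.LEInfty.out
  have hP := ((contDiff_primConst hpos).of_le h0).contDiffAt.comp x hσ
  have hQ := fun i => ((contDiff_primSide hpos i).of_le h0).contDiffAt.comp x hσ
  have hφ := ((contDiff_integrandConst hpos).of_le h0).contDiffAt.comp x hσ
  exact contDiffAt_const.mul ((hP.add (ContDiffAt.sum fun i _ =>
    ContDiffAt.mul (by fun_prop) (hQ i))).add ((ContDiffAt.mul (by fun_prop) hτ).mul hφ))

/-- Only one derivative of σ and τ occurs, since `potentialDeriv` contains none. In the last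
component the term x_n ∑ φ/(s² + h_i²) dσ cancels w φ' dσ because x_n = s w. -/
theorem fderiv_fderiv_potential (hpos : ∀ i, 0 < h i) (hσ : ContDiffAt ℝ 2 σ x)
    (hτ : ContDiffAt ℝ 2 τ x) (H : ∀ᶠ y in 𝓝 x, IsLift h y (σ y) (τ y)) (v : Euc (m + 1)) :
    fderiv ℝ (fderiv ℝ fun y => potential h y (σ y) (τ y)) x v v = (∏ j, h j) *
      ((v (Fin.last m) * ∑ i, primSide h i (σ x) + integrandConst h (σ x) * fderiv ℝ τ x v) *
        v (Fin.last m) - ∑ i : Fin m, (v i.castSucc * primSide h i (σ x) +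
          x i.castSucc * integrandSide h i (σ x) * fderiv ℝ σ x v) * v i.castSucc) := by
  have hσ' := (hσ.differentiableAt (by simp)).hasFDerivAt
  have hτ' := (hτ.differentiableAt (by simp)).hasFDerivAt
  have h1 : HasFDerivAt (fderiv ℝ fun y => potential h y (σ y) (τ y)) _ x :=
    (((contDiffAt_potential hpos hσ hτ).fderiv_right (m := 1) (by norm_num)).differentiableAt
      (by simp)).hasFDerivAt
  have h2 := h1.clm_apply (hasFDerivAt_const v x)
  have h3 : (fun y => fderiv ℝ (fun y => potential h y (σ y) (τ y)) y v) =ᶠ[𝓝 x]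
      fun y => potentialDeriv h y (σ y) (τ y) v := by
    filter_upwards [hσ.eventually (by simp), hτ.eventually (by simp), H.eventually_nhds] with
      y hy1 hy2 hy3
    rw [(hasFDerivAt_potential hpos (hy1.differentiableAt (by simp))
      (hy2.differentiableAt (by simp)) hy3).fderiv]
  have hc := fun j => hasFDerivAt_coord x j
  have hQ := fun i => (hasDerivAt_primSide hpos i (σ x)).comp_hasFDerivAt x hσ'
  have hφ := (hasDerivAt_integrandConst hpos (σ x)).comp_hasFDerivAt x hσ'
  have h4 := ((((hc (Fin.last m)).fun_mul
    (HasFDerivAt.fun_sum (u := Finset.univ) fun i _ => hQ i)).fun_add (hτ'.fun_mul hφ)).mul_const (v (Fin.last m))).fun_sub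
    (HasFDerivAt.fun_sum (u := Finset.univ) fun (i : Fin m) _ =>
      ((hc i.castSucc).fun_mul (hQ i)).mul_const (v i.castSucc))
  have h5 := (h4.const_mul (∏ j, h j)).congr_of_eventuallyEq
    (h3.trans (Eventually.of_forall fun y => potentialDeriv_apply h y v (σ y) (τ y)))
  have h6 := congrArg (fun L => L v) (h2.unique h5)
  simp only [_root_.smul_apply, _root_.add_apply, _root_.sub_apply, _root_.sum_apply, smul_eq_mul,
    Function.comp_apply, PiLp.proj_apply, ContinuousLinearMap.comp_apply,
    ContinuousLinearMap.flip_apply, _root_.zero_apply, map_zero, zero_add] at h6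
  rw [h6, ← Finset.sum_mul, ← H.self_of_nhds.1]
  have e : ∑ i : Fin m, v i.castSucc * (x i.castSucc * (integrandSide h i (σ x) * fderiv ℝ σ x v) +
      primSide h i (σ x) * v i.castSucc) = ∑ i : Fin m, (v i.castSucc * primSide h i (σ x) +
        x i.castSucc * integrandSide h i (σ x) * fderiv ℝ σ x v) * v i.castSucc :=
    Finset.sum_congr rfl fun i _ => by ring
  rw [e]
  ring

/-- In the trace the primitives cancel, leaving φ ∂_n w - ∑ x_i φ/(s² + h_i²) ∂_i s. With J the
Jacobian, J ∂_n w and J ∑ x_i/(s² + h_i²) ∂_i s both equal s · `slope`. -/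
theorem harmonicAt_potential {V : Set (Euc (m + 1))} (hpos : ∀ i, 0 < h i) (hV : IsOpen V)
    (hVΓ : V ⊆ (ellipsoid h)ᶜ) (hσ : ContDiffOn ℝ 2 σ V) (hτ : ContDiffOn ℝ 2 τ V)
    (H : ∀ y ∈ V, IsLift h y (σ y) (τ y)) (hx : x ∈ V) :
    HarmonicAt (fun y => potential h y (σ y) (τ y)) x := by
  refine ⟨contDiffAt_potential hpos (hσ.contDiffAt (hV.mem_nhds hx))
    (hτ.contDiffAt (hV.mem_nhds hx)), ?_⟩
  filter_upwards [hV.mem_nhds hx] with y hy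
  have hσy := hσ.contDiffAt (hV.mem_nhds hy)
  have hτy := hτ.contDiffAt (hV.mem_nhds hy)
  have Hy : ∀ᶠ z in 𝓝 y, IsLift h z (σ z) (τ z) := eventually_of_mem (hV.mem_nhds hy) H
  have hJ := (H y hy).jacobian_pos hpos (hVΓ hy)
  have hrel := fderiv_lift_relations hpos (hσy.differentiableAt (by simp))
    (hτy.differentiableAt (by simp)) Hy
  rw [laplacian_eq_iteratedFDeriv_orthonormalBasis _ (EuclideanSpace.basisFun (Fin (m + 1)) ℝ)]
  simp only [iteratedFDeriv_two_apply, Matrix.cons_val_zero, Matrix.cons_val_one,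
    fderiv_fderiv_potential hpos hσy hτy Hy, Fin.sum_univ_castSucc, EuclideanSpace.basisFun_apply,
    PiLp.single_apply, Pi.zero_apply]
  have hside : ∀ i : Fin m, (slope h y (σ y) * σ y ^ 2 + τ y ^ 2) *
      fderiv ℝ σ y (EuclideanSpace.single i.castSucc 1) =
        σ y * (y i.castSucc / (σ y ^ 2 + h i ^ 2)) := by
    intro i
    obtain ⟨h1, h2⟩ := hrel (EuclideanSpace.single i.castSucc 1)
    simp [(Fin.castSucc_lt_last i).ne', ite_div] at h1 h2
    linear_combination τ y * h1 - σ y * h2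
  have hlast : (slope h y (σ y) * σ y ^ 2 + τ y ^ 2) *
      fderiv ℝ τ y (EuclideanSpace.single (Fin.last m) 1) = slope h y (σ y) * σ y := by
    obtain ⟨h1, h2⟩ := hrel (EuclideanSpace.single (Fin.last m) 1)
    simp [(Fin.castSucc_lt_last _).ne] at h1 h2
    linear_combination τ y * h2 + slope h y (σ y) * σ y * h1
  simp only [(Fin.castSucc_lt_last _).ne, (Fin.castSucc_lt_last _).ne', if_true, if_false,
    Fin.castSucc_inj, mul_ite, mul_one, mul_zero, ite_mul, one_mul, zero_mul, Finset.sum_ite_eq',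
    Finset.mem_univ, Finset.sum_const_zero, sub_zero, zero_sub]
  rw [← Finset.mul_sum, ← mul_add, Finset.sum_neg_distrib, Finset.sum_add_distrib]
  refine mul_eq_zero_of_right _ (mul_left_cancel₀ hJ.ne' ?_)
  have e : (slope h y (σ y) * σ y ^ 2 + τ y ^ 2) * ∑ i : Fin m,
      y i.castSucc * integrandSide h i (σ y) * fderiv ℝ σ y (EuclideanSpace.single i.castSucc 1) =
      integrandConst h (σ y) * (slope h y (σ y) * σ y) := by
    rw [slope, Finset.sum_mul _ _ (σ y), Finset.mul_sum, Finset.mul_sum, ← slope]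
    refine Finset.sum_congr rfl fun i _ => ?_
    have := (sq_add_sq_pos hpos (σ y) i).ne'
    rw [mul_left_comm, hside, integrandSide_eq]
    field_simp
  linear_combination integrandConst h (σ y) * hlast - e

end Local

end Z2Harmonic

end

/-! ### The two-valued function, its branches and local square integrability. -/

noncomputable section

namespace Z2Harmonic

variable {m : ℕ} {h : Fin m → ℝ} {x : Euc (m + 1)} {s w : ℝ}

theorem primitive_neg_of_even {f : ℝ → ℝ} (hf : ∀ u, f (-u) = f u) (s : ℝ) :
    ∫ u in (0 : ℝ)..(-s), f u = -∫ u in (0 : ℝ)..s, f u := by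
  have := intervalIntegral.integral_comp_neg (a := 0) (b := s) f
  simp only [hf, neg_zero] at this
  rw [this, intervalIntegral.integral_symm]

theorem integrandConst_neg (h : Fin m → ℝ) (s : ℝ) :
    integrandConst h (-s) = integrandConst h s := by
  simp [integrandConst]

theorem primConst_neg (h : Fin m → ℝ) (s : ℝ) : primConst h (-s) = -primConst h s :=
  primitive_neg_of_even (integrandConst_neg h) s

theorem primSide_neg (h : Fin m → ℝ) (i : Fin m) (s : ℝ) :
    primSide h i (-s) = -primSide h i s :=
  primitive_neg_of_even (fun u => by simp [integrandSide]) s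

theorem potential_neg (h : Fin m → ℝ) (x : Euc (m + 1)) (s w : ℝ) :
    potential h x (-s) (-w) = -potential h x s w := by
  simp only [potential, primConst_neg, primSide_neg, integrandConst_neg, mul_neg,
    Finset.sum_neg_distrib, neg_mul]
  ring

theorem potentialDeriv_neg (h : Fin m → ℝ) (x : Euc (m + 1)) (s w : ℝ) :
    potentialDeriv h x (-s) (-w) = -potentialDeriv h x s w := by
  ext v
  simp only [potentialDeriv_apply, primSide_neg, integrandConst_neg, mul_neg, _root_.neg_apply,
    Finset.sum_neg_distrib, neg_mul]
  ring

theorem continuous_potential (hpos : ∀ i, 0 < h i) :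
    Continuous fun p : Euc (m + 1) × ℝ × ℝ => potential h p.1 p.2.1 p.2.2 := by
  have h1 := (contDiff_primConst hpos).continuous
  have h2 := fun i => (contDiff_primSide hpos i).continuous
  have h3 := (contDiff_integrandConst hpos).continuous
  unfold potential
  fun_prop

/-- Continuity holds on the whole space of triples, including s = w = 0, so the gradient stays
bounded near the branching set. -/
theorem continuous_potentialDeriv (hpos : ∀ i, 0 < h i) :
    Continuous fun p : Euc (m + 1) × ℝ × ℝ => potentialDeriv h p.1 p.2.1 p.2.2 := by
  have h2 := fun i => (contDiff_primSide hpos i).continuous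
  have h3 := (contDiff_integrandConst hpos).continuous
  unfold potentialDeriv
  fun_prop

/-- The two-valued harmonic function, on the double cover. -/
def harmonicFn (h : Fin m → ℝ) (y : Cover h) : ℝ := potential h y.pt y.sCoord y.wCoord

theorem harmonicFn_deck (y : Cover h) : harmonicFn h y.deck = -harmonicFn h y :=
  potential_neg h y.pt y.sCoord y.wCoord

/-- Locally, a branch of the two-valued function is the potential along a smooth local lift. -/
theorem exists_local_of_isBranchOn (hpos : ∀ i, 0 < h i) {V : Set (Euc (m + 1))}
    {g : Euc (m + 1) → ℝ} (hV : IsOpen V) (hg : (cover h hpos).IsBranchOn (harmonicFn h) V g)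
    (hx : x ∈ V) :
    ∃ (U : Set (Euc (m + 1))) (σ τ : Euc (m + 1) → ℝ), IsOpen U ∧ x ∈ U ∧ U ⊆ (ellipsoid h)ᶜ ∧
      ContDiffOn ℝ 2 σ U ∧ ContDiffOn ℝ 2 τ U ∧ (∀ y ∈ U, IsLift h y (σ y) (τ y)) ∧
      ∀ᶠ y in 𝓝 x, g y = potential h y (σ y) (τ y) := by
  obtain ⟨sec, hsec, hproj, hgs⟩ := hg
  change V → Cover h at sec
  change ∀ z, (sec z).pt = z at hproj
  change ∀ z : V, g z = harmonicFn h (sec z) at hgs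
  replace hsec : Continuous sec := hsec
  have hl := (sec ⟨x, hx⟩).isLift
  have hx' := (sec ⟨x, hx⟩).pt_notMem
  rw [hproj] at hl hx'
  obtain ⟨U, σ, τ, hU, hxU, hUΓ, hσ, hτ, hσx, hτx, H⟩ := hl.exists_local hpos hx'
  refine ⟨U, σ, τ, hU, hxU, hUΓ, hσ, hτ, H, ?_⟩
  have hσc : ContinuousAt (fun z : V => σ z) ⟨x, hx⟩ :=
    ContinuousAt.comp (g := σ) (hσ.continuousOn.continuousAt (hU.mem_nhds hxU))
      continuous_subtype_val.continuousAt
  have hτc : ContinuousAt (fun z : V => τ z) ⟨x, hx⟩ :=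
    ContinuousAt.comp (g := τ) (hτ.continuousOn.continuousAt (hU.mem_nhds hxU))
      continuous_subtype_val.continuousAt
  -- Again s σ + w τ detects the sheet: it is positive at x, hence near x, and this rules out the
  -- section being the opposite of (σ, τ).
  have hcont : ContinuousAt (fun z : V => (sec z).sCoord * σ z + (sec z).wCoord * τ z) ⟨x, hx⟩ :=
    ((Cover.continuous_sCoord.comp hsec).continuousAt.mul hσc).add
      ((Cover.continuous_wCoord.comp hsec).continuousAt.mul hτc)
  have hpos0 : 0 < (sec ⟨x, hx⟩).sCoord * σ x + (sec ⟨x, hx⟩).wCoord * τ x := by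
    rw [hσx, hτx]
    have := hl.ne_zero hx'
    nlinarith
  have hev := hcont.eventually (lt_mem_nhds hpos0)
  rw [← hV.isOpenEmbedding_subtypeVal.map_nhds_eq ⟨x, hx⟩]
  rw [eventually_map]
  filter_upwards [hev, continuous_subtype_val.continuousAt (hU.mem_nhds hxU)] with z hz hzU
  have hlz := (sec z).isLift
  rw [hproj] at hlz
  rw [hgs, harmonicFn, hproj]
  have hnz := (H z hzU).ne_zero (hUΓ hzU)
  rcases (H z hzU).eq_or_eq_neg hpos hlz with ⟨h1, h2⟩ | ⟨h1, h2⟩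
  · rw [h1, h2]
  · rw [h1, h2] at hz
    nlinarith

theorem harmonicOnNhd_of_isBranchOn (hpos : ∀ i, 0 < h i) {V : Set (Euc (m + 1))}
    {g : Euc (m + 1) → ℝ} (hV : IsOpen V) (hg : (cover h hpos).IsBranchOn (harmonicFn h) V g) :
    HarmonicOnNhd g V := by
  intro x hx
  obtain ⟨U, σ, τ, hU, hxU, hUΓ, hσ, hτ, H, hgx⟩ := exists_local_of_isBranchOn hpos hV hg hx
  exact (harmonicAt_congr_nhds hgx).2 (harmonicAt_potential hpos hU hUΓ hσ hτ H hxU)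

theorem norm_gradient_of_isBranchOn (hpos : ∀ i, 0 < h i) {V : Set (Euc (m + 1))}
    {g : Euc (m + 1) → ℝ} (hV : IsOpen V) (hg : (cover h hpos).IsBranchOn (harmonicFn h) V g)
    (y : Cover h) (hx : y.pt ∈ V) :
    ‖gradient g y.pt‖ = ‖potentialDeriv h y.pt y.sCoord y.wCoord‖ := by
  obtain ⟨U, σ, τ, hU, hxU, hUΓ, hσ, hτ, H, hgx⟩ := exists_local_of_isBranchOn hpos hV hg hx
  have h1 := hasFDerivAt_potential hpos
    ((hσ.contDiffAt (hU.mem_nhds hxU)).differentiableAt (by simp))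
    ((hτ.contDiffAt (hU.mem_nhds hxU)).differentiableAt (by simp))
    (eventually_of_mem (hU.mem_nhds hxU) H)
  rw [gradient, LinearIsometryEquiv.norm_map, (h1.congr_of_eventuallyEq hgx).fderiv]
  rcases (H _ hxU).eq_or_eq_neg hpos y.isLift with ⟨h1, h2⟩ | ⟨h1, h2⟩
  · rw [h1, h2]
  · rw [h1, h2, potentialDeriv_neg, norm_neg]

/-- Makes the set in `gradNorm` nonempty, so that its supremum is the actual gradient norm and not
the default value. -/
theorem exists_isBranchOn (hpos : ∀ i, 0 < h i) (y : Cover h) :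
    ∃ (V : Set (Euc (m + 1))) (g : Euc (m + 1) → ℝ), IsOpen V ∧ y.pt ∈ V ∧
      (cover h hpos).IsBranchOn (harmonicFn h) V g := by
  obtain ⟨V, σ, τ, hV, hxV, hVΓ, hσ, hτ, -, -, H⟩ := y.isLift.exists_local hpos y.pt_notMem
  refine ⟨V, fun z => potential h z (σ z) (τ z), hV, hxV,
    fun z => Cover.mk z.1 (σ z) (τ z) (hVΓ z.2) (H z z.2), ?_, fun z => rfl, fun z => rfl⟩
  exact Cover.continuous_iff.2 ⟨continuous_subtype_val, hσ.continuousOn.domRestrict,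
    hτ.continuousOn.domRestrict⟩

theorem absValue_eq (hpos : ∀ i, 0 < h i) (y : Cover h) :
    (cover h hpos).absValue (harmonicFn h) y.pt = |harmonicFn h y| := by
  have : {a : ℝ | ∃ z : Cover h, z.pt = y.pt ∧ a = |harmonicFn h z|} = {|harmonicFn h y|} := by
    ext a
    constructor
    · rintro ⟨z, hz, rfl⟩
      rcases (Cover.pt_eq_iff hpos y z).1 hz with rfl | rfl
      · rfl
      · simp [harmonicFn_deck]
    · rintro rfl
      exact ⟨y, rfl, rfl⟩
  exact (congrArg sSup this).trans (csSup_singleton _)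

theorem gradNorm_eq (hpos : ∀ i, 0 < h i) (y : Cover h) :
    (cover h hpos).gradNorm (harmonicFn h) y.pt = ‖potentialDeriv h y.pt y.sCoord y.wCoord‖ := by
  have : {a : ℝ | ∃ (V : Set (Euc (m + 1))) (g : Euc (m + 1) → ℝ), IsOpen V ∧ y.pt ∈ V ∧
      (cover h hpos).IsBranchOn (harmonicFn h) V g ∧ a = ‖gradient g y.pt‖} =
      {‖potentialDeriv h y.pt y.sCoord y.wCoord‖} := by
    ext a
    constructor
    · rintro ⟨V, g, hV, hyV, hg, rfl⟩
      exact norm_gradient_of_isBranchOn hpos hV hg y hyV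
    · rintro rfl
      obtain ⟨V, g, hV, hyV, hg⟩ := exists_isBranchOn hpos y
      exact ⟨V, g, hV, hyV, hg, (norm_gradient_of_isBranchOn hpos hV hg y hyV).symm⟩
  exact (congrArg sSup this).trans (csSup_singleton _)

theorem absValue_of_mem (hpos : ∀ i, 0 < h i) (hx : x ∈ ellipsoid h) :
    (cover h hpos).absValue (harmonicFn h) x = 0 := by
  have : {a : ℝ | ∃ z : Cover h, z.pt = x ∧ a = |harmonicFn h z|} = ∅ := by
    ext a
    simp only [mem_ofPred_eq, mem_empty_iff_false, iff_false]
    rintro ⟨z, rfl, -⟩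
    exact z.pt_notMem hx
  exact (congrArg sSup this).trans Real.sSup_empty

theorem gradNorm_of_mem (hpos : ∀ i, 0 < h i) (hx : x ∈ ellipsoid h) :
    (cover h hpos).gradNorm (harmonicFn h) x = 0 := by
  have : {a : ℝ | ∃ (V : Set (Euc (m + 1))) (g : Euc (m + 1) → ℝ), IsOpen V ∧ x ∈ V ∧
      (cover h hpos).IsBranchOn (harmonicFn h) V g ∧ a = ‖gradient g x‖} = ∅ := by
    ext a
    simp only [mem_ofPred_eq, mem_empty_iff_false, iff_false]
    rintro ⟨V, g, -, hxV, ⟨sec, -, hsec, -⟩, -⟩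
    have h1 : (sec ⟨x, hxV⟩ : Cover h).pt = x := hsec ⟨x, hxV⟩
    refine (sec ⟨x, hxV⟩ : Cover h).pt_notMem ?_
    rwa [h1]
  exact (congrArg sSup this).trans Real.sSup_empty

/-- A function on the complement of the branching set is continuous if its pullback to the cover
is. -/
theorem continuousOn_compl_of_cover {α : Type*} [TopologicalSpace α] (hpos : ∀ i, 0 < h i)
    {u : Euc (m + 1) → α} (hu : Continuous fun y : Cover h => u y.pt) :
    ContinuousOn u (ellipsoid h)ᶜ := by
  rw [continuousOn_iff_continuous_domRestrict]
  exact ((Cover.isCoveringMap_proj hpos).isQuotientMap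
    (Cover.surjective_proj hpos)).continuous_iff.2 hu

/-- Since |s| ≤ ‖x‖ and |w| ≤ 1, the triples over a bounded set lie in a compact box, where `F` is
bounded. Measurability comes from continuity off the closed ellipsoid. -/
theorem isLocallyL2_of_cover (hpos : ∀ i, 0 < h i) {u : Euc (m + 1) → ℝ}
    {F : Euc (m + 1) × ℝ × ℝ → ℝ} (hF : Continuous F) (hΓ : ∀ x ∈ ellipsoid h, u x = 0)
    (hu : ∀ y : Cover h, u y.pt = F (y.pt, y.sCoord, y.wCoord)) : IsLocallyL2 u := by
  intro K hK
  have hcont : ContinuousOn u (ellipsoid h)ᶜ := continuousOn_compl_of_cover hpos <| by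
    simp only [hu]
    exact hF.comp (Cover.continuous_pt.prodMk
      (Cover.continuous_sCoord.prodMk Cover.continuous_wCoord))
  have hmeas : MeasurableSet (ellipsoid h)ᶜ := (isClosed_ellipsoid h).measurableSet.compl
  have hind : (ellipsoid h)ᶜ.indicator u = u :=
    indicator_eq_self.2 fun x hx hxΓ => hx (hΓ x hxΓ)
  have hsm : AEStronglyMeasurable u (volume : Measure (Euc (m + 1))) := by
    rw [← hind, aestronglyMeasurable_indicator_iff hmeas]
    exact hcont.aestronglyMeasurable hmeas
  obtain ⟨R, hR⟩ := hK.isBounded.subset_closedBall 0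
  have hcpt : IsCompact (Metric.closedBall (0 : Euc (m + 1)) R ×ˢ (Icc (-R) R ×ˢ Icc (-1 : ℝ) 1)) :=
    (isCompact_closedBall _ _).prod (isCompact_Icc.prod isCompact_Icc)
  obtain ⟨C, hC⟩ := hcpt.exists_bound_of_continuousOn hF.continuousOn
  have : IsFiniteMeasure (volume.restrict K) := isFiniteMeasure_restrict.2 hK.measure_lt_top.ne
  refine MemLp.of_bound hsm.restrict (max C 0) ((ae_restrict_iff' hK.measurableSet).2
    (Eventually.of_forall fun x hx => ?_))
  by_cases hxΓ : x ∈ ellipsoid h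
  · simp [hΓ x hxΓ]
  · obtain ⟨y, hy⟩ := Cover.surjective_proj hpos ⟨x, hxΓ⟩
    obtain rfl : y.pt = x := congrArg Subtype.val hy
    rw [hu]
    have h1 : ‖y.pt‖ ≤ R := by simpa using hR hx
    have h2 : |y.sCoord| ≤ R := (abs_le_of_sq_le_sq (y.isLift.sq_s_le hpos) (norm_nonneg _)).trans h1
    exact (hC _ ⟨hR hx, abs_le.1 h2, abs_le.1 y.isLift.abs_w_le_one⟩).trans (le_max_left _ _)

theorem isLocallyL2_absValue (hpos : ∀ i, 0 < h i) :
    IsLocallyL2 ((cover h hpos).absValue (harmonicFn h)) :=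
  isLocallyL2_of_cover hpos (continuous_potential hpos).abs (fun _ => absValue_of_mem hpos)
    (absValue_eq hpos)

theorem isLocallyL2_gradNorm (hpos : ∀ i, 0 < h i) :
    IsLocallyL2 ((cover h hpos).gradNorm (harmonicFn h)) :=
  isLocallyL2_of_cover hpos (continuous_potentialDeriv hpos).norm (fun _ => gradNorm_of_mem hpos)
    (gradNorm_eq hpos)

end Z2Harmonic

end

/-! ### Geometry of the ellipsoid: tangent cone, normal planes, co-orientation. -/

noncomputable section

namespace Z2Harmonic

variable {m : ℕ} {h : Fin m → ℝ} {x q v : Euc (m + 1)}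

/-- Half the gradient of the quadratic form `∑ x_i² / h_i²`. -/
def conormal (h : Fin m → ℝ) (x : Euc (m + 1)) : Euc (m + 1) :=
  WithLp.toLp 2 (Fin.lastCases (motive := fun _ => ℝ) 0 fun i => x i.castSucc / h i ^ 2)

@[simp] theorem conormal_castSucc (h : Fin m → ℝ) (x : Euc (m + 1)) (i : Fin m) :
    conormal h x i.castSucc = x i.castSucc / h i ^ 2 := by
  simp [conormal]

@[simp] theorem conormal_last (h : Fin m → ℝ) (x : Euc (m + 1)) :
    conormal h x (Fin.last m) = 0 := by
  simp [conormal]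

theorem inner_eq_sum (x y : Euc (m + 1)) :
    inner ℝ x y = ∑ i : Fin m, x i.castSucc * y i.castSucc + x (Fin.last m) * y (Fin.last m) := by
  simp [PiLp.inner_apply, Fin.sum_univ_castSucc, mul_comm]

theorem inner_conormal (h : Fin m → ℝ) (x v : Euc (m + 1)) :
    inner ℝ (conormal h x) v = ∑ i : Fin m, x i.castSucc * v i.castSucc / h i ^ 2 := by
  rw [inner_eq_sum]
  simp only [conormal_castSucc, conormal_last, zero_mul, add_zero]
  exact Finset.sum_congr rfl fun i _ => by ring

theorem norm_conormal_sq (h : Fin m → ℝ) (x : Euc (m + 1)) :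
    ‖conormal h x‖ ^ 2 = ∑ i : Fin m, x i.castSucc ^ 2 / (h i ^ 2) ^ 2 := by
  rw [norm_sq_eq]
  simp [div_pow]

theorem contDiff_conormal (h : Fin m → ℝ) : ContDiff ℝ ∞ (conormal h) := by
  rw [contDiff_euclidean]
  intro j
  refine Fin.lastCases ?_ (fun i => ?_) j
  · simpa using contDiff_const
  · simp only [conormal_castSucc]
    fun_prop

/-- The unit vector in the direction of the last coordinate. -/
def lastVec (m : ℕ) : Euc (m + 1) := EuclideanSpace.single (Fin.last m) 1

@[simp] theorem lastVec_last : lastVec m (Fin.last m) = 1 := by simp [lastVec]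

@[simp] theorem lastVec_castSucc (i : Fin m) : lastVec m i.castSucc = 0 := by
  simp [lastVec, (Fin.castSucc_lt_last i).ne]

theorem inner_lastVec (v : Euc (m + 1)) : inner ℝ (lastVec m) v = v (Fin.last m) := by
  simp [inner_eq_sum]

theorem norm_lastVec : ‖lastVec m‖ = 1 := by simp [lastVec]

/-- The outward unit normal of the ellipsoid inside the hyperplane `x_n = 0`. -/
def unitNormal (h : Fin m → ℝ) (x : Euc (m + 1)) : Euc (m + 1) :=
  ‖conormal h x‖⁻¹ • conormal h x

@[simp] theorem unitNormal_last (h : Fin m → ℝ) (x : Euc (m + 1)) :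
    unitNormal h x (Fin.last m) = 0 := by
  simp [unitNormal]

theorem inner_conormal_self (hq : q ∈ ellipsoid h) : inner ℝ (conormal h q) q = 1 := by
  rw [inner_conormal, ← hq.1]
  exact Finset.sum_congr rfl fun i _ => by ring

theorem conormal_ne_zero (hq : q ∈ ellipsoid h) : conormal h q ≠ 0 := by
  intro h0
  have := inner_conormal_self hq
  simp [h0] at this

theorem norm_unitNormal (hx : conormal h x ≠ 0) : ‖unitNormal h x‖ = 1 :=
  norm_smul_inv_norm (𝕜 := ℝ) hx

theorem contDiffAt_unitNormal (hx : conormal h x ≠ 0) : ContDiffAt ℝ ∞ (unitNormal h) x := by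
  have h1 := (contDiff_conormal h).contDiffAt (x := x)
  exact ((h1.norm ℝ hx).inv (norm_ne_zero_iff.2 hx)).smul h1

theorem inner_unitNormal_lastVec (h : Fin m → ℝ) (x : Euc (m + 1)) :
    inner ℝ (unitNormal h x) (lastVec m) = 0 := by
  rw [real_inner_comm, inner_lastVec, unitNormal_last]

theorem hasFDerivAt_quadForm (h : Fin m → ℝ) (x : Euc (m + 1)) :
    HasFDerivAt (fun y : Euc (m + 1) => ∑ i : Fin m, y i.castSucc ^ 2 / h i ^ 2)
      ((2 : ℝ) • innerSL ℝ (conormal h x)) x := by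
  have h1 := HasFDerivAt.fun_sum (u := Finset.univ) fun (i : Fin m) _ =>
    ((hasFDerivAt_coord x i.castSucc).pow 2).mul_const ((h i ^ 2)⁻¹)
  simp only [div_eq_mul_inv]
  refine h1.congr_fderiv ?_
  ext v
  simp only [_root_.smul_apply, _root_.sum_apply, innerSL_apply_apply, inner_conormal, smul_eq_mul,
    PiLp.proj_apply, nsmul_eq_mul, Finset.mul_sum]
  exact Finset.sum_congr rfl fun i _ => by push_cast; ring

theorem isCompact_ellipsoid (hpos : ∀ i, 0 < h i) : IsCompact (ellipsoid h) := by
  refine Metric.isCompact_of_isClosed_isBounded (isClosed_ellipsoid h) ?_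
  refine (Metric.isBounded_closedBall (x := (0 : Euc (m + 1)))
    (r := √(∑ i, h i ^ 2))).subset fun x hx => ?_
  have := (isLift_zero_iff.2 hx).norm_sq_le hpos
  rw [mem_closedBall_zero_iff]
  exact Real.le_sqrt_of_sq_le (by simpa using this)

theorem isCodimTwoSubmanifold_ellipsoid (h : Fin m → ℝ) : IsCodimTwoSubmanifold (ellipsoid h) := by
  intro p hp
  set Φ : Euc (m + 1) → Euc 2 := fun x =>
    !₂[∑ i : Fin m, x i.castSucc ^ 2 / h i ^ 2 - 1, x (Fin.last m)] with hΦdef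
  have hΦ : ContDiff ℝ ∞ Φ := by
    rw [contDiff_euclidean]
    intro j
    fin_cases j
    · simp only [Φ, Fin.zero_eta, Matrix.cons_val_zero]
      fun_prop
    · simp only [Φ, Fin.mk_one, Matrix.cons_val_one, Matrix.cons_val_fin_one]
      fun_prop
  refine ⟨{x | conormal h x ≠ 0}, Φ, isOpen_ne_fun (contDiff_conormal h).continuous
    continuous_const, conormal_ne_zero hp, hΦ.contDiffOn, fun x hx => ?_, ?_⟩
  · intro y
    have hx : conormal h x ≠ 0 := hx
    have hd : HasFDerivAt Φ (fderiv ℝ Φ x) x := (hΦ.differentiable (by simp) x).hasFDerivAt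
    have hcomp := fun j : Fin 2 => (coord j).hasFDerivAt.comp x hd
    have h0 := (hcomp 0).unique ((hasFDerivAt_quadForm h x).sub_const 1)
    have h1 := (hcomp 1).unique (hasFDerivAt_coord x (Fin.last m))
    -- The rows of the differential are 2⟨conormal, ·⟩ and the last coordinate; they are orthogonal,
    -- so the preimage is read off from the dual vectors.
    refine ⟨(y 0 / (2 * ‖conormal h x‖ ^ 2)) • conormal h x + y 1 • lastVec m, ?_⟩
    set v := (y 0 / (2 * ‖conormal h x‖ ^ 2)) • conormal h x + y 1 • lastVec m with hv
    have e0 := congrArg (fun L => L v) h0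
    have e1 := congrArg (fun L => L v) h1
    simp only [ContinuousLinearMap.comp_apply, PiLp.proj_apply, _root_.smul_apply,
      innerSL_apply_apply, smul_eq_mul] at e0 e1
    have hn : ‖conormal h x‖ ≠ 0 := norm_ne_zero_iff.2 hx
    ext j
    fin_cases j
    · refine e0.trans ?_
      rw [hv, inner_add_right, inner_smul_right, inner_smul_right, real_inner_self_eq_norm_sq,
        real_inner_comm, inner_lastVec, conormal_last]
      simp only [Fin.zero_eta]
      field_simp
      simp
    · refine e1.trans ?_
      simp [hv]
  · ext x
    constructor
    · rintro ⟨hx, hxV⟩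
      refine ⟨hxV, ?_⟩
      ext j
      fin_cases j
      · simp [Φ, hx.1]
      · simp [Φ, hx.2]
    · rintro ⟨hxV, hx⟩
      have h0 := congrArg (fun y : Euc 2 => y 0) hx
      have h1 := congrArg (fun y : Euc 2 => y 1) hx
      simp [Φ] at h0 h1
      exact ⟨⟨by linarith, h1⟩, hxV⟩

theorem inner_eq_zero_of_mem_tangentConeAt (hq : q ∈ ellipsoid h)
    (hv : v ∈ tangentConeAt ℝ (ellipsoid h) q) :
    inner ℝ (conormal h q) v = 0 ∧ v (Fin.last m) = 0 := by
  constructor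
  · have h1 := (hasFDerivAt_quadForm h q).hasFDerivWithinAt (s := ellipsoid h)
    have h2 : HasFDerivWithinAt (fun y : Euc (m + 1) => ∑ i : Fin m, y i.castSucc ^ 2 / h i ^ 2)
        (0 : Euc (m + 1) →L[ℝ] ℝ) (ellipsoid h) q :=
      (hasFDerivWithinAt_const (1 : ℝ) q _).congr (fun y hy => hy.1) hq.1
    simpa using h1.unique_on h2 hv
  · have h1 := (hasFDerivAt_coord q (Fin.last m)).hasFDerivWithinAt (s := ellipsoid h)
    have h2 : HasFDerivWithinAt (fun y : Euc (m + 1) => y (Fin.last m))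
        (0 : Euc (m + 1) →L[ℝ] ℝ) (ellipsoid h) q :=
      (hasFDerivWithinAt_const (0 : ℝ) q _).congr (fun y hy => hy.2) hq.2
    simpa using h1.unique_on h2 hv

theorem mem_tangentConeAt_ellipsoid (hq : q ∈ ellipsoid h)
    (h1 : inner ℝ (conormal h q) v = 0) (h2 : v (Fin.last m) = 0) :
    v ∈ tangentConeAt ℝ (ellipsoid h) q := by
  set β := ∑ i : Fin m, v i.castSucc ^ 2 / h i ^ 2 with hβ
  have hβ0 : 0 ≤ β := by positivity
  -- The quadratic form takes the value 1 + t² β at q + t v because v is conjugate to q, so radial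
  -- rescaling returns the line to the ellipsoid; the factor has zero derivative at t = 0.
  set c : ℝ → Euc (m + 1) := fun t => (√(1 + t ^ 2 * β))⁻¹ • (q + t • v) with hc
  have hc0 : c 0 = q := by simp [hc]
  have hcΓ : ∀ t, c t ∈ ellipsoid h := by
    intro t
    have hpos : 0 < 1 + t ^ 2 * β := by positivity
    refine ⟨?_, by simp [hc, hq.2, h2]⟩
    have e : ∀ i : Fin m, c t i.castSucc ^ 2 / h i ^ 2 = (1 + t ^ 2 * β)⁻¹ *
        (q i.castSucc ^ 2 / h i ^ 2 + 2 * t * (q i.castSucc * v i.castSucc / h i ^ 2) +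
          t ^ 2 * (v i.castSucc ^ 2 / h i ^ 2)) := by
      intro i
      simp only [hc, PiLp.smul_apply, PiLp.add_apply, smul_eq_mul, mul_pow, inv_pow]
      rw [Real.sq_sqrt hpos.le]
      ring
    rw [inner_conormal] at h1
    rw [Finset.sum_congr rfl fun i _ => e i, ← Finset.mul_sum, Finset.sum_add_distrib,
      Finset.sum_add_distrib, ← Finset.mul_sum, ← Finset.mul_sum, h1, hq.1, ← hβ]
    field_simp
    ring
  have hder : HasDerivAt c v 0 := by
    have e1 : HasDerivAt (fun t : ℝ => 1 + t ^ 2 * β) 0 0 := by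
      simpa using ((hasDerivAt_pow 2 (0 : ℝ)).mul_const β).const_add 1
    have e2 : HasDerivAt (fun t : ℝ => q + t • v) v 0 := by
      simpa using ((hasDerivAt_id (0 : ℝ)).smul_const v).const_add q
    exact (((e1.sqrt (by simp)).fun_inv (by simp)).fun_smul e2).congr_deriv (by simp)
  have h3 := (hder.hasFDerivAt.hasFDerivWithinAt (s := univ)).mapsTo_tangent_cone
    (show (1 : ℝ) ∈ tangentConeAt ℝ univ 0 by simp)
  rw [hc0] at h3
  refine tangentConeAt_mono ?_ (by simpa using h3)
  rintro _ ⟨t, -, rfl⟩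
  exact hcΓ t

/-- For a normal vector, the remainder after removing its components along the two orthonormal
directions lies in the tangent cone, so it is orthogonal to itself. -/
theorem mem_normalSpace_iff (hq : q ∈ ellipsoid h) :
    v ∈ normalSpace (ellipsoid h) q ↔ ∃ a b : ℝ, v = a • unitNormal h q + b • lastVec m := by
  have hν := norm_unitNormal (conormal_ne_zero hq)
  have hν0 : ‖conormal h q‖ ≠ 0 := norm_ne_zero_iff.2 (conormal_ne_zero hq)
  constructor
  · intro hv
    refine ⟨inner ℝ (unitNormal h q) v, v (Fin.last m), ?_⟩
    set u := v - (inner ℝ (unitNormal h q) v • unitNormal h q + v (Fin.last m) • lastVec m) with hu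
    have hun : inner ℝ (unitNormal h q) u = 0 := by
      rw [hu, inner_sub_right, inner_add_right, inner_smul_right, inner_smul_right,
        inner_unitNormal_lastVec, real_inner_self_eq_norm_sq, hν]
      ring
    have hul : u (Fin.last m) = 0 := by simp [hu]
    have huc : inner ℝ (conormal h q) u = 0 := by
      rw [unitNormal, inner_smul_left] at hun
      simpa [hν0, conormal_ne_zero hq] using hun
    have h1 := (Submodule.mem_orthogonal _ _).1 hv u
      (Submodule.subset_span (mem_tangentConeAt_ellipsoid hq huc hul))
    have h2 : inner ℝ u u = 0 := by
      nth_rw 2 [hu]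
      rw [inner_sub_right, h1, inner_add_right, inner_smul_right, inner_smul_right,
        real_inner_comm (unitNormal h q) u, hun, real_inner_comm (lastVec m) u, inner_lastVec, hul]
      ring
    rw [← sub_eq_zero]
    exact inner_self_eq_zero.1 h2
  · rintro ⟨a, b, rfl⟩
    refine (Submodule.mem_orthogonal _ _).2 fun u hu => ?_
    induction hu using Submodule.span_induction with
    | mem u hu =>
      obtain ⟨h1, h2⟩ := inner_eq_zero_of_mem_tangentConeAt hq hu
      rw [inner_add_right, inner_smul_right, inner_smul_right, real_inner_comm, unitNormal,
        inner_smul_left, h1, real_inner_comm, inner_lastVec, h2]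
      simp
    | zero => simp
    | add u u' _ _ h1 h2 => rw [inner_add_left, h1, h2, add_zero]
    | smul c u _ h1 => rw [inner_smul_left, h1, mul_zero]

/-- The rotation by a right angle of the normal planes of the ellipsoid. -/
def rotation (h : Fin m → ℝ) (q : Euc (m + 1)) : Euc (m + 1) →L[ℝ] Euc (m + 1) :=
  (innerSL ℝ (unitNormal h q)).smulRight (lastVec m) -
    (innerSL ℝ (lastVec m)).smulRight (unitNormal h q)

theorem rotation_apply (hq : q ∈ ellipsoid h) (a b : ℝ) :
    rotation h q (a • unitNormal h q + b • lastVec m) = a • lastVec m - b • unitNormal h q := by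
  have hν := norm_unitNormal (conormal_ne_zero hq)
  simp [rotation, inner_add_right, inner_smul_right, inner_unitNormal_lastVec, inner_lastVec,
    norm_lastVec, hν]

theorem norm_sq_normal (hq : q ∈ ellipsoid h) (a b : ℝ) :
    ‖a • unitNormal h q + b • lastVec m‖ ^ 2 = a ^ 2 + b ^ 2 := by
  have hν := norm_unitNormal (conormal_ne_zero hq)
  rw [norm_add_sq_real, norm_smul, norm_smul, hν, norm_lastVec, inner_smul_left, inner_smul_right,
    inner_unitNormal_lastVec]
  simp

theorem continuousOn_unitNormal (h : Fin m → ℝ) : ContinuousOn (unitNormal h) (ellipsoid h) :=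
  fun _ hq => (contDiffAt_unitNormal (conormal_ne_zero hq)).continuousAt.continuousWithinAt

theorem isCoorientation_rotation (h : Fin m → ℝ) : IsCoorientation (ellipsoid h) (rotation h) where
  continuousOn := by
    have h1 := continuousOn_unitNormal h
    have h2 : Continuous fun e : Euc (m + 1) => (innerSL ℝ e).smulRight (lastVec m) -
        (innerSL ℝ (lastVec m)).smulRight e := by
      fun_prop
    exact h2.comp_continuousOn h1
  mem q hq v hv := by
    obtain ⟨a, b, rfl⟩ := (mem_normalSpace_iff hq).1 hv
    rw [rotation_apply hq]
    exact (mem_normalSpace_iff hq).2 ⟨-b, a, by module⟩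
  orthogonal q hq v hv := by
    obtain ⟨a, b, rfl⟩ := (mem_normalSpace_iff hq).1 hv
    have hν := norm_unitNormal (conormal_ne_zero hq)
    rw [rotation_apply hq]
    simp only [inner_sub_left, inner_add_right, inner_smul_left, inner_smul_right,
      inner_unitNormal_lastVec, real_inner_comm (unitNormal h q) (lastVec m),
      real_inner_self_eq_norm_sq, hν, norm_lastVec]
    simp
    ring
  norm_eq q hq v hv := by
    obtain ⟨a, b, rfl⟩ := (mem_normalSpace_iff hq).1 hv
    rw [rotation_apply hq, ← sq_eq_sq₀ (norm_nonneg _) (norm_nonneg _), norm_sq_normal hq,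
      show a • lastVec m - b • unitNormal h q = (-b) • unitNormal h q + a • lastVec m by module,
      norm_sq_normal hq]
    ring

end Z2Harmonic

end

/-! ### Polar coordinates around the ellipsoid and the monodromy. -/

noncomputable section

namespace Z2Harmonic

variable {m : ℕ} {h : Fin m → ℝ} {x q v : Euc (m + 1)} {r θ : ℝ}

/-- The absolute value of the first signed coordinate of the points over `x`. -/
def absS (h : Fin m → ℝ) (hpos : ∀ i, 0 < h i) (x : Euc (m + 1)) : ℝ :=
  (exists_isLift hpos x).choose

/-- The absolute value of the second signed coordinate of the points over `x`. -/
def absW (h : Fin m → ℝ) (hpos : ∀ i, 0 < h i) (x : Euc (m + 1)) : ℝ :=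
  |(exists_isLift hpos x).choose_spec.choose|

theorem absS_nonneg (hpos : ∀ i, 0 < h i) (x : Euc (m + 1)) : 0 ≤ absS h hpos x :=
  (exists_isLift hpos x).choose_spec.choose_spec.1

theorem absW_nonneg (hpos : ∀ i, 0 < h i) (x : Euc (m + 1)) : 0 ≤ absW h hpos x := abs_nonneg _

theorem IsLift.absS_eq {s w : ℝ} (hpos : ∀ i, 0 < h i) (H : IsLift h x s w) :
    absS h hpos x = |s| := by
  have h1 := (H.sq_eq hpos (exists_isLift hpos x).choose_spec.choose_spec.2).1
  rw [← abs_of_nonneg (absS_nonneg hpos x)]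
  exact sq_eq_sq_iff_abs_eq_abs _ _ |>.1 h1

theorem IsLift.absW_eq {s w : ℝ} (hpos : ∀ i, 0 < h i) (H : IsLift h x s w) :
    absW h hpos x = |w| := by
  have h1 := (H.sq_eq hpos (exists_isLift hpos x).choose_spec.choose_spec.2).2
  exact sq_eq_sq_iff_abs_eq_abs _ _ |>.1 h1

theorem continuousOn_absS (hpos : ∀ i, 0 < h i) : ContinuousOn (absS h hpos) (ellipsoid h)ᶜ :=
  continuousOn_compl_of_cover hpos <| by
    simp only [fun y : Cover h => y.isLift.absS_eq hpos]
    exact Cover.continuous_sCoord.abs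

theorem continuousOn_absW (hpos : ∀ i, 0 < h i) : ContinuousOn (absW h hpos) (ellipsoid h)ᶜ :=
  continuousOn_compl_of_cover hpos <| by
    simp only [fun y : Cover h => y.isLift.absW_eq hpos]
    exact Cover.continuous_wCoord.abs

theorem quadric_absS (hpos : ∀ i, 0 < h i) (x : Euc (m + 1)) :
    ∑ i, x i.castSucc ^ 2 / (absS h hpos x ^ 2 + h i ^ 2) + absW h hpos x ^ 2 = 1 := by
  have := (exists_isLift hpos x).choose_spec.choose_spec.2.2
  rwa [← sq_abs (exists_isLift hpos x).choose_spec.choose] at this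

theorem absS_mul_absW (hpos : ∀ i, 0 < h i) (x : Euc (m + 1)) :
    absS h hpos x * absW h hpos x = |x (Fin.last m)| := by
  have := (exists_isLift hpos x).choose_spec.choose_spec.2.1
  rw [← this, abs_mul]
  change _ = |absS h hpos x| * absW h hpos x
  rw [abs_of_nonneg (absS_nonneg hpos x)]

theorem absS_eq_zero (hpos : ∀ i, 0 < h i) (hx : x (Fin.last m) = 0)
    (hlt : ∑ i : Fin m, x i.castSucc ^ 2 / h i ^ 2 < 1) : absS h hpos x = 0 := by
  have h1 := absS_mul_absW hpos x
  rw [hx, abs_zero, mul_eq_zero] at h1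
  refine h1.resolve_right fun hw => ?_
  have h2 := quadric_absS hpos x
  have h3 := quadric_antitone hpos x (s := 0) (s' := absS h hpos x) (by simpa using sq_nonneg _)
  rw [hw] at h2
  simp only [ne_eq, OfNat.ofNat_ne_zero, not_false_eq_true, zero_pow, zero_add, add_zero] at h2 h3
  linarith

theorem absW_eq_zero (hpos : ∀ i, 0 < h i) (hx : x (Fin.last m) = 0)
    (hlt : 1 < ∑ i : Fin m, x i.castSucc ^ 2 / h i ^ 2) : absW h hpos x = 0 := by
  have h1 := absS_mul_absW hpos x
  rw [hx, abs_zero, mul_eq_zero] at h1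
  refine h1.resolve_left fun hs => ?_
  have h2 := quadric_absS hpos x
  rw [hs] at h2
  simp only [ne_eq, OfNat.ofNat_ne_zero, not_false_eq_true, zero_pow, zero_add] at h2
  nlinarith [sq_nonneg (absW h hpos x)]

/-- The sign is locally constant where `c ≠ 0`, and its jump is harmless where `F` vanishes. This
lets a continuous signed coordinate be built from its absolute value. -/
theorem continuousOn_sign_mul {α : Type*} [TopologicalSpace α] {c F : α → ℝ} {D : Set α}
    (hc : Continuous c) (hF : ContinuousOn F D) (h0 : ∀ p ∈ D, c p = 0 → F p = 0) :
    ContinuousOn (fun p => (SignType.sign (c p) : ℝ) * F p) D := by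
  intro p hp
  by_cases hcp : c p = 0
  · have hFp := h0 p hp hcp
    have h1 : Tendsto F (𝓝[D] p) (𝓝 0) := hFp ▸ hF p hp
    rw [ContinuousWithinAt, hFp, mul_zero]
    refine squeeze_zero_norm (a := fun z => ‖F z‖) (fun z => ?_) (by simpa using h1.norm)
    rw [norm_mul]
    refine mul_le_of_le_one_left (norm_nonneg _) ?_
    cases SignType.sign (c z) <;> simp
  · have h1 : ContinuousAt (fun p => (SignType.sign (c p) : ℝ)) p :=
      (continuous_of_discreteTopology (f := fun s : SignType => (s : ℝ))).continuousAt.comp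
        ((continuousAt_sign_of_ne_zero hcp).comp hc.continuousAt)
    exact h1.continuousWithinAt.mul (hF p hp)

/-- The point with polar coordinates `(r, θ)` in the normal plane at `q`. -/
def tubePoint (h : Fin m → ℝ) (q : Euc (m + 1)) (r θ : ℝ) : Euc (m + 1) :=
  q + r • (Real.cos θ • unitNormal h q + Real.sin θ • lastVec m)

theorem rotation_unitNormal (hq : q ∈ ellipsoid h) : rotation h q (unitNormal h q) = lastVec m := by
  simpa using rotation_apply hq 1 0

theorem normalPoint_unitNormal (hq : q ∈ ellipsoid h) (r θ : ℝ) :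
    normalPoint (rotation h) q (unitNormal h q) r θ = tubePoint h q r θ := by
  rw [normalPoint, rotation_unitNormal hq, tubePoint]

theorem normalPoint_eq_tubePoint (hq : q ∈ ellipsoid h) (r θ α : ℝ) :
    normalPoint (rotation h) q (Real.cos α • unitNormal h q + Real.sin α • lastVec m) r θ =
      tubePoint h q r (θ + α) := by
  rw [normalPoint, rotation_apply hq, tubePoint, Real.cos_add, Real.sin_add]
  module

theorem tubePoint_last (hq : q ∈ ellipsoid h) (r θ : ℝ) :
    tubePoint h q r θ (Fin.last m) = r * Real.sin θ := by
  simp [tubePoint, hq.2]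

theorem tubePoint_castSucc (h : Fin m → ℝ) (q : Euc (m + 1)) (r θ : ℝ) (i : Fin m) :
    tubePoint h q r θ i.castSucc = q i.castSucc + r * Real.cos θ * unitNormal h q i.castSucc := by
  simp [tubePoint]
  ring

theorem quadForm_tubePoint (hq : q ∈ ellipsoid h) (r θ : ℝ) :
    ∑ i : Fin m, tubePoint h q r θ i.castSucc ^ 2 / h i ^ 2 =
      1 + 2 * ‖conormal h q‖ * (r * Real.cos θ) +
        (∑ i : Fin m, unitNormal h q i.castSucc ^ 2 / h i ^ 2) * (r * Real.cos θ) ^ 2 := by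
  have h1 : inner ℝ (conormal h q) (unitNormal h q) = ‖conormal h q‖ := by
    have := norm_ne_zero_iff.2 (conormal_ne_zero hq)
    rw [unitNormal, inner_smul_right, real_inner_self_eq_norm_sq]
    field_simp
  rw [inner_conormal] at h1
  have e : ∀ i : Fin m, tubePoint h q r θ i.castSucc ^ 2 / h i ^ 2 = q i.castSucc ^ 2 / h i ^ 2 +
      2 * (r * Real.cos θ) * (q i.castSucc * unitNormal h q i.castSucc / h i ^ 2) +
      (r * Real.cos θ) ^ 2 * (unitNormal h q i.castSucc ^ 2 / h i ^ 2) := by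
    intro i
    rw [tubePoint_castSucc]
    ring
  rw [Finset.sum_congr rfl fun i _ => e i, Finset.sum_add_distrib, Finset.sum_add_distrib,
    ← Finset.mul_sum, ← Finset.mul_sum, h1, hq.1]
  ring

theorem quadForm_unitNormal_le (hq : q ∈ ellipsoid h) :
    ∑ i : Fin m, unitNormal h q i.castSucc ^ 2 / h i ^ 2 ≤ ∑ i, 1 / h i ^ 2 := by
  refine Finset.sum_le_sum fun i _ => ?_
  have h1 := norm_unitNormal (conormal_ne_zero hq)
  have h2 := EuclideanSpace.norm_sq_eq (unitNormal h q)
  have h3 := Finset.single_le_sum (f := fun j => ‖unitNormal h q j‖ ^ 2)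
    (fun _ _ => sq_nonneg _) (Finset.mem_univ i.castSucc)
  rw [← h2, h1] at h3
  gcongr
  simpa using h3

/-- A radius below which the normal circles around the ellipsoid are simple linking loops. -/
def tubeRadius (h : Fin m → ℝ) : ℝ := 1 / ((∑ i, 1 / h i ^ 2) * √(∑ i, h i ^ 2) + 1)

theorem tubeRadius_pos (h : Fin m → ℝ) : 0 < tubeRadius h := by
  unfold tubeRadius
  positivity

theorem one_le_norm_conormal_mul (hpos : ∀ i, 0 < h i) (hq : q ∈ ellipsoid h) :
    1 ≤ ‖conormal h q‖ * √(∑ i, h i ^ 2) := by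
  have h1 := (isLift_zero_iff.2 hq).norm_sq_le hpos
  have h2 : ‖q‖ ≤ √(∑ i, h i ^ 2) := Real.le_sqrt_of_sq_le (by simpa using h1)
  have h3 := real_inner_le_norm (conormal h q) q
  rw [inner_conormal_self hq] at h3
  exact h3.trans (by gcongr)

/-- The curvature sum is at most ∑ 1/h_i² and ‖conormal‖ is at least 1/√(∑ h_i²). Below this radius
the linear term in `quadForm_tubePoint` dominates, so the circle meets the hyperplane once inside
and once outside the ellipsoid. -/
theorem tubeRadius_spec (hpos : ∀ i, 0 < h i) (hq : q ∈ ellipsoid h) (hr : 0 < r)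
    (hr' : r < tubeRadius h) :
    (∑ i : Fin m, unitNormal h q i.castSucc ^ 2 / h i ^ 2) * r < ‖conormal h q‖ := by
  have h1 := one_le_norm_conormal_mul hpos hq
  have h2 := quadForm_unitNormal_le hq
  set D := √(∑ i, h i ^ 2)
  have hD : 0 ≤ D := Real.sqrt_nonneg _
  have hD' : 0 < D := by
    by_contra! h0
    have : D = 0 := le_antisymm h0 hD
    rw [this] at h1
    linarith [mul_zero ‖conormal h q‖]
  have h3 : r * ((∑ i, 1 / h i ^ 2) * D + 1) < 1 := by
    rwa [tubeRadius, lt_div_iff₀ (by positivity)] at hr'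
  refine lt_of_mul_lt_mul_right ?_ hD
  calc _ ≤ (∑ i, 1 / h i ^ 2) * r * D := by gcongr
    _ < 1 := by nlinarith
    _ ≤ _ := h1

/-- The half-angle condition means θ ≡ π mod 2π, the inner point of the circle in the hyperplane,
where s = 0. Thus the sign of cos(θ/2) jumps only where the first coordinate vanishes;
`absW_tubePoint` treats θ ≡ 0 likewise. -/
theorem absS_tubePoint (hpos : ∀ i, 0 < h i) (hq : q ∈ ellipsoid h) (hr : 0 < r)
    (hr' : r < tubeRadius h) (hθ : Real.cos (θ / 2) = 0) :
    absS h hpos (tubePoint h q r θ) = 0 := by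
  have hc : Real.cos θ = -1 := by
    rw [show θ = 2 * (θ / 2) by ring, Real.cos_two_mul, hθ]; norm_num
  have hs : Real.sin θ = 0 := by
    rw [show θ = 2 * (θ / 2) by ring, Real.sin_two_mul, hθ]; ring
  have h1 := tubeRadius_spec hpos hq hr hr'
  have h2 : 0 < ‖conormal h q‖ := norm_pos_iff.2 (conormal_ne_zero hq)
  refine absS_eq_zero hpos (by rw [tubePoint_last hq, hs, mul_zero]) ?_
  rw [quadForm_tubePoint hq, hc]
  nlinarith [mul_lt_mul_of_pos_right h1 hr]

theorem absW_tubePoint (hpos : ∀ i, 0 < h i) (hq : q ∈ ellipsoid h) (hr : 0 < r)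
    (hθ : Real.sin (θ / 2) = 0) : absW h hpos (tubePoint h q r θ) = 0 := by
  have hc : Real.cos θ = 1 := by
    rw [show θ = 2 * (θ / 2) by ring, Real.cos_two_mul, Real.cos_sq', hθ]; norm_num
  have hs : Real.sin θ = 0 := by
    rw [show θ = 2 * (θ / 2) by ring, Real.sin_two_mul, hθ]; ring
  have h2 : 0 < ‖conormal h q‖ := norm_pos_iff.2 (conormal_ne_zero hq)
  have h3 : 0 ≤ ∑ i : Fin m, unitNormal h q i.castSucc ^ 2 / h i ^ 2 := by positivity
  refine absW_eq_zero hpos (by rw [tubePoint_last hq, hs, mul_zero]) ?_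
  rw [quadForm_tubePoint hq, hc]
  nlinarith [mul_pos h2 hr, mul_nonneg h3 (sq_nonneg r)]

theorem tubePoint_notMem (hpos : ∀ i, 0 < h i) (hq : q ∈ ellipsoid h) (hr : 0 < r)
    (hr' : r < tubeRadius h) (θ : ℝ) : tubePoint h q r θ ∉ ellipsoid h := by
  intro hx
  have h0 := hx.2
  rw [tubePoint_last hq, mul_eq_zero, or_iff_right hr.ne'] at h0
  have h1 := tubeRadius_spec hpos hq hr hr'
  have h2 : 0 < ‖conormal h q‖ := norm_pos_iff.2 (conormal_ne_zero hq)
  have h3 : 0 ≤ ∑ i : Fin m, unitNormal h q i.castSucc ^ 2 / h i ^ 2 := by positivity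
  have h4 := hx.1
  rw [quadForm_tubePoint hq] at h4
  rcases Real.sin_eq_zero_iff_cos_eq.1 h0 with hc | hc
  · rw [hc] at h4
    nlinarith [mul_pos h2 hr, mul_nonneg h3 (sq_nonneg r)]
  · rw [hc] at h4
    nlinarith [mul_lt_mul_of_pos_right h1 hr]

/-- The first signed coordinate along the normal circles. -/
def tubeS (h : Fin m → ℝ) (hpos : ∀ i, 0 < h i) (q : Euc (m + 1)) (r θ : ℝ) : ℝ :=
  SignType.sign (Real.cos (θ / 2)) * absS h hpos (tubePoint h q r θ)

/-- The second signed coordinate along the normal circles. -/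
def tubeW (h : Fin m → ℝ) (hpos : ∀ i, 0 < h i) (q : Euc (m + 1)) (r θ : ℝ) : ℝ :=
  SignType.sign (Real.sin (θ / 2)) * absW h hpos (tubePoint h q r θ)

theorem sq_sign_mul {c a : ℝ} (hc : c = 0 → a = 0) : ((SignType.sign c : ℝ) * a) ^ 2 = a ^ 2 := by
  rcases lt_trichotomy c 0 with h0 | h0 | h0
  · simp [sign_neg h0]
  · simp [hc h0]
  · simp [sign_pos h0]

/-- The half-angle signs are chosen so that their product is the sign of sin θ, hence of x_n; the
quadric equation only sees squares. -/
theorem isLift_tube (hpos : ∀ i, 0 < h i) (hq : q ∈ ellipsoid h) (hr : 0 < r)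
    (hr' : r < tubeRadius h) (θ : ℝ) :
    IsLift h (tubePoint h q r θ) (tubeS h hpos q r θ) (tubeW h hpos q r θ) := by
  constructor
  · have h1 := absS_mul_absW hpos (tubePoint h q r θ)
    have h2 : Real.sin θ = 2 * Real.sin (θ / 2) * Real.cos (θ / 2) := by
      rw [← Real.sin_two_mul]; ring_nf
    rw [tubeS, tubeW, mul_mul_mul_comm, h1, ← SignType.coe_mul, ← sign_mul, tubePoint_last hq, h2]
    have h3 : SignType.sign (Real.cos (θ / 2) * Real.sin (θ / 2)) =
        SignType.sign (r * (2 * Real.sin (θ / 2) * Real.cos (θ / 2))) := by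
      rw [show r * (2 * Real.sin (θ / 2) * Real.cos (θ / 2)) =
        (r * 2) * (Real.cos (θ / 2) * Real.sin (θ / 2)) by ring, sign_mul (r * 2),
        sign_pos (show 0 < r * 2 by positivity), one_mul]
    rw [h3, sign_mul_abs]
  · rw [tubeS, tubeW, sq_sign_mul (absS_tubePoint hpos hq hr hr'),
      sq_sign_mul (absW_tubePoint hpos hq hr)]
    exact quadric_absS hpos _

theorem continuousOn_tubePoint (h : Fin m → ℝ) :
    ContinuousOn (fun p : Euc (m + 1) × ℝ × ℝ => tubePoint h p.1 p.2.1 p.2.2)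
      (ellipsoid h ×ˢ (Ioo 0 (tubeRadius h) ×ˢ univ)) := by
  have h1 : ContinuousOn (fun p : Euc (m + 1) × ℝ × ℝ => unitNormal h p.1)
      (ellipsoid h ×ˢ (Ioo 0 (tubeRadius h) ×ˢ univ)) :=
    (continuousOn_unitNormal h).comp continuousOn_fst fun p hp => hp.1
  unfold tubePoint
  fun_prop

theorem continuousOn_tubeS (hpos : ∀ i, 0 < h i) :
    ContinuousOn (fun p : Euc (m + 1) × ℝ × ℝ => tubeS h hpos p.1 p.2.1 p.2.2)
      (ellipsoid h ×ˢ (Ioo 0 (tubeRadius h) ×ˢ univ)) :=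
  continuousOn_sign_mul (by fun_prop)
    ((continuousOn_absS hpos).comp (continuousOn_tubePoint h)
      fun p hp => tubePoint_notMem hpos hp.1 hp.2.1.1 hp.2.1.2 _)
    fun p hp => absS_tubePoint hpos hp.1 hp.2.1.1 hp.2.1.2

theorem continuousOn_tubeW (hpos : ∀ i, 0 < h i) :
    ContinuousOn (fun p : Euc (m + 1) × ℝ × ℝ => tubeW h hpos p.1 p.2.1 p.2.2)
      (ellipsoid h ×ˢ (Ioo 0 (tubeRadius h) ×ˢ univ)) :=
  continuousOn_sign_mul (by fun_prop)
    ((continuousOn_absW hpos).comp (continuousOn_tubePoint h)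
      fun p hp => tubePoint_notMem hpos hp.1 hp.2.1.1 hp.2.1.2 _)
    fun p hp => absW_tubePoint hpos hp.1 hp.2.1.1

/-- The lift to the cover of a point in polar coordinates around the ellipsoid. -/
def tubeLift (hpos : ∀ i, 0 < h i) (hq : q ∈ ellipsoid h) (hr : r ∈ Ioo 0 (tubeRadius h))
    (θ : ℝ) : Cover h :=
  Cover.mk (tubePoint h q r θ) (tubeS h hpos q r θ) (tubeW h hpos q r θ)
    (tubePoint_notMem hpos hq hr.1 hr.2 θ) (isLift_tube hpos hq hr.1 hr.2 θ)

theorem continuous_tubeLift (hpos : ∀ i, 0 < h i) (hq : q ∈ ellipsoid h)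
    (hr : r ∈ Ioo 0 (tubeRadius h)) : Continuous (tubeLift hpos hq hr) := by
  have h1 : Continuous fun θ : ℝ => (q, r, θ) := by fun_prop
  have h2 : ∀ θ, (q, r, θ) ∈ ellipsoid h ×ˢ (Ioo 0 (tubeRadius h) ×ˢ (univ : Set ℝ)) :=
    fun θ => ⟨hq, hr, trivial⟩
  have e1 := (continuousOn_tubePoint h).comp_continuous h1 h2
  have e2 := (continuousOn_tubeS hpos).comp_continuous h1 h2
  have e3 := (continuousOn_tubeW hpos).comp_continuous h1 h2
  exact Cover.continuous_iff.2 ⟨e1, e2, e3⟩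

theorem tubeLift_add_two_pi (hpos : ∀ i, 0 < h i) (hq : q ∈ ellipsoid h)
    (hr : r ∈ Ioo 0 (tubeRadius h)) (θ : ℝ) :
    tubeLift hpos hq hr (θ + 2 * Real.pi) = (tubeLift hpos hq hr θ).deck := by
  have h1 : tubePoint h q r (θ + 2 * Real.pi) = tubePoint h q r θ := by simp [tubePoint]
  have h2 : (θ + 2 * Real.pi) / 2 = θ / 2 + Real.pi := by ring
  refine Cover.ext h1 ?_ ?_
  · simp [tubeLift, tubeS, h1, h2, Left.sign_neg]
  · simp [tubeLift, tubeW, h1, h2, Left.sign_neg]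

theorem hasMonodromyNegOne_cover (hpos : ∀ i, 0 < h i) :
    (cover h hpos).HasMonodromyNegOne (rotation h) := by
  intro q hq e he hne
  refine ⟨tubeRadius h, tubeRadius_pos h, fun r hr0 hr1 => ?_⟩
  have hr : r ∈ Ioo 0 (tubeRadius h) := ⟨hr0, hr1⟩
  obtain ⟨a, b, rfl⟩ := (mem_normalSpace_iff hq).1 he
  have hab : a ^ 2 + b ^ 2 = 1 := by rw [← norm_sq_normal hq, hne, one_pow]
  obtain ⟨α, rfl, rfl⟩ : ∃ α, a = Real.cos α ∧ b = Real.sin α := by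
    have hz : ‖(⟨a, b⟩ : ℂ)‖ = 1 := by
      rw [← sq_eq_sq₀ (norm_nonneg _) zero_le_one, Complex.sq_norm, Complex.normSq_mk]
      linarith
    obtain ⟨α, hα⟩ := (Complex.norm_eq_one_iff _).1 hz
    refine ⟨α, ?_, ?_⟩
    · simpa [Complex.exp_ofReal_mul_I_re] using (congrArg Complex.re hα).symm
    · simpa [Complex.exp_ofReal_mul_I_im] using (congrArg Complex.im hα).symm
  simp only [normalPoint_eq_tubePoint hq]
  refine ⟨fun θ => tubePoint_notMem hpos hq hr0 hr1 _, fun γ hγ hproj => ?_⟩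
  change ℝ → Cover h at γ
  -- Any unit normal is the outward one turned by an angle α, so its circle is the standard one with
  -- shifted parameter. A lift of it agrees with this shifted lift up to the deck map, and 2π
  -- changes both half-angle signs.
  have hΛ : Continuous fun θ => tubeLift hpos hq hr (θ + α) :=
    (continuous_tubeLift hpos hq hr).comp (by fun_prop)
  have h1 : tubeLift hpos hq hr (2 * Real.pi + α) = (tubeLift hpos hq hr (0 + α)).deck := by
    rw [← tubeLift_add_two_pi]
    congr 1
    ring
  change γ (2 * Real.pi) = (γ 0).deck
  rcases lifts_eq_or_eq_deck hpos (f := γ) hγ hΛ hproj with hγΛ | hγΛ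
  · rw [hγΛ, hγΛ, h1]
  · rw [hγΛ, hγΛ, h1]

end Z2Harmonic

end

/-! ### Convergence of the integrals and behaviour at infinity. -/

noncomputable section

namespace Z2Harmonic

variable {m : ℕ} {h : Fin m → ℝ} {x : Euc (m + 1)}

/-- Comparison with u^(-n), whose tail is s^(1-n)/(n - 1). The bound is kept as s/s^n to avoid
subtraction of natural numbers, and dropping the denominator uses n ≥ 2. -/
theorem integrableOn_and_tail_le {f : ℝ → ℝ} {n : ℕ} (hn : 2 ≤ n) (hf : Continuous f)
    (h0 : ∀ u, 0 ≤ f u) (hle : ∀ u, 0 < u → f u ≤ 1 / u ^ n) :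
    IntegrableOn f (Ioi 0) ∧
      ∀ s, 0 < s → |(∫ u in (0 : ℝ)..s, f u) - ∫ u in Ioi (0 : ℝ), f u| ≤ s / s ^ n := by
  have hn' : (2 : ℝ) ≤ n := by exact_mod_cast hn
  have hpow : ∀ u : ℝ, 0 < u → 1 / u ^ n = u ^ (-(n : ℝ)) := fun u hu => by
    rw [Real.rpow_neg hu.le, Real.rpow_natCast, one_div]
  have htail : ∀ s, 0 < s → IntegrableOn f (Ioi s) := fun s hs =>
    (integrableOn_Ioi_rpow_of_lt (by linarith : -(n : ℝ) < -1) hs).mono'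
      hf.aestronglyMeasurable ((ae_restrict_iff' measurableSet_Ioi).2 (Eventually.of_forall
        fun u hu => by
          have hu0 : 0 < u := hs.trans hu
          rw [Real.norm_of_nonneg (h0 u), ← hpow u hu0]
          exact hle u hu0))
  have hfi : IntegrableOn f (Ioi 0) := by
    rw [← Ioc_union_Ioi_eq_Ioi (zero_le_one' ℝ)]
    exact hf.integrableOn_Ioc.union (htail 1 one_pos)
  refine ⟨hfi, fun s hs => ?_⟩
  have hsplit : ∫ u in Ioi (0 : ℝ), f u = (∫ u in (0 : ℝ)..s, f u) + ∫ u in Ioi s, f u := by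
    rw [intervalIntegral.integral_of_le hs.le, ← setIntegral_union (Ioc_disjoint_Ioi le_rfl)
      measurableSet_Ioi hf.integrableOn_Ioc (htail s hs), Ioc_union_Ioi_eq_Ioi hs.le]
  rw [hsplit, sub_add_cancel_left, abs_neg, abs_of_nonneg (setIntegral_nonneg measurableSet_Ioi
    fun u _ => h0 u)]
  calc ∫ u in Ioi s, f u ≤ ∫ u in Ioi s, u ^ (-(n : ℝ)) := by
        refine setIntegral_mono_on (htail s hs)
          (integrableOn_Ioi_rpow_of_lt (by linarith : -(n : ℝ) < -1) hs) measurableSet_Ioi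
          fun u hu => ?_
        have hu0 : 0 < u := hs.trans hu
        rw [← hpow u hu0]
        exact hle u hu0
    _ = s ^ (-(n : ℝ) + 1) / (n - 1) := by
        rw [integral_Ioi_rpow_of_lt (by linarith) hs, ← neg_div_neg_eq]
        ring_nf
    _ ≤ s ^ (-(n : ℝ) + 1) := div_le_self (by positivity) (by linarith)
    _ = s / s ^ n := by
        rw [Real.rpow_add hs, Real.rpow_neg hs.le, Real.rpow_natCast, Real.rpow_one]
        ring

theorem integrandConst_le (h : Fin m → ℝ) {u : ℝ} (hu : 0 < u) :
    integrandConst h u ≤ 1 / u ^ m := by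
  unfold integrandConst
  have h1 : (u ^ m) ^ 2 ≤ S h (u ^ 2) := by
    have : ∏ _i : Fin m, u ^ 2 ≤ S h (u ^ 2) :=
      Finset.prod_le_prod (fun _ _ => sq_nonneg u) fun i _ => by
        have := sq_nonneg (h i)
        linarith
    simpa [pow_right_comm] using this
  gcongr
  exact Real.le_sqrt_of_sq_le h1

theorem integrandSide_nonneg (hpos : ∀ i, 0 < h i) (i : Fin m) (u : ℝ) :
    0 ≤ integrandSide h i u := by
  rw [integrandSide_eq]
  exact div_nonneg (integrandConst_pos hpos u).le (sq_add_sq_pos hpos u i).le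

theorem integrandSide_le (h : Fin m → ℝ) (i : Fin m) {u : ℝ} (hu : 0 < u) :
    integrandSide h i u ≤ 1 / u ^ (m + 2) := by
  rw [integrandSide_eq, pow_add, ← div_div]
  have h1 := integrandConst_le h hu
  have h2 : u ^ 2 ≤ u ^ 2 + h i ^ 2 := by nlinarith [sq_nonneg (h i)]
  gcongr

theorem integrableOn_integrandConst (hpos : ∀ i, 0 < h i) (hm : 2 ≤ m) :
    IntegrableOn (integrandConst h) (Ioi 0) :=
  (integrableOn_and_tail_le hm (contDiff_integrandConst hpos).continuous
    (fun u => (integrandConst_pos hpos u).le) fun _ => integrandConst_le h).1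

theorem abs_primConst_sub_le (hpos : ∀ i, 0 < h i) (hm : 2 ≤ m) {s : ℝ} (hs : 0 < s) :
    |primConst h s - ∫ u in Ioi (0 : ℝ), integrandConst h u| ≤ s / s ^ m :=
  (integrableOn_and_tail_le hm (contDiff_integrandConst hpos).continuous
    (fun u => (integrandConst_pos hpos u).le) fun _ => integrandConst_le h).2 s hs

theorem integrableOn_integrandSide (hpos : ∀ i, 0 < h i) (i : Fin m) :
    IntegrableOn (integrandSide h i) (Ioi 0) :=
  (integrableOn_and_tail_le (by omega) (contDiff_integrandSide hpos i).continuous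
    (integrandSide_nonneg hpos i) fun _ => integrandSide_le h i).1

theorem abs_primSide_sub_le (hpos : ∀ i, 0 < h i) (i : Fin m) {s : ℝ} (hs : 0 < s) :
    |primSide h i s - ∫ u in Ioi (0 : ℝ), integrandSide h i u| ≤ s / s ^ (m + 2) :=
  (integrableOn_and_tail_le (by omega) (contDiff_integrandSide hpos i).continuous
    (integrandSide_nonneg hpos i) fun _ => integrandSide_le h i).2 s hs

theorem integrableOn_integrandLast (hpos : ∀ i, 0 < h i) :
    IntegrableOn (integrandLast h) (Ioi 0) := by
  rw [funext (integrandLast_eq hpos)]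
  exact integrable_finsetSum _ fun i _ => integrableOn_integrandSide hpos i

theorem coeffLast_eq (hpos : ∀ i, 0 < h i) :
    coeffLast h = -((∏ j, h j) / 2) * ∑ i, ∫ u in Ioi (0 : ℝ), integrandSide h i u := by
  rw [coeffLast, funext (integrandLast_eq hpos),
    integral_finsetSum _ fun i _ => integrableOn_integrandSide hpos i]

/-- Choosing s > 0 selects a sheet wherever s is nonzero, in particular outside a ball; there w =
x_n/s is continuous. -/
theorem isLift_absS (hpos : ∀ i, 0 < h i) (hx : absS h hpos x ≠ 0) :
    IsLift h x (absS h hpos x) (x (Fin.last m) / absS h hpos x) := by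
  refine ⟨by field_simp, ?_⟩
  have h1 := absS_mul_absW hpos x
  rw [← quadric_absS hpos x, div_pow, ← sq_abs (x (Fin.last m)), ← h1]
  field_simp

theorem absS_ne_zero_of_norm (hpos : ∀ i, 0 < h i) (hx : √(∑ i, h i ^ 2) < ‖x‖) :
    absS h hpos x ≠ 0 := by
  intro h0
  obtain ⟨s, w, -, H⟩ := exists_isLift hpos x
  have h1 := H.norm_sq_le hpos
  have h2 : s = 0 := by
    rw [H.absS_eq hpos] at h0
    exact abs_eq_zero.1 h0
  have h3 : ∑ i, h i ^ 2 < ‖x‖ ^ 2 := by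
    rwa [Real.sqrt_lt' (lt_of_le_of_lt (Real.sqrt_nonneg _) hx)] at hx
  rw [h2] at h1
  linarith

theorem notMem_of_absS_ne_zero (hpos : ∀ i, 0 < h i) (hx : absS h hpos x ≠ 0) :
    x ∉ ellipsoid h := fun hxΓ =>
  hx (by simpa using (isLift_zero_iff.2 hxΓ).absS_eq hpos)

theorem isBranchOn_outside (hpos : ∀ i, 0 < h i) :
    (cover h hpos).IsBranchOn (harmonicFn h) {x | √(∑ i, h i ^ 2) < ‖x‖}
      fun x => potential h x (absS h hpos x) (x (Fin.last m) / absS h hpos x) := by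
  have hne : ∀ x : {x : Euc (m + 1) | √(∑ i, h i ^ 2) < ‖x‖}, absS h hpos x ≠ 0 :=
    fun x => absS_ne_zero_of_norm hpos x.2
  refine ⟨fun x => Cover.mk x.1 _ _ (notMem_of_absS_ne_zero hpos (hne x))
    (isLift_absS hpos (hne x)), ?_, fun _ => rfl, fun _ => rfl⟩
  have h1 : Continuous fun x : {x : Euc (m + 1) | √(∑ i, h i ^ 2) < ‖x‖} => absS h hpos x :=
    (continuousOn_absS hpos).comp_continuous continuous_subtype_val
      fun x => notMem_of_absS_ne_zero hpos (hne x)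
  refine Cover.continuous_iff.2 ⟨continuous_subtype_val, h1, Continuous.div ?_ h1 hne⟩
  fun_prop

/-- The error consists of the tail of the constant primitive, the side tails of size s^(-1-m)
multiplied by |x_n² - x_i²| ≤ 4 s², and x_n w φ(s) = s w² φ(s). Each is O(s^(1-m)), which is the
required order because n = m + 1. -/
theorem abs_potential_sub_le (hpos : ∀ i, 0 < h i) (hm : 2 ≤ m) {s w : ℝ} (hs : 0 < s)
    (H : IsLift h x s w) (hx : ‖x‖ ≤ 2 * s) :
    |potential h x s w - (coeffConst h - (∑ i : Fin m, coeffSide h i * x i.castSucc ^ 2 +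
      coeffLast h * x (Fin.last m) ^ 2))| ≤ (∏ j, h j) / 2 * (2 + 4 * m) * (s / s ^ m) := by
  have hc : 0 ≤ (∏ j, h j) / 2 := by
    have := Finset.prod_pos fun i (_ : i ∈ Finset.univ) => hpos i
    positivity
  have e : potential h x s w - (coeffConst h - (∑ i : Fin m, coeffSide h i * x i.castSucc ^ 2 +
      coeffLast h * x (Fin.last m) ^ 2)) = (∏ j, h j) / 2 *
      ((primConst h s - ∫ u in Ioi (0 : ℝ), integrandConst h u) +
      ∑ i : Fin m, (x (Fin.last m) ^ 2 - x i.castSucc ^ 2) *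
        (primSide h i s - ∫ u in Ioi (0 : ℝ), integrandSide h i u) +
      x (Fin.last m) * w * integrandConst h s) := by
    have e1 : ∑ i : Fin m, (x (Fin.last m) ^ 2 - x i.castSucc ^ 2) *
        (primSide h i s - ∫ u in Ioi (0 : ℝ), integrandSide h i u) =
        ∑ i : Fin m, (x (Fin.last m) ^ 2 - x i.castSucc ^ 2) * primSide h i s -
        x (Fin.last m) ^ 2 * (∑ i, ∫ u in Ioi (0 : ℝ), integrandSide h i u) +
        ∑ i : Fin m, (∫ u in Ioi (0 : ℝ), integrandSide h i u) * x i.castSucc ^ 2 := by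
      rw [Finset.mul_sum, ← Finset.sum_sub_distrib, ← Finset.sum_add_distrib]
      exact Finset.sum_congr rfl fun i _ => by ring
    have e2 : ∑ i : Fin m, coeffSide h i * x i.castSucc ^ 2 = (∏ j, h j) / 2 *
        ∑ i : Fin m, (∫ u in Ioi (0 : ℝ), integrandSide h i u) * x i.castSucc ^ 2 := by
      rw [Finset.mul_sum]
      exact Finset.sum_congr rfl fun i _ => by rw [coeffSide]; ring
    rw [e1, e2, coeffLast_eq hpos, coeffConst, potential]
    ring
  rw [e, abs_mul, abs_of_nonneg hc, mul_assoc ((∏ j, h j) / 2)]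
  refine mul_le_mul_of_nonneg_left ?_ hc
  have hn := norm_sq_eq x
  have hx2 : ‖x‖ ^ 2 ≤ 4 * s ^ 2 := by nlinarith [norm_nonneg x]
  have t1 := abs_primConst_sub_le hpos hm hs
  have t2 : |∑ i : Fin m, (x (Fin.last m) ^ 2 - x i.castSucc ^ 2) *
      (primSide h i s - ∫ u in Ioi (0 : ℝ), integrandSide h i u)| ≤ 4 * m * (s / s ^ m) := by
    have : ∀ i ∈ Finset.univ, |(x (Fin.last m) ^ 2 - x (Fin.castSucc i) ^ 2) *
        (primSide h i s - ∫ u in Ioi (0 : ℝ), integrandSide h i u)| ≤ 4 * (s / s ^ m) := by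
      intro i _
      have hi := Finset.single_le_sum (f := fun i : Fin m => x i.castSucc ^ 2)
        (fun _ _ => sq_nonneg _) (Finset.mem_univ i)
      have hl := Finset.sum_nonneg fun (i : Fin m) (_ : i ∈ Finset.univ) =>
        sq_nonneg (x i.castSucc)
      rw [abs_mul]
      calc _ ≤ (4 * s ^ 2) * (s / s ^ (m + 2)) := by
            gcongr
            · exact abs_le.2 ⟨by nlinarith [sq_nonneg (x (Fin.last m))],
                by nlinarith [sq_nonneg (x i.castSucc)]⟩
            · exact abs_primSide_sub_le hpos i hs
        _ = _ := by
            rw [pow_add]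
            field_simp
    refine (Finset.abs_sum_le_sum_abs _ _).trans ((Finset.sum_le_sum this).trans_eq ?_)
    simp
    ring
  have t3 : |x (Fin.last m) * w * integrandConst h s| ≤ s / s ^ m := by
    rw [← H.1, abs_mul, abs_of_nonneg (integrandConst_pos hpos s).le, mul_assoc, abs_mul,
      abs_of_pos hs, ← sq, abs_of_nonneg (sq_nonneg w), div_eq_mul_one_div]
    have := integrandConst_le h hs
    have hw := H.sq_w_le_one
    have hφ := (integrandConst_pos hpos s).le
    calc s * w ^ 2 * integrandConst h s ≤ s * 1 * (1 / s ^ m) := by gcongr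
      _ = _ := by ring
  calc _ ≤ s / s ^ m + 4 * m * (s / s ^ m) + s / s ^ m :=
        (abs_add_le _ _).trans (add_le_add ((abs_add_le _ _).trans (add_le_add t1 t2)) t3)
    _ = _ := by ring

theorem div_pow_le_of_le {s t : ℝ} (hm : 1 ≤ m) (ht : 0 < t) (hts : t ≤ 2 * s) :
    s / s ^ m ≤ 2 ^ m * t ^ ((2 : ℤ) - ((m + 1 : ℕ) : ℤ)) := by
  have hs : 0 < s := by linarith
  obtain ⟨k, rfl⟩ : ∃ k, m = k + 1 := ⟨m - 1, by omega⟩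
  have e1 : (2 : ℤ) - ((k + 1 + 1 : ℕ) : ℤ) = -(k : ℤ) := by push_cast; ring
  have e2 : s / s ^ (k + 1) = (s ^ k)⁻¹ := by
    rw [pow_succ]
    field_simp
  rw [e1, e2, zpow_neg, zpow_natCast, ← div_eq_mul_inv, inv_le_iff_one_le_mul₀ (by positivity),
    div_mul_eq_mul_div, le_div_iff₀ (by positivity), one_mul]
  calc t ^ k ≤ (2 * s) ^ k := by gcongr
    _ = 2 ^ k * s ^ k := mul_pow _ _ _
    _ ≤ 2 ^ (k + 1) * s ^ k := by gcongr <;> norm_num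

theorem isBigO_outside (hpos : ∀ i, 0 < h i) (hm : 2 ≤ m) :
    (fun x : Euc (m + 1) => potential h x (absS h hpos x) (x (Fin.last m) / absS h hpos x) -
      (coeffConst h - (∑ i : Fin m, coeffSide h i * x i.castSucc ^ 2 +
        coeffLast h * x (Fin.last m) ^ 2)))
      =O[Bornology.cobounded (Euc (m + 1))]
        fun x => ‖x‖ ^ ((2 : ℤ) - ((m + 1 : ℕ) : ℤ)) := by
  refine IsBigO.of_bound ((∏ j, h j) / 2 * (2 + 4 * m) * 2 ^ m) ?_
  set D := √(∑ i, h i ^ 2) with hD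
  have hD0 : 0 ≤ D := Real.sqrt_nonneg _
  -- With ‖x‖² ≤ s² + D² this threshold gives both s ≠ 0 and ‖x‖ ≤ 2 s.
  filter_upwards [eventually_cobounded_le_norm (2 * D + 1)] with x hx
  have hne := absS_ne_zero_of_norm hpos (x := x) (by linarith)
  have H := isLift_absS hpos hne
  have hs : 0 < absS h hpos x := lt_of_le_of_ne (absS_nonneg hpos x) hne.symm
  have hxs : ‖x‖ ≤ 2 * absS h hpos x := by
    have h1 := H.norm_sq_le hpos
    have h2 : ∑ i, h i ^ 2 = D ^ 2 := (Real.sq_sqrt (by positivity)).symm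
    rw [h2] at h1
    refine abs_le_of_sq_le_sq' ?_ (by positivity) |>.2
    nlinarith
  have hx0 : 0 < ‖x‖ := by linarith
  have hc : 0 ≤ (∏ j, h j) / 2 * (2 + 4 * (m : ℝ)) := by
    have := Finset.prod_pos fun i (_ : i ∈ Finset.univ) => hpos i
    positivity
  rw [Real.norm_eq_abs, norm_zpow, norm_norm]
  refine (abs_potential_sub_le hpos hm hs H hxs).trans ?_
  rw [mul_assoc _ ((2 : ℝ) ^ m)]
  exact mul_le_mul_of_nonneg_left (div_pow_le_of_le (by omega) hx0 hxs) hc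

end Z2Harmonic

end

/-! ### Cubic approximation of the potential in the signed coordinates. -/

noncomputable section

namespace Z2Harmonic

variable {m : ℕ} {h : Fin m → ℝ} {x q : Euc (m + 1)} {s w r θ : ℝ}

theorem integrandConst_zero (hpos : ∀ i, 0 < h i) : integrandConst h 0 = 1 / ∏ j, h j := by
  have : S h (0 ^ 2) = (∏ j, h j) ^ 2 := by simp [S, Finset.prod_pow]
  rw [integrandConst, this, Real.sqrt_sq (Finset.prod_nonneg fun i _ => (hpos i).le)]

theorem integrandConst_le_zero (hpos : ∀ i, 0 < h i) (u : ℝ) :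
    integrandConst h u ≤ integrandConst h 0 := by
  have h0 := S_pos hpos 0
  unfold integrandConst
  gcongr
  refine Finset.prod_le_prod (fun i _ => by positivity) fun i _ => ?_
  nlinarith [sq_nonneg u]

/-- The mean value inequality on |v| ≤ |u|. As φ is even, its derivative carries a factor v, which
makes the error quadratic. -/
theorem abs_integrandConst_sub_le (hpos : ∀ i, 0 < h i) (u : ℝ) :
    |integrandConst h u - integrandConst h 0| ≤
      integrandConst h 0 * (∑ i, 1 / h i ^ 2) * u ^ 2 := by
  set N := integrandConst h 0 * ∑ i, 1 / h i ^ 2 with hN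
  have hφ0 := (integrandConst_pos hpos 0).le
  have hbound : ∀ v ∈ Metric.closedBall (0 : ℝ) |u|, ‖-v * ∑ i, integrandSide h i v‖ ≤ N * |u| := by
    intro v hv
    have hv' : |v| ≤ |u| := by simpa using hv
    have h1 : ∑ i, integrandSide h i v ≤ N := by
      rw [hN, Finset.mul_sum]
      refine Finset.sum_le_sum fun i _ => ?_
      rw [integrandSide_eq, mul_one_div]
      have := integrandConst_le_zero hpos v
      have := pow_pos (hpos i) 2
      gcongr
      nlinarith [sq_nonneg v]
    have h2 := Finset.sum_nonneg fun i (_ : i ∈ Finset.univ) => integrandSide_nonneg hpos i v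
    rw [norm_mul, Real.norm_of_nonneg h2, norm_neg, Real.norm_eq_abs, mul_comm]
    gcongr
  have := (convex_closedBall (0 : ℝ) |u|).norm_image_sub_le_of_norm_hasDerivWithin_le
    (fun v _ => (hasDerivAt_integrandConst hpos v).hasDerivWithinAt) hbound
    (show (0 : ℝ) ∈ _ by simp) (show u ∈ _ by simp)
  rw [Real.norm_eq_abs, sub_zero, Real.norm_eq_abs, mul_assoc, ← sq, sq_abs] at this
  exact this

/-- The mixed difference quotient of the quadric between the parameters `s²` and `u²`. -/
def mixedSlope (h : Fin m → ℝ) (x : Euc (m + 1)) (s u : ℝ) : ℝ :=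
  ∑ i : Fin m, x i.castSucc ^ 2 / ((s ^ 2 + h i ^ 2) * (u ^ 2 + h i ^ 2))

theorem IsLift.one_sub_quadric (hpos : ∀ i, 0 < h i) (H : IsLift h x s w) (u : ℝ) :
    1 - ∑ i : Fin m, x i.castSucc ^ 2 / (u ^ 2 + h i ^ 2) =
      w ^ 2 - (s ^ 2 - u ^ 2) * mixedSlope h x s u := by
  have e : (s ^ 2 - u ^ 2) * mixedSlope h x s u =
      ∑ i : Fin m, x i.castSucc ^ 2 / (u ^ 2 + h i ^ 2) -
        ∑ i : Fin m, x i.castSucc ^ 2 / (s ^ 2 + h i ^ 2) := by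
    rw [mixedSlope, Finset.mul_sum, ← Finset.sum_sub_distrib]
    refine Finset.sum_congr rfl fun i _ => ?_
    have := (sq_add_sq_pos hpos s i).ne'
    have := (sq_add_sq_pos hpos u i).ne'
    field_simp
    ring
  rw [e, ← H.2]
  ring

/-- The integrand of the potential, as a function of the point. -/
def potentialIntegrand (h : Fin m → ℝ) (x : Euc (m + 1)) (u : ℝ) : ℝ :=
  integrandConst h u + ∑ i : Fin m, (x (Fin.last m) ^ 2 - x i.castSucc ^ 2) * integrandSide h i u

theorem continuous_potentialIntegrand (hpos : ∀ i, 0 < h i) (x : Euc (m + 1)) :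
    Continuous (potentialIntegrand h x) := by
  have h2 := fun i => (contDiff_integrandSide hpos i).continuous
  have h3 := (contDiff_integrandConst hpos).continuous
  unfold potentialIntegrand
  fun_prop

theorem potential_eq_integral (hpos : ∀ i, 0 < h i) (x : Euc (m + 1)) (s w : ℝ) :
    potential h x s w = (∏ j, h j) / 2 *
      ((∫ u in (0 : ℝ)..s, potentialIntegrand h x u) +
        x (Fin.last m) * w * integrandConst h s) := by
  have h2 := fun i => (contDiff_integrandSide hpos i).continuous
  have h3 := (contDiff_integrandConst hpos).continuous
  unfold potentialIntegrand
  rw [intervalIntegral.integral_add (h3.intervalIntegrable _ _)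
    (Continuous.intervalIntegrable (by fun_prop) _ _),
    intervalIntegral.integral_finsetSum fun i _ =>
      Continuous.intervalIntegrable (by fun_prop) _ _]
  simp only [intervalIntegral.integral_const_mul]
  rfl

/-- Eliminates the coordinates of x in favour of s², w² and a difference quotient, so that near the
ellipsoid every term in the bracket is visibly small. -/
theorem IsLift.potentialIntegrand_eq (hpos : ∀ i, 0 < h i) (H : IsLift h x s w) (u : ℝ) :
    potentialIntegrand h x u = integrandConst h u *
      (w ^ 2 - (s ^ 2 - u ^ 2) * mixedSlope h x s u +
        s ^ 2 * w ^ 2 * ∑ i, 1 / (u ^ 2 + h i ^ 2)) := by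
  rw [← H.one_sub_quadric hpos, ← mul_pow, H.1, potentialIntegrand]
  have e : ∑ i : Fin m, (x (Fin.last m) ^ 2 - x i.castSucc ^ 2) * integrandSide h i u =
      integrandConst h u * (x (Fin.last m) ^ 2 * ∑ i, 1 / (u ^ 2 + h i ^ 2) -
        ∑ i : Fin m, x i.castSucc ^ 2 / (u ^ 2 + h i ^ 2)) := by
    rw [Finset.mul_sum, ← Finset.sum_sub_distrib, Finset.mul_sum]
    exact Finset.sum_congr rfl fun i _ => by rw [integrandSide_eq]; ring
  rw [e]
  ring

/-- The leading term of the potential near the branching set. -/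
theorem IsLift.abs_potential_sub_cubic_le (hpos : ∀ i, 0 < h i) (H : IsLift h x s w)
    {A C K : ℝ} (hA : 0 ≤ A) (hC : 0 ≤ C) (hK : 0 ≤ K) (hr : 0 < r) (hr1 : r ≤ 1)
    (hs : s ^ 2 ≤ C * r) (hw : w ^ 2 ≤ C * r)
    (hG : ∀ u, u ^ 2 ≤ s ^ 2 → |A - mixedSlope h x s u| ≤ K * r) :
    |potential h x s w - (s * w ^ 2 - A * s ^ 3 / 3)| ≤
      ((∑ i, 1 / h i ^ 2) * C * (C + A * C + (C * K + C ^ 2 * ∑ i, 1 / h i ^ 2)) +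
        (C * K + C ^ 2 * ∑ i, 1 / h i ^ 2) + (∑ i, 1 / h i ^ 2) * C ^ 2) * r ^ 2 * |s| := by
  set M := ∑ i, 1 / h i ^ 2 with hM
  have hM0 : 0 ≤ M := by positivity
  set φ₀ := integrandConst h 0 with hφ₀
  have hφ₀0 : 0 ≤ φ₀ := (integrandConst_pos hpos 0).le
  set L := C * K + C ^ 2 * M with hL
  have hL0 : 0 ≤ L := by positivity
  have hP : 0 < ∏ j, h j := Finset.prod_pos fun i _ => hpos i
  have hPφ : (∏ j, h j) * φ₀ = 1 := by
    rw [hφ₀, integrandConst_zero hpos]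
    field_simp
  have hs0 := sq_nonneg s
  have hw0 := sq_nonneg w
  have hpt : ∀ u, u ^ 2 ≤ s ^ 2 →
      |potentialIntegrand h x u - φ₀ * (w ^ 2 - A * (s ^ 2 - u ^ 2))| ≤
        φ₀ * ((M * C * (C + A * C + L)) + L) * r ^ 2 := by
    intro u hu
    have hu0 := sq_nonneg u
    have hMu : ∑ i, 1 / (u ^ 2 + h i ^ 2) ≤ M := by
      refine Finset.sum_le_sum fun i _ => ?_
      have := pow_pos (hpos i) 2
      gcongr
      linarith
    have hMu0 : 0 ≤ ∑ i, 1 / (u ^ 2 + h i ^ 2) := by positivity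
    set Y₀ := w ^ 2 - A * (s ^ 2 - u ^ 2) with hY₀
    rw [H.potentialIntegrand_eq hpos]
    set Y := w ^ 2 - (s ^ 2 - u ^ 2) * mixedSlope h x s u +
      s ^ 2 * w ^ 2 * ∑ i, 1 / (u ^ 2 + h i ^ 2) with hY
    -- Second order in r: s² - u² is O(r) and multiplies the O(r) slope error, and s² w² is a
    -- product of two O(r) factors.
    have hd : |Y - Y₀| ≤ L * r ^ 2 := by
      have e : Y - Y₀ = (s ^ 2 - u ^ 2) * (A - mixedSlope h x s u) +
          s ^ 2 * w ^ 2 * ∑ i, 1 / (u ^ 2 + h i ^ 2) := by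
        rw [hY, hY₀]
        ring
      rw [e]
      refine (abs_add_le _ _).trans ?_
      rw [abs_mul, abs_of_nonneg (by linarith : 0 ≤ s ^ 2 - u ^ 2),
        abs_of_nonneg (by positivity : 0 ≤ s ^ 2 * w ^ 2 * ∑ i, 1 / (u ^ 2 + h i ^ 2))]
      calc _ ≤ (C * r) * (K * r) + (C * r) * (C * r) * M := by
            gcongr
            · linarith
            · exact hG u hu
        _ = _ := by rw [hL]; ring
    have hY0' : |Y₀| ≤ (C + A * C) * r := by
      rw [hY₀, abs_le]
      have h1 : A * (s ^ 2 - u ^ 2) ≤ A * (C * r) := by gcongr; linarith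
      have h2 : 0 ≤ A * (s ^ 2 - u ^ 2) := mul_nonneg hA (by linarith)
      constructor <;> nlinarith
    have hYb : |Y| ≤ (C + A * C + L) * r := by
      have h1 : |Y| ≤ |Y - Y₀| + |Y₀| := by simpa using abs_add_le (Y - Y₀) Y₀
      have h2 : L * r ^ 2 ≤ L * r := by
        gcongr
        nlinarith
      nlinarith
    have hφ : |integrandConst h u - φ₀| ≤ φ₀ * M * (C * r) :=
      (abs_integrandConst_sub_le hpos u).trans (by gcongr; linarith)
    have e : integrandConst h u * Y - φ₀ * Y₀ =
        (integrandConst h u - φ₀) * Y + φ₀ * (Y - Y₀) := by ring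
    rw [e]
    refine (abs_add_le _ _).trans ?_
    rw [abs_mul, abs_mul, abs_of_nonneg hφ₀0]
    calc _ ≤ φ₀ * M * (C * r) * ((C + A * C + L) * r) + φ₀ * (L * r ^ 2) := by gcongr
      _ = _ := by ring
  have hcontF : Continuous fun u : ℝ => φ₀ * (w ^ 2 - A * (s ^ 2 - u ^ 2)) := by fun_prop
  have hF : ∫ u in (0 : ℝ)..s, φ₀ * (w ^ 2 - A * (s ^ 2 - u ^ 2)) =
      φ₀ * (s * w ^ 2 - 2 / 3 * A * s ^ 3) := by
    have hd : ∀ u ∈ uIcc 0 s, HasDerivAt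
        (fun u : ℝ => φ₀ * (u * w ^ 2 - A * (u * s ^ 2 - u ^ 3 / 3)))
        (φ₀ * (w ^ 2 - A * (s ^ 2 - u ^ 2))) u := by
      intro u _
      have h1 := (hasDerivAt_id u).mul_const (w ^ 2)
      have h2 := ((hasDerivAt_id u).mul_const (s ^ 2)).sub ((hasDerivAt_pow 3 u).div_const 3)
      refine ((h1.sub (h2.const_mul A)).const_mul φ₀).congr_deriv ?_
      push_cast
      ring
    rw [intervalIntegral.integral_eq_sub_of_hasDerivAt hd (hcontF.intervalIntegrable _ _)]
    ring
  have hI : |(∫ u in (0 : ℝ)..s, potentialIntegrand h x u) -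
      φ₀ * (s * w ^ 2 - 2 / 3 * A * s ^ 3)| ≤
        φ₀ * ((M * C * (C + A * C + L)) + L) * r ^ 2 * |s| := by
    rw [← hF, ← intervalIntegral.integral_sub
      ((continuous_potentialIntegrand hpos x).intervalIntegrable _ _)
      (hcontF.intervalIntegrable _ _)]
    have := intervalIntegral.norm_integral_le_of_norm_le_const (a := 0) (b := s)
      (f := fun u => potentialIntegrand h x u - φ₀ * (w ^ 2 - A * (s ^ 2 - u ^ 2)))
      (C := φ₀ * ((M * C * (C + A * C + L)) + L) * r ^ 2) fun u hu => by
        refine hpt u (sq_le_sq.2 ?_)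
        have := abs_sub_left_of_mem_uIcc (uIoc_subset_uIcc hu)
        simpa using this
    simpa using this
  have hT : |s * w ^ 2 * (integrandConst h s - φ₀)| ≤ φ₀ * (M * C ^ 2) * r ^ 2 * |s| := by
    rw [abs_mul, abs_mul, abs_of_nonneg hw0]
    calc _ ≤ |s| * (C * r) * (φ₀ * M * (C * r)) := by
          gcongr
          exact (abs_integrandConst_sub_le hpos s).trans (by gcongr)
      _ = _ := by ring
  -- The integral contributes s w² - (2/3) A s³ and the boundary term another s w². The prefactor
  -- halves the total, and (∏ h_j) φ(0) = 1 removes the constant.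
  have e : potential h x s w - (s * w ^ 2 - A * s ^ 3 / 3) = (∏ j, h j) / 2 *
      (((∫ u in (0 : ℝ)..s, potentialIntegrand h x u) -
        φ₀ * (s * w ^ 2 - 2 / 3 * A * s ^ 3)) + s * w ^ 2 * (integrandConst h s - φ₀)) := by
    rw [potential_eq_integral hpos, ← H.1]
    linear_combination (s * w ^ 2 - A * s ^ 3 / 3) * hPφ
  rw [e, abs_mul, abs_of_pos (by positivity : 0 < (∏ j, h j) / 2)]
  calc _ ≤ (∏ j, h j) / 2 * (φ₀ * ((M * C * (C + A * C + L)) + L) * r ^ 2 * |s| +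
        φ₀ * (M * C ^ 2) * r ^ 2 * |s|) := by
        gcongr
        exact (abs_add_le _ _).trans (add_le_add hI hT)
    _ = (∏ j, h j) * φ₀ * (((M * C * (C + A * C + L)) + L + M * C ^ 2) * r ^ 2 * |s|) / 2 := by
        ring
    _ ≤ _ := by
        rw [hPφ, one_mul]
        refine half_le_self ?_
        positivity

/-- The comparison of `(a s + i w)³` with the cube of the square root of `2 a ρ² e^{iθ}`. -/
theorem abs_cube_sub_le {a ρ C K : ℝ} (ha : 0 < a) (hρ : 0 < ρ)
    (hs : |s| ≤ C * ρ) (hw : |w| ≤ C * ρ) (hsθ : 0 ≤ s * Real.cos (θ / 2))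
    (hwθ : 0 ≤ w * Real.sin (θ / 2)) (hsw : s * w = ρ ^ 2 * Real.sin θ)
    (hK : |a ^ 2 * s ^ 2 - w ^ 2 - 2 * a * ρ ^ 2 * Real.cos θ| ≤ K * ρ ^ 4) :
    |(a ^ 3 * s ^ 3 - 3 * a * s * w ^ 2) - (√(2 * a) * ρ) ^ 3 * Real.cos (3 / 2 * θ)| ≤
      K / √(2 * a) * ((a + 1) * C + √(2 * a)) ^ 2 * ρ ^ 5 := by
  set b := √(2 * a) with hb
  have hb0 : 0 < b := Real.sqrt_pos.2 (by positivity)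
  have hb2 : b ^ 2 = 2 * a := Real.sq_sqrt (by positivity)
  have hc : Real.cos θ = 2 * Real.cos (θ / 2) ^ 2 - 1 := by rw [← Real.cos_two_mul]; ring_nf
  have hsn : Real.sin θ = 2 * Real.sin (θ / 2) * Real.cos (θ / 2) := by
    rw [← Real.sin_two_mul]; ring_nf
  have h3 : Real.cos (3 / 2 * θ) = 4 * Real.cos (θ / 2) ^ 3 - 3 * Real.cos (θ / 2) := by
    rw [← Real.cos_three_mul]; ring_nf
  have hcs := Real.sin_sq_add_cos_sq (θ / 2)
  set c := Real.cos (θ / 2)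
  set d := Real.sin (θ / 2)
  set z : ℂ := ⟨a * s, w⟩ with hz
  set z₀ : ℂ := ⟨b * ρ * c, b * ρ * d⟩ with hz₀
  have hz₀n : ‖z₀‖ = b * ρ := by
    rw [← sq_eq_sq₀ (norm_nonneg _) (by positivity), Complex.sq_norm, Complex.normSq_mk]
    linear_combination (b * ρ) ^ 2 * hcs
  -- The difference is real: the product s w is known exactly, so the imaginary parts agree without
  -- error.
  have hdiff : z ^ 2 - z₀ ^ 2 =
      ((a ^ 2 * s ^ 2 - w ^ 2 - 2 * a * ρ ^ 2 * Real.cos θ : ℝ) : ℂ) := by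
    apply Complex.ext
    · simp only [sq, Complex.sub_re, Complex.mul_re, Complex.ofReal_re, hz, hz₀]
      rw [hc]
      linear_combination (-ρ ^ 2 * (c ^ 2 - d ^ 2)) * hb2 + (2 * a * ρ ^ 2) * hcs
    · simp only [sq, Complex.sub_im, Complex.mul_im, Complex.ofReal_im, hz, hz₀]
      rw [hsn] at hsw
      linear_combination 2 * a * hsw - 2 * ρ ^ 2 * c * d * hb2
  -- The sign conditions put z and z₀ in the same closed quadrant. So z is compared with the correct
  -- square root, and dividing by z + z₀ costs only a factor 1/(b ρ).
  have hsum : b * ρ ≤ ‖z + z₀‖ := by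
    rw [← hz₀n, ← sq_le_sq₀ (norm_nonneg _) (norm_nonneg _), Complex.sq_norm, Complex.sq_norm,
      Complex.normSq_apply, Complex.normSq_apply]
    simp only [Complex.add_re, Complex.add_im, hz, hz₀]
    have e1 : 0 ≤ (a * b * ρ) * (s * c) := by positivity
    have e2 : 0 ≤ (b * ρ) * (w * d) := by positivity
    nlinarith [sq_nonneg (a * s), sq_nonneg w]
  have hsub : ‖z - z₀‖ ≤ K / b * ρ ^ 3 := by
    have e : ‖z - z₀‖ * ‖z + z₀‖ ≤ K * ρ ^ 4 := by
      rw [← norm_mul, show (z - z₀) * (z + z₀) = z ^ 2 - z₀ ^ 2 by ring, hdiff, Complex.norm_real]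
      exact hK
    have e2 : ‖z - z₀‖ * (b * ρ) ≤ K * ρ ^ 4 :=
      (mul_le_mul_of_nonneg_left hsum (norm_nonneg _)).trans e
    rw [← le_div_iff₀ (by positivity)] at e2
    refine e2.trans_eq ?_
    field_simp
  have hzn : ‖z‖ ≤ (a + 1) * C * ρ := by
    refine (Complex.norm_le_abs_re_add_abs_im z).trans ?_
    simp only [hz, abs_mul, abs_of_pos ha]
    nlinarith
  have hcube : ‖z ^ 3 - z₀ ^ 3‖ ≤ K / b * ((a + 1) * C + b) ^ 2 * ρ ^ 5 := by
    rw [show z ^ 3 - z₀ ^ 3 = (z - z₀) * (z ^ 2 + z * z₀ + z₀ ^ 2) by ring, norm_mul]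
    have e : ‖z ^ 2 + z * z₀ + z₀ ^ 2‖ ≤ (((a + 1) * C + b) * ρ) ^ 2 := by
      calc _ ≤ ‖z‖ ^ 2 + ‖z‖ * ‖z₀‖ + ‖z₀‖ ^ 2 := by
            refine (norm_add_le _ _).trans (add_le_add ((norm_add_le _ _).trans ?_) ?_)
            · rw [norm_pow, norm_mul]
            · rw [norm_pow]
        _ ≤ (‖z‖ + ‖z₀‖) ^ 2 := by nlinarith [mul_nonneg (norm_nonneg z) (norm_nonneg z₀)]
        _ ≤ _ := by
            gcongr
            rw [hz₀n]
            linarith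
    calc _ ≤ (K / b * ρ ^ 3) * (((a + 1) * C + b) * ρ) ^ 2 :=
          mul_le_mul hsub e (norm_nonneg _) ((norm_nonneg _).trans hsub)
      _ = _ := by ring
  have hre : (a ^ 3 * s ^ 3 - 3 * a * s * w ^ 2) - (b * ρ) ^ 3 * Real.cos (3 / 2 * θ) =
      (z ^ 3 - z₀ ^ 3).re := by
    simp only [pow_succ, pow_zero, one_mul, Complex.sub_re, Complex.mul_re, Complex.mul_im, hz, hz₀]
    rw [h3]
    linear_combination (-3 * b ^ 3 * ρ ^ 3 * c) * hcs
  rw [hre]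
  exact (Complex.abs_re_le_norm _).trans hcube

end Z2Harmonic

end

/-! ### Uniform estimates along the ellipsoid, non-degeneracy and conclusion. -/

noncomputable section

namespace Z2Harmonic

variable {m : ℕ} {h : Fin m → ℝ} {x q : Euc (m + 1)} {s w r θ : ℝ}

theorem abs_coord_le_norm (x : Euc (m + 1)) (j : Fin (m + 1)) : |x j| ≤ ‖x‖ := by
  simpa using PiLp.norm_apply_le x j

theorem norm_le_of_mem_ellipsoid (hpos : ∀ i, 0 < h i) (hq : q ∈ ellipsoid h) :
    ‖q‖ ≤ √(∑ i, h i ^ 2) :=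
  Real.le_sqrt_of_sq_le (by simpa using (isLift_zero_iff.2 hq).norm_sq_le hpos)

theorem abs_tubePoint_sub_le (hq : q ∈ ellipsoid h) (hr : 0 ≤ r) (θ : ℝ) (i : Fin m) :
    |tubePoint h q r θ i.castSucc - q i.castSucc| ≤ r := by
  rw [tubePoint_castSucc, add_sub_cancel_left, abs_mul, abs_mul, abs_of_nonneg hr]
  have h1 := Real.abs_cos_le_one θ
  have h2 := (abs_coord_le_norm (unitNormal h q) i.castSucc).trans_eq
    (norm_unitNormal (conormal_ne_zero hq))
  calc _ ≤ r * 1 * 1 := by gcongr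
    _ = r := by ring

theorem abs_tubePoint_le (hpos : ∀ i, 0 < h i) (hq : q ∈ ellipsoid h) (hr : 0 ≤ r) (hr1 : r ≤ 1)
    (θ : ℝ) (i : Fin m) : |tubePoint h q r θ i.castSucc| ≤ √(∑ i, h i ^ 2) + 1 := by
  have h1 := abs_tubePoint_sub_le hq hr θ i
  have h2 := (abs_coord_le_norm q i.castSucc).trans (norm_le_of_mem_ellipsoid hpos hq)
  have h3 := abs_sub_abs_le_abs_sub (tubePoint h q r θ i.castSucc) (q i.castSucc)
  linarith

theorem exists_norm_conormal_le (hpos : ∀ i, 0 < h i) :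
    ∃ a₁, 0 ≤ a₁ ∧ ∀ q ∈ ellipsoid h, ‖conormal h q‖ ≤ a₁ := by
  obtain ⟨a₁, ha₁⟩ := (isCompact_ellipsoid hpos).exists_bound_of_continuousOn
    (contDiff_conormal h).continuous.continuousOn
  exact ⟨max a₁ 0, le_max_right _ _, fun q hq => (ha₁ q hq).trans (le_max_left _ _)⟩

theorem IsLift.tube_relation (hpos : ∀ i, 0 < h i) (hq : q ∈ ellipsoid h)
    (H : IsLift h (tubePoint h q r θ) s w) :
    s ^ 2 * mixedSlope h (tubePoint h q r θ) s 0 - w ^ 2 =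
      2 * ‖conormal h q‖ * (r * Real.cos θ) +
        (∑ i : Fin m, unitNormal h q i.castSucc ^ 2 / h i ^ 2) * (r * Real.cos θ) ^ 2 := by
  have h1 := H.one_sub_quadric hpos 0
  simp only [ne_eq, OfNat.ofNat_ne_zero, not_false_eq_true, zero_pow, zero_add, sub_zero] at h1
  rw [quadForm_tubePoint hq] at h1
  linarith

set_option maxHeartbeats 2000000 in
/-- The signed coordinates are of the order of the square root of the distance to the branching
set. -/
theorem exists_tube_bound (hpos : ∀ i, 0 < h i) :
    ∃ r₁ C, 0 < r₁ ∧ r₁ ≤ tubeRadius h ∧ r₁ ≤ 1 ∧ 0 ≤ C ∧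
      ∀ q ∈ ellipsoid h, ∀ r, 0 < r → r < r₁ → ∀ θ s w, IsLift h (tubePoint h q r θ) s w →
        s ^ 2 ≤ C * r ∧ w ^ 2 ≤ C * r := by
  obtain ⟨a₁, ha₁, hcon⟩ := exists_norm_conormal_le hpos
  set D := √(∑ i, h i ^ 2) with hD
  have hD0 : 0 ≤ D := Real.sqrt_nonneg _
  have hD2 : D ^ 2 = ∑ i, h i ^ 2 := Real.sq_sqrt (by positivity)
  set M := ∑ i, 1 / h i ^ 2 with hM
  have hM0 : 0 ≤ M := by positivity
  set G₁ := ∑ i, (D + 1) ^ 2 / (h i ^ 2 * h i ^ 2) with hG₁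
  have hG₁0 : 0 ≤ G₁ := by positivity
  -- Chosen so that K² ≥ (2 a₁ + M)² + 4 G₁, as needed for `hsum`; the radius 1/(2K) then makes w²
  -- at most 1/2.
  set K := 2 * a₁ + M + 2 * G₁ + 1 with hK
  have hK0 : 0 < K := by positivity
  refine ⟨min (min (tubeRadius h) 1) (1 / (2 * K)), K * (1 + 2 * D ^ 2),
    lt_min (lt_min (tubeRadius_pos h) one_pos) (by positivity),
    (min_le_left _ _).trans (min_le_left _ _), (min_le_left _ _).trans (min_le_right _ _),
    by positivity, fun q hq r hr hr1 θ s w H => ?_⟩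
  have hrone : r ≤ 1 := (hr1.le.trans (min_le_left _ _)).trans (min_le_right _ _)
  have hrK : K * r ≤ 1 / 2 := by
    have := hr1.le.trans (min_le_right _ _)
    rw [le_div_iff₀ (by positivity)] at this
    linarith
  have hrel := H.tube_relation hpos hq
  have hκ := quadForm_unitNormal_le hq
  have hκ0 : 0 ≤ ∑ i : Fin m, unitNormal h q i.castSucc ^ 2 / h i ^ 2 := by positivity
  have ha := hcon q hq
  set κ := ∑ i : Fin m, unitNormal h q i.castSucc ^ 2 / h i ^ 2
  set G := mixedSlope h (tubePoint h q r θ) s 0 with hG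
  have hG0 : 0 ≤ G := by
    rw [hG, mixedSlope]
    positivity
  have hGle : G ≤ G₁ := by
    rw [hG, mixedSlope, hG₁]
    refine Finset.sum_le_sum fun i _ => ?_
    have h1 := abs_tubePoint_le hpos hq hr.le hrone θ i
    have h2 := pow_pos (hpos i) 2
    rw [← sq_abs]
    gcongr
    · nlinarith [sq_nonneg s]
    · nlinarith
  have hcos := Real.abs_cos_le_one θ
  have hQ : |2 * ‖conormal h q‖ * (r * Real.cos θ) + κ * (r * Real.cos θ) ^ 2| ≤
      (2 * a₁ + M) * r := by
    have hrc : |r * Real.cos θ| ≤ r := by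
      rw [abs_mul, abs_of_pos hr]
      nlinarith
    refine (abs_add_le _ _).trans ?_
    rw [abs_mul, abs_mul κ, abs_of_nonneg hκ0, abs_of_nonneg (by positivity :
      0 ≤ 2 * ‖conormal h q‖), abs_pow]
    calc _ ≤ 2 * a₁ * r + M * r ^ 2 := by gcongr
      _ ≤ _ := by nlinarith [mul_nonneg hM0 hr.le]
  have hsw : s ^ 2 * w ^ 2 ≤ r ^ 2 := by
    rw [← mul_pow, H.1, tubePoint_last hq, mul_pow]
    nlinarith [Real.sin_sq_le_one θ, sq_nonneg r]
  have hsum : s ^ 2 * G + w ^ 2 ≤ K * r := by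
    refine abs_le_of_sq_le_sq' ?_ (by positivity) |>.2
    -- The difference s² G - w² and the product s² w² are controlled by the lift equations; this
    -- identity converts them into a bound on the sum.
    have e : (s ^ 2 * G + w ^ 2) ^ 2 = (s ^ 2 * G - w ^ 2) ^ 2 + 4 * G * (s ^ 2 * w ^ 2) := by ring
    rw [e, hrel, ← sq_abs]
    calc _ ≤ ((2 * a₁ + M) * r) ^ 2 + 4 * G₁ * r ^ 2 := by gcongr
      _ ≤ (K * r) ^ 2 := by
        rw [mul_pow, mul_pow, ← add_mul]
        gcongr
        rw [hK]
        nlinarith [mul_nonneg ha₁ hG₁0, mul_nonneg hM0 hG₁0]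
  have hw : w ^ 2 ≤ K * r := by nlinarith [mul_nonneg (sq_nonneg s) hG0]
  -- A lower bound for G, needed to pass from s² G = O(r) to s² = O(r). It holds because 1 - w² ≤ D²
  -- G and w² ≤ 1/2.
  have hGD : 1 ≤ 2 * D ^ 2 * G := by
    have h1 : 1 - w ^ 2 ≤ D ^ 2 * G := by
      rw [← H.2, add_sub_cancel_right, hG, mixedSlope, Finset.mul_sum]
      refine Finset.sum_le_sum fun i _ => ?_
      have h2 := pow_pos (hpos i) 2
      have h3 := sq_add_sq_pos hpos s i
      have h4 : h i ^ 2 ≤ D ^ 2 := by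
        rw [hD2]
        exact Finset.single_le_sum (f := fun i => h i ^ 2) (fun _ _ => sq_nonneg _)
          (Finset.mem_univ i)
      rw [mul_div_assoc', div_le_div_iff₀ h3 (by positivity)]
      have h5 : 0 ≤ tubePoint h q r θ i.castSucc ^ 2 * (s ^ 2 + h i ^ 2) := by positivity
      nlinarith [mul_le_mul_of_nonneg_left h4 h5]
    linarith
  refine ⟨?_, ?_⟩
  · have h1 : s ^ 2 ≤ s ^ 2 * (2 * D ^ 2 * G) := le_mul_of_one_le_right (sq_nonneg s) hGD
    have h2 : s ^ 2 * G ≤ K * r := by nlinarith [sq_nonneg w]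
    calc s ^ 2 ≤ 2 * D ^ 2 * (s ^ 2 * G) := by linarith
      _ ≤ 2 * D ^ 2 * (K * r) := by gcongr
      _ ≤ _ := by nlinarith [mul_pos hK0 hr]
  · refine hw.trans ?_
    nlinarith [mul_nonneg (mul_nonneg hK0.le hr.le) (sq_nonneg D)]

/-- At q with both parameters zero the mixed slope is exactly ‖conormal‖². The point moves by at
most r and the squared parameters by at most C r, uniformly in q. -/
theorem exists_mixedSlope_bound (hpos : ∀ i, 0 < h i) {C : ℝ} (hC : 0 ≤ C) :
    ∃ K, 0 ≤ K ∧ ∀ q ∈ ellipsoid h, ∀ r, 0 < r → r ≤ 1 → ∀ θ s u : ℝ, s ^ 2 ≤ C * r →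
      u ^ 2 ≤ s ^ 2 →
        |‖conormal h q‖ ^ 2 - mixedSlope h (tubePoint h q r θ) s u| ≤ K * r := by
  set D := √(∑ i, h i ^ 2) with hD
  have hD0 : 0 ≤ D := Real.sqrt_nonneg _
  refine ⟨∑ i, ((2 * D + 1) / (h i ^ 2) ^ 2 +
    (D + 1) ^ 2 * ((C ^ 2 + 2 * h i ^ 2 * C) / (h i ^ 2) ^ 4)), by positivity,
    fun q hq r hr hr1 θ s u hs hu => ?_⟩
  rw [norm_conormal_sq, mixedSlope, ← Finset.sum_sub_distrib, Finset.sum_mul]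
  refine (Finset.abs_sum_le_sum_abs _ _).trans (Finset.sum_le_sum fun i _ => ?_)
  have hP := pow_pos (hpos i) 2
  set P := h i ^ 2
  have h1 := abs_tubePoint_sub_le hq hr.le θ i
  have h2 := abs_tubePoint_le hpos hq hr.le hr1 θ i
  have h3 := (abs_coord_le_norm q i.castSucc).trans (norm_le_of_mem_ellipsoid hpos hq)
  rw [← hD] at h2 h3
  set y := tubePoint h q r θ i.castSucc
  set z := q i.castSucc
  have hs0 := sq_nonneg s
  have hu0 := sq_nonneg u
  set α := s ^ 2
  set β := u ^ 2
  have hβ : β ≤ C * r := hu.trans hs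
  have hCr : C * r ≤ C := mul_le_of_le_one_right hC hr1
  have e : z ^ 2 / P ^ 2 - y ^ 2 / ((α + P) * (β + P)) =
      (z - y) * (z + y) / P ^ 2 + y ^ 2 * ((α * β + P * (α + β)) / (P ^ 2 * ((α + P) * (β + P)))) := by
    field_simp
    ring
  have t1 : |(z - y) * (z + y) / P ^ 2| ≤ (2 * D + 1) / P ^ 2 * r := by
    rw [abs_div, abs_mul, abs_of_pos (by positivity : 0 < P ^ 2), abs_sub_comm, div_mul_eq_mul_div]
    have h4 : |z + y| ≤ 2 * D + 1 := (abs_add_le _ _).trans (by linarith)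
    rw [mul_comm]
    gcongr
  have t2 : |y ^ 2 * ((α * β + P * (α + β)) / (P ^ 2 * ((α + P) * (β + P))))| ≤
      (D + 1) ^ 2 * ((C ^ 2 + 2 * P * C) / P ^ 4) * r := by
    rw [abs_of_nonneg (by positivity), ← sq_abs, mul_assoc, div_mul_eq_mul_div]
    have h5 : α * β ≤ C ^ 2 * r := by
      calc α * β ≤ C * (C * r) := mul_le_mul (hs.trans hCr) hβ hu0 hC
        _ = _ := by ring
    have h6 : P * (α + β) ≤ 2 * P * C * r := by
      calc P * (α + β) ≤ P * (C * r + C * r) := by gcongr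
        _ = _ := by ring
    gcongr
    · linarith
    · calc P ^ 4 = P ^ 2 * (P * P) := by ring
        _ ≤ P ^ 2 * ((α + P) * (β + P)) := by
          gcongr <;> linarith
  rw [e]
  exact ((abs_add_le _ _).trans (add_le_add t1 t2)).trans_eq (add_mul _ _ r).symm

/-- The leading coefficient of the harmonic function at the branching set. -/
def leadingCoeff (h : Fin m → ℝ) (q : Euc (m + 1)) : ℝ :=
  -(√(2 * ‖conormal h q‖) ^ 3 / (3 * ‖conormal h q‖))

theorem leadingCoeff_ne_zero (hq : conormal h q ≠ 0) : leadingCoeff h q ≠ 0 := by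
  have : 0 < ‖conormal h q‖ := norm_pos_iff.2 hq
  unfold leadingCoeff
  exact neg_ne_zero.2 (by positivity)

theorem contDiffAt_leadingCoeff (hq : conormal h q ≠ 0) :
    ContDiffAt ℝ ∞ (leadingCoeff h) q := by
  have h0 : 0 < ‖conormal h q‖ := norm_pos_iff.2 hq
  have h1 : ContDiffAt ℝ ∞ (fun q => ‖conormal h q‖) q :=
    (contDiff_conormal h).contDiffAt.norm ℝ hq
  have h2 := (contDiffAt_const (c := (2 : ℝ))).mul h1
  exact (((h2.sqrt (by positivity)).pow 3).div ((contDiffAt_const (c := (3 : ℝ))).mul h1)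
    (by positivity)).neg

theorem re_leadingTerm (β r θ : ℝ) :
    ((β : ℂ) * ((r ^ (3 / 2 : ℝ) : ℝ) : ℂ) * Complex.exp (3 / 2 * θ * Complex.I)).re =
      β * r ^ (3 / 2 : ℝ) * Real.cos (3 / 2 * θ) := by
  have : (3 / 2 * θ * Complex.I : ℂ) = ((3 / 2 * θ : ℝ) : ℂ) * Complex.I := by push_cast; ring
  rw [this, ← Complex.ofReal_mul, Complex.re_ofReal_mul, Complex.exp_ofReal_mul_I_re]

set_option maxHeartbeats 2000000 in
/-- The expansion of the harmonic function near the branching set. -/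
theorem exists_expansion (hpos : ∀ i, 0 < h i) :
    ∃ r₁ K, 0 < r₁ ∧ r₁ ≤ tubeRadius h ∧ ∀ q ∈ ellipsoid h, ∀ r, 0 < r → r < r₁ → ∀ θ,
      |potential h (tubePoint h q r θ) (tubeS h hpos q r θ) (tubeW h hpos q r θ) -
        leadingCoeff h q * r ^ (3 / 2 : ℝ) * Real.cos (3 / 2 * θ)| ≤ K * r ^ (5 / 2 : ℝ) := by
  obtain ⟨a₁, ha₁, hcon⟩ := exists_norm_conormal_le hpos
  obtain ⟨r₁, C, hr₁, hr₁t, hr₁1, hC, hbd⟩ := exists_tube_bound hpos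
  obtain ⟨K, hK, hslope⟩ := exists_mixedSlope_bound hpos hC
  set D := √(∑ i, h i ^ 2) with hD
  have hD0 : 0 ≤ D := Real.sqrt_nonneg _
  set M := ∑ i, 1 / h i ^ 2 with hM
  have hM0 : 0 ≤ M := by positivity
  set L := C * K + C ^ 2 * M with hL
  have hL0 : 0 ≤ L := by positivity
  refine ⟨r₁, (M * C * (C + a₁ ^ 2 * C + L) + L + M * C ^ 2) * √C +
    D / 3 * ((C * K + M) * √D * ((a₁ + 1) * √C + √(2 * a₁)) ^ 2), hr₁, hr₁t,
    fun q hq r hr hr' θ => ?_⟩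
  have hr1 : r ≤ 1 := hr'.le.trans hr₁1
  have H := isLift_tube hpos hq hr (hr'.trans_le hr₁t) θ
  obtain ⟨hs, hw⟩ := hbd q hq r hr hr' θ _ _ H
  have hsθ : 0 ≤ tubeS h hpos q r θ * Real.cos (θ / 2) := by
    rw [tubeS, mul_right_comm, sign_mul_self]
    exact mul_nonneg (abs_nonneg _) (absS_nonneg hpos _)
  have hwθ : 0 ≤ tubeW h hpos q r θ * Real.sin (θ / 2) := by
    rw [tubeW, mul_right_comm, sign_mul_self]
    exact mul_nonneg (abs_nonneg _) (absW_nonneg hpos _)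
  set s := tubeS h hpos q r θ
  set w := tubeW h hpos q r θ
  set a := ‖conormal h q‖ with ha
  have ha0 : 0 < a := norm_pos_iff.2 (conormal_ne_zero hq)
  have haa₁ : a ≤ a₁ := hcon q hq
  have haD : 1 ≤ a * D := one_le_norm_conormal_mul hpos hq
  set ρ := √r with hρ
  have hρ0 : 0 < ρ := Real.sqrt_pos.2 hr
  have hρ2 : ρ ^ 2 = r := Real.sq_sqrt hr.le
  have hr3 : r ^ (3 / 2 : ℝ) = ρ ^ 3 := by
    rw [hρ, Real.sqrt_eq_rpow, ← Real.rpow_natCast, ← Real.rpow_mul hr.le]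
    norm_num
  have hr5 : r ^ (5 / 2 : ℝ) = ρ ^ 5 := by
    rw [hρ, Real.sqrt_eq_rpow, ← Real.rpow_natCast, ← Real.rpow_mul hr.le]
    norm_num
  have habs : ∀ t : ℝ, t ^ 2 ≤ C * r → |t| ≤ √C * ρ := fun t ht => by
    rw [hρ, ← Real.sqrt_mul hC]
    exact Real.abs_le_sqrt ht
  have hG := hslope q hq r hr hr1 θ s
  have t1 := H.abs_potential_sub_cubic_le hpos (sq_nonneg a) hC hK hr hr1 hs hw
    fun u hu => hG u hs hu
  have hsw : s * w = ρ ^ 2 * Real.sin θ := by rw [H.1, tubePoint_last hq, hρ2]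
  have hquad : |a ^ 2 * s ^ 2 - w ^ 2 - 2 * a * ρ ^ 2 * Real.cos θ| ≤ (C * K + M) * ρ ^ 4 := by
    have hrel := H.tube_relation hpos hq
    have hκ := quadForm_unitNormal_le hq
    have hκ0 : 0 ≤ ∑ i : Fin m, unitNormal h q i.castSucc ^ 2 / h i ^ 2 := by positivity
    have e : a ^ 2 * s ^ 2 - w ^ 2 - 2 * a * ρ ^ 2 * Real.cos θ =
        s ^ 2 * (a ^ 2 - mixedSlope h (tubePoint h q r θ) s 0) +
        (∑ i : Fin m, unitNormal h q i.castSucc ^ 2 / h i ^ 2) * (r * Real.cos θ) ^ 2 := by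
      rw [hρ2]
      linear_combination hrel
    rw [e]
    refine (abs_add_le _ _).trans ?_
    rw [abs_mul, abs_of_nonneg (sq_nonneg s), abs_of_nonneg (by positivity : 0 ≤
      (∑ i : Fin m, unitNormal h q i.castSucc ^ 2 / h i ^ 2) * (r * Real.cos θ) ^ 2)]
    have hcos : (r * Real.cos θ) ^ 2 ≤ r ^ 2 := by
      rw [mul_pow]
      nlinarith [Real.cos_sq_le_one θ, sq_nonneg r]
    calc _ ≤ C * r * (K * r) + M * r ^ 2 := by
          gcongr
          exact hG 0 hs (by simpa using sq_nonneg s)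
      _ = _ := by rw [← hρ2]; ring
  have t2 := abs_cube_sub_le ha0 hρ0 (habs s hs) (habs w hw) hsθ hwθ hsw hquad
  have hb0 : 0 < √(2 * a) := Real.sqrt_pos.2 (by positivity)
  -- The negative powers of a are made uniform in q by 1 ≤ a D; the positive ones are bounded by a₁
  -- from compactness.
  have hbD : 1 / √(2 * a) ≤ √D := by
    rw [div_le_iff₀ hb0, ← Real.sqrt_mul hD0]
    exact Real.one_le_sqrt.2 (by nlinarith)
  have hCK : 0 ≤ C * K + M := by positivity
  have t3 : |(s * w ^ 2 - a ^ 2 * s ^ 3 / 3) -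
      leadingCoeff h q * r ^ (3 / 2 : ℝ) * Real.cos (3 / 2 * θ)| ≤
        D / 3 * ((C * K + M) * √D * ((a₁ + 1) * √C + √(2 * a₁)) ^ 2) * ρ ^ 5 := by
    -- The cubic is -1/(3a) times the real part of (a s + i w)³, which explains the form of
    -- `leadingCoeff`.
    have e : (s * w ^ 2 - a ^ 2 * s ^ 3 / 3) -
        leadingCoeff h q * r ^ (3 / 2 : ℝ) * Real.cos (3 / 2 * θ) = -(1 / (3 * a)) *
        ((a ^ 3 * s ^ 3 - 3 * a * s * w ^ 2) - (√(2 * a) * ρ) ^ 3 * Real.cos (3 / 2 * θ)) := by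
      rw [hr3, leadingCoeff, ← ha]
      field_simp
      ring
    have h3a : 1 / (3 * a) ≤ D / 3 := by
      rw [div_le_div_iff₀ (by positivity) (by positivity)]
      nlinarith
    rw [e, abs_mul, abs_neg, abs_of_pos (by positivity : 0 < 1 / (3 * a))]
    calc _ ≤ D / 3 * ((C * K + M) / √(2 * a) * ((a + 1) * √C + √(2 * a)) ^ 2 * ρ ^ 5) := by
          gcongr
      _ ≤ D / 3 * ((C * K + M) * √D * ((a₁ + 1) * √C + √(2 * a₁)) ^ 2 * ρ ^ 5) := by
          rw [div_eq_mul_one_div (C * K + M)]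
          gcongr
      _ = _ := by ring
  have t1' : |potential h (tubePoint h q r θ) s w - (s * w ^ 2 - a ^ 2 * s ^ 3 / 3)| ≤
      (M * C * (C + a₁ ^ 2 * C + L) + L + M * C ^ 2) * √C * ρ ^ 5 := by
    refine t1.trans ?_
    calc _ ≤ (M * C * (C + a₁ ^ 2 * C + L) + L + M * C ^ 2) * r ^ 2 * (√C * ρ) := by
          gcongr
          exact habs s hs
      _ = _ := by rw [← hρ2]; ring
  rw [hr5, add_mul]
  refine le_trans ?_ (add_le_add t1' t3)
  refine le_trans (le_of_eq ?_) (abs_add_le _ _)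
  congr 1
  ring

theorem isNondegenerate_harmonicFn (hpos : ∀ i, 0 < h i) :
    IsNondegenerate (ellipsoid h) (rotation h) (cover h hpos) (harmonicFn h) := by
  classical
  intro p hp
  obtain ⟨r₁, K, hr₁, hr₁t, hexp⟩ := exists_expansion hpos
  have hr₀ : r₁ / 2 ∈ Ioo 0 (tubeRadius h) := ⟨by positivity, by linarith⟩
  -- The second branch is only a default value that makes the map total; it is never used on the
  -- domain of the expansion.
  set Λ : Euc (m + 1) × ℝ × ℝ → Cover h := fun z =>
    if hz : z.1 ∈ ellipsoid h ∧ z.2.1 ∈ Ioo 0 (tubeRadius h) then tubeLift hpos hz.1 hz.2 z.2.2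
    else tubeLift hpos hp hr₀ 0 with hΛ
  have hΛeq : ∀ z : Euc (m + 1) × ℝ × ℝ, z.1 ∈ ellipsoid h → z.2.1 ∈ Ioo 0 r₁ →
      (Λ z).pt = tubePoint h z.1 z.2.1 z.2.2 ∧ (Λ z).sCoord = tubeS h hpos z.1 z.2.1 z.2.2 ∧
        (Λ z).wCoord = tubeW h hpos z.1 z.2.1 z.2.2 := by
    intro z hz hz'
    have : z.1 ∈ ellipsoid h ∧ z.2.1 ∈ Ioo 0 (tubeRadius h) :=
      ⟨hz, hz'.1, hz'.2.trans_le hr₁t⟩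
    simp only [hΛ, dif_pos this]
    exact ⟨rfl, rfl, rfl⟩
  have hsub : (ellipsoid h ∩ {x | conormal h x ≠ 0}) ×ˢ (Ioo 0 r₁ ×ˢ (univ : Set ℝ)) ⊆
      ellipsoid h ×ˢ (Ioo 0 (tubeRadius h) ×ˢ univ) :=
    fun z hz => ⟨hz.1.1, ⟨hz.2.1.1, hz.2.1.2.trans_le hr₁t⟩, trivial⟩
  refine ⟨{x | conormal h x ≠ 0}, unitNormal h, fun q => (leadingCoeff h q : ℂ), r₁, K, Λ,
    isOpen_ne_fun (contDiff_conormal h).continuous continuous_const, conormal_ne_zero hp,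
    fun x hx => (contDiffAt_unitNormal hx).contDiffWithinAt,
    fun x hx => (Complex.ofRealCLM.contDiff.contDiffAt.comp x
      (contDiffAt_leadingCoeff hx)).contDiffWithinAt, hr₁, ?_, ?_, ?_⟩
  · rintro q ⟨hq, hq'⟩
    refine ⟨(mem_normalSpace_iff hq).2 ⟨1, 0, by simp⟩, norm_unitNormal hq', ?_⟩
    exact Complex.ofReal_ne_zero.2 (leadingCoeff_ne_zero hq')
  · refine Cover.continuousOn_iff.2 ⟨?_, ?_, ?_⟩
    · exact ((continuousOn_tubePoint h).mono hsub).congr fun z hz => (hΛeq z hz.1.1 hz.2.1).1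
    · exact ((continuousOn_tubeS hpos).mono hsub).congr fun z hz => (hΛeq z hz.1.1 hz.2.1).2.1
    · exact ((continuousOn_tubeW hpos).mono hsub).congr fun z hz => (hΛeq z hz.1.1 hz.2.1).2.2
  · rintro q ⟨hq, -⟩ r hr θ
    obtain ⟨e1, e2, e3⟩ := hΛeq (q, r, θ) hq hr
    refine ⟨?_, ?_⟩
    · rw [normalPoint_unitNormal hq]
      exact e1
    · rw [re_leadingTerm, harmonicFn, e1, e2, e3]
      exact hexp q hq r hr.1 hr.2 θ

theorem isZ2HarmonicFunction_harmonicFn (hpos : ∀ i, 0 < h i) :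
    IsZ2HarmonicFunction (ellipsoid h) (rotation h) (cover h hpos) (harmonicFn h) where
  isCompact := isCompact_ellipsoid hpos
  isSubmanifold := isCodimTwoSubmanifold_ellipsoid h
  isCoorientation := isCoorientation_rotation h
  monodromy := hasMonodromyNegOne_cover hpos
  odd := harmonicFn_deck
  harmonic _ _ hV hg := harmonicOnNhd_of_isBranchOn hpos hV hg
  locallyL2 := isLocallyL2_absValue hpos
  gradient_locallyL2 := isLocallyL2_gradNorm hpos

end Z2Harmonic

end

open Z2Harmonic in
/-- Here the dimension is `n = m + 1 ≥ 3`. -/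
theorem theorem1p1 (m : ℕ) (hm : 2 ≤ m) (h : Fin m → ℝ) (hpos : ∀ i, 0 < h i) :
    (IntegrableOn (integrandConst h) (Ioi 0) ∧ (∀ i, IntegrableOn (integrandSide h i) (Ioi 0)) ∧
      IntegrableOn (integrandLast h) (Ioi 0)) ∧
    ∃ (J : Euc (m + 1) → Euc (m + 1) →L[ℝ] Euc (m + 1)) (C : DoubleCover (ellipsoid h))
      (f : C.X → ℝ),
      IsZ2HarmonicFunction (ellipsoid h) J C f ∧
      IsNondegenerate (ellipsoid h) J C f ∧
      ∃ (R : ℝ) (g : Euc (m + 1) → ℝ), C.IsBranchOn f {x | R < ‖x‖} g ∧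
        (fun x : Euc (m + 1) => g x - (coeffConst h -
            (∑ i : Fin m, coeffSide h i * x i.castSucc ^ 2 + coeffLast h * x (Fin.last m) ^ 2)))
          =O[Bornology.cobounded (Euc (m + 1))]
            fun x => ‖x‖ ^ ((2 : ℤ) - ((m + 1 : ℕ) : ℤ)) := by
  refine ⟨⟨integrableOn_integrandConst hpos hm, integrableOn_integrandSide hpos,
    integrableOn_integrandLast hpos⟩, rotation h, cover h hpos, harmonicFn h,
    isZ2HarmonicFunction_harmonicFn hpos, isNondegenerate_harmonicFn hpos, √(∑ i, h i ^ 2), _,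
    isBranchOn_outside hpos, isBigO_outside hpos hm⟩
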